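/- **Setting.** A Smale space is a homeomorphism $\varphi$ of a compact metric space $X$ with a bracket $[\cdot,\cdot]$, defined for points at distance at most some $\varepsilon_X>0$, satisfying the usual axioms; $X^s(x)$, $X^u(x)$ are the stable and unstable sets, with their intrinsic topologies (basic neighbourhoods: the local stable, resp. unstable, sets). A map (continuous and equivariant) $f$ of Smale spaces is $s$-bijective (resp. $u$-bijective) if $f\colon X^s(x)\to Y^s(f(x))$ (resp. $f\colon X^u(x)\to Y^u(f(x))$) is a bijection for every $x$. An $s/u$-bijective pair $\pi=(Y,\psi,\pi_s,Z,\zeta,\pi_u)$ for $(X,\varphi)$ consists of Smale spaces $(Y,\psi)$, $(Z,\zeta)$, a surjective $s$-bijective map $\pi_s\colon Y\to X$ and a surjective $u$-bijective map $\pi_u\colon Z\to X$, such that all unstable sets of $Y$ and all stable sets of $Z$ are totally disconnected. For $L,M\ge 0$ let $$\Sigma_{L,M}=\{(y_0,\dots,y_L,z_0,\dots,z_M)\mid y_l\in Y,\ z_m\in Z,\ \pi_s(y_l)=\pi_u(z_m)\ \text{for all } l,m\},$$ with the coordinatewise dynamics and bracket. For such a space $\Sigma$ with dynamics $\sigma$,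 let $CO^s(\Sigma)$ be the family of compact open subsets of the stable sets $\Sigma^s(e)$, $e\in\Sigma$, and let $\sim$ be the smallest equivalence relation on it such that $E\sim F$ whenever $E$ and $F$ are contained in local stable sets, $[E,F]$ and $[F,E]$ are defined, and $[E,F]=E$, $[F,E]=F$; and such that $E\sim F$ if and only if $\sigma(E)\sim\sigma(F)$. The dimension group $D^s(\Sigma)$ is the free abelian group on the $\sim$-classes $[E]$ modulo the subgroup generated by the elements $[E\cup F]-[E]-[F]$, for disjoint $E,F\in CO^s(\Sigma)$ with $E\cup F\in CO^s(\Sigma)$. The maps below between the spaces $\Sigma_{L,M}$ that delete, repeat or permute the entries $y_l$ are $s$-bijective and induce homomorphisms $f^s\colon[E]\mapsto[f(E)]$. Put $C_{L,M}=D^s(\Sigma_{L,M})$ and $\partial^s=\sum_{l=0}^{L}(-1)^l\delta_l^s\colon C_{L,M}\to C_{L-1,M}$, where $\delta_l$ deletes the entry $y_l$ (and $\partial^s=0$ on $C_{0,M}$). For $L\ge1$, $0\le l\le L-1$ and $1\le j\le L-l$, let $\sigma_js_l\colon\Sigma_{L-1,M}\to\Sigma_{L,M}$ be the map that repeats $y_l$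 at coordinate $l+j$, $$(y_0,\dots,y_{L-1},z)\mapsto(y_0,\dots,y_l,\dots,y_{l+j-1},\,y_l,\,y_{l+j},\dots,y_{L-1},z).$$ Let the symmetric group $S_{L+1}$ act on $C_{L,M}$ by permuting $y_0,\dots,y_L$, and let $DC_{L,M}\subseteq C_{L,M}$ be the subgroup generated by the images $(\sigma_js_l)^s(C_{L-1,M})$ (none if $L=0$) and by all elements $\alpha(a)-\operatorname{sgn}(\alpha)a$ with $\alpha\in S_{L+1}$, $a\in C_{L,M}$. These subgroups form a subcomplex $DC_{\bullet,M}$ of the chain complex $(C_{\bullet,M},\partial^s)$. **Theorem.** Let $\pi$ be an $s/u$-bijective pair for a Smale space $(X,\varphi)$ and let $M\ge0$. In the short exact sequence of chain complexes $$0\to DC_{\bullet,M}\to C_{\bullet,M}\to C_{\bullet,M}/DC_{\bullet,M}\to0$$ the complex $DC_{\bullet,M}$ is acyclic; hence the projection $C_{\bullet,M}\to C_{\bullet,M}/DC_{\bullet,M}$ is a quasi-isomorphism. -/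

import Mathlib

namespace SmaleHomology

open Filter Topology

/-- `x` and `y` are asymptotic under `f`: `d(fⁿ x, fⁿ y) → 0`. -/
def Asymptotic {X : Type*} [MetricSpace X] (f : X → X) (x y : X) : Prop :=
  Tendsto (fun n : ℕ => dist (f^[n] x) (f^[n] y)) atTop (𝓝 0)

/-- The points asymptotic to `x` whose whole forward `f`-orbit stays `δ`-close to that of `x`. -/
def localSet {X : Type*} [MetricSpace X] (f : X → X) (x : X) (δ : ℝ) : Set X :=
  {y | Asymptotic f x y ∧ ∀ n : ℕ, dist (f^[n] x) (f^[n] y) < δ}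

/-- The topology in which the sets `localSet f x δ`, `δ > 0`, are basic neighbourhoods of `x`.
Each asymptotic class is open, and carries its intrinsic (inductive limit) topology. -/
@[reducible]
def leafTopology {X : Type*} [MetricSpace X] (f : X → X) : TopologicalSpace X where
  IsOpen U := ∀ x ∈ U, ∃ δ > 0, localSet f x δ ⊆ U
  isOpen_univ := fun _ _ => ⟨1, one_pos, Set.subset_univ _⟩
  isOpen_inter := by
    rintro U V hU hV x ⟨hxU, hxV⟩
    obtain ⟨a, ha, hUa⟩ := hU x hxU
    obtain ⟨b, hb, hVb⟩ := hV x hxV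
    refine ⟨min a b, lt_min ha hb, fun y hy => ⟨hUa ⟨hy.1, fun n => ?_⟩, hVb ⟨hy.1, fun n => ?_⟩⟩⟩
    · exact (hy.2 n).trans_le (min_le_left _ _)
    · exact (hy.2 n).trans_le (min_le_right _ _)
  isOpen_sUnion := by
    rintro 𝒰 h𝒰 x ⟨U, hU, hxU⟩
    obtain ⟨a, ha, hUa⟩ := h𝒰 U hU x hxU
    exact ⟨a, ha, hUa.trans (Set.subset_sUnion_of_mem hU)⟩

/-- A Smale space structure `(φ, [·,·], ε, λ)` on a (compact) metric space. The bracket is only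
meaningful for pairs of points at distance at most `ε`; `[x, y]` is the intersection of the
local stable set of `x` with the local unstable set of `y`. -/
structure SmaleSpace (X : Type*) [MetricSpace X] where
  φ : X ≃ₜ X
  bracket : X → X → X
  eps : ℝ
  lam : ℝ
  eps_pos : 0 < eps
  lam_pos : 0 < lam
  lam_lt_one : lam < 1
  continuousOn_bracket :
    ContinuousOn (fun p : X × X => bracket p.1 p.2) {p | dist p.1 p.2 ≤ eps}
  bracket_self : ∀ x, bracket x x = x
  bracket_right : ∀ x y z, dist y z ≤ eps → dist x (bracket y z) ≤ eps → dist x z ≤ eps →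
    bracket x (bracket y z) = bracket x z
  bracket_left : ∀ x y z, dist x y ≤ eps → dist (bracket x y) z ≤ eps → dist x z ≤ eps →
    bracket (bracket x y) z = bracket x z
  map_bracket : ∀ x y, dist x y ≤ eps → dist (φ x) (φ y) ≤ eps →
    φ (bracket x y) = bracket (φ x) (φ y)
  contract : ∀ y z, dist y z ≤ eps → bracket y z = z → dist (φ y) (φ z) ≤ lam * dist y z
  expand : ∀ y z, dist y z ≤ eps → bracket y z = y →
    dist (φ.symm y) (φ.symm z) ≤ lam * dist y z

namespace SmaleSpace

variable {X : Type*} [MetricSpace X]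

/-- The global stable set `X^s(x)`. -/
def stableSet (S : SmaleSpace X) (x : X) : Set X := {y | Asymptotic S.φ x y}

/-- The global unstable set `X^u(x)`. -/
def unstableSet (S : SmaleSpace X) (x : X) : Set X := {y | Asymptotic S.φ.symm x y}

/-- The same space run backwards in time. -/
def reverse (S : SmaleSpace X) : SmaleSpace X where
  φ := S.φ.symm
  bracket x y := S.bracket y x
  eps := S.eps
  lam := S.lam
  eps_pos := S.eps_pos
  lam_pos := S.lam_pos
  lam_lt_one := S.lam_lt_one
  continuousOn_bracket := by
    refine S.continuousOn_bracket.comp continuous_swap.continuousOn ?_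
    intro p hp
    simpa [dist_comm] using hp
  bracket_self := S.bracket_self
  bracket_right x y z h1 h2 h3 := by
    rw [dist_comm] at h1 h2 h3
    exact S.bracket_left z y x h1 h2 h3
  bracket_left x y z h1 h2 h3 := by
    rw [dist_comm] at h1 h2 h3
    exact S.bracket_right z y x h1 h2 h3
  map_bracket x y h1 h2 := by
    rw [dist_comm] at h1 h2
    have := S.map_bracket (S.φ.symm y) (S.φ.symm x) h2 (by simpa using h1)
    rw [S.φ.symm_apply_eq, this]
    simp
  contract y z h1 h2 := by
    rw [dist_comm] at h1
    rw [dist_comm, dist_comm y z]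
    exact S.expand z y h1 h2
  expand y z h1 h2 := by
    rw [dist_comm] at h1
    rw [dist_comm, dist_comm y z]
    exact S.contract z y h1 h2

lemma near_diag [CompactSpace X] (S : SmaleSpace X) {η : ℝ} (hη : 0 < η) :
    ∃ δ > 0, δ ≤ S.eps ∧ ∀ x y, dist x y ≤ δ →
      dist (S.bracket x y) x < η ∧ dist (S.bracket x y) y < η := by
  have hc : IsCompact {p : X × X | dist p.1 p.2 ≤ S.eps} :=
    (isClosed_le continuous_dist continuous_const).isCompact
  have hu := hc.uniformContinuousOn_of_continuous S.continuousOn_bracket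
  rw [Metric.uniformContinuousOn_iff] at hu
  obtain ⟨δ, hδ, h⟩ := hu η hη
  have he := S.eps_pos
  refine ⟨min S.eps (δ / 2), by positivity, min_le_left _ _, fun x y hxy => ?_⟩
  have h1 : dist x y ≤ S.eps := hxy.trans (min_le_left _ _)
  have h2 : dist x y < δ := (hxy.trans (min_le_right _ _)).trans_lt (by linarith)
  constructor
  · have := h (x, y) h1 (x, x) (by simp [he.le]) (by simpa [Prod.dist_eq, dist_comm, hδ] using h2)
    simpa [S.bracket_self] using this
  · have := h (x, y) h1 (y, y) (by simp [he.le]) (by simpa [Prod.dist_eq, hδ] using h2)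
    simpa [S.bracket_self] using this

lemma iterate_bracket (S : SmaleSpace X) {a b : X}
    (h : ∀ n : ℕ, dist (S.φ^[n] a) (S.φ^[n] b) ≤ S.eps) (n : ℕ) :
    S.φ^[n] (S.bracket a b) = S.bracket (S.φ^[n] a) (S.φ^[n] b) := by
  induction n with
  | zero => rfl
  | succ n ih =>
    have h2 := h (n + 1)
    simp only [Function.iterate_succ_apply'] at h2 ⊢
    rw [ih, S.map_bracket _ _ (h n) h2]

lemma contract_iterate (S : SmaleSpace X) {y z : X} (h : dist y z ≤ S.eps)
    (hb : S.bracket y z = z) (n : ℕ) :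
    dist (S.φ^[n] y) (S.φ^[n] z) ≤ S.lam ^ n * dist y z ∧
      S.bracket (S.φ^[n] y) (S.φ^[n] z) = S.φ^[n] z := by
  have key : ∀ k : ℕ, S.lam ^ k * dist y z ≤ S.eps := fun k =>
    (mul_le_of_le_one_left dist_nonneg (pow_le_one₀ S.lam_pos.le S.lam_lt_one.le)).trans h
  induction n with
  | zero => simpa using hb
  | succ n ih =>
    simp only [Function.iterate_succ_apply']
    have h1 := S.contract _ _ (ih.1.trans (key n)) ih.2
    have h2 : dist (S.φ (S.φ^[n] y)) (S.φ (S.φ^[n] z)) ≤ S.lam ^ (n + 1) * dist y z := by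
      refine h1.trans ?_
      rw [pow_succ', mul_assoc]
      exact mul_le_mul_of_nonneg_left ih.1 S.lam_pos.le
    refine ⟨h2, ?_⟩
    rw [← S.map_bracket _ _ (ih.1.trans (key n)) (h2.trans (key _)), ih.2]

lemma asymptotic_of_bracket (S : SmaleSpace X) {y z : X} (h : dist y z ≤ S.eps)
    (hb : S.bracket y z = z) : Asymptotic S.φ y z := by
  refine squeeze_zero (fun _ => dist_nonneg) (fun n => (S.contract_iterate h hb n).1) ?_
  simpa using (tendsto_pow_atTop_nhds_zero_of_lt_one S.lam_pos.le S.lam_lt_one).mul_const (dist y z)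

/-- Points whose forward orbits stay close lie on the same local stable set. -/
lemma exists_forward [CompactSpace X] (S : SmaleSpace X) : ∃ δ > 0, δ ≤ S.eps ∧ ∀ a b,
    (∀ n : ℕ, dist (S.φ^[n] a) (S.φ^[n] b) ≤ δ) → S.bracket a b = b := by
  obtain ⟨δ, hδ, hδe, hd⟩ := S.near_diag S.eps_pos
  refine ⟨δ, hδ, hδe, fun a b hab => ?_⟩
  set c := S.bracket a b with hc
  have hit := S.iterate_bracket (fun n => (hab n).trans hδe)
  have key : ∀ n : ℕ, dist c b ≤ S.lam ^ n * S.eps := by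
    intro n
    have h1 : dist (S.φ^[n] c) (S.φ^[n] b) ≤ S.eps := by
      rw [hc, hit]
      exact (hd _ _ (hab n)).2.le
    have h2 : S.bracket (S.φ^[n] c) (S.φ^[n] b) = S.φ^[n] c := by
      rw [hc, hit] at h1 ⊢
      exact S.bracket_left _ _ _ ((hab n).trans hδe) h1 ((hab n).trans hδe)
    have h3 := (S.reverse.contract_iterate (y := S.φ^[n] b) (z := S.φ^[n] c)
      (by rw [dist_comm]; exact h1) h2 n).1
    have inv : ∀ x, (S.reverse.φ)^[n] (S.φ^[n] x) = x :=
      fun x => (Function.LeftInverse.iterate S.φ.symm_apply_apply n) x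
    rw [inv, inv] at h3
    rw [dist_comm]
    refine h3.trans ?_
    rw [dist_comm]
    exact mul_le_mul_of_nonneg_left h1 (pow_nonneg S.lam_pos.le _)
  have lim : Tendsto (fun n : ℕ => S.lam ^ n * S.eps) atTop (𝓝 0) := by
    simpa using (tendsto_pow_atTop_nhds_zero_of_lt_one S.lam_pos.le S.lam_lt_one).mul_const S.eps
  exact dist_le_zero.mp (ge_of_tendsto lim (Eventually.of_forall key))

/-- Smale spaces are expansive. -/
lemma exists_expansive [CompactSpace X] (S : SmaleSpace X) : ∃ δ > 0, ∀ a b,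
    (∀ n : ℕ, dist (S.φ^[n] a) (S.φ^[n] b) ≤ δ) →
    (∀ n : ℕ, dist (S.φ.symm^[n] a) (S.φ.symm^[n] b) ≤ δ) → a = b := by
  obtain ⟨δ, hδ, -, h⟩ := S.exists_forward
  obtain ⟨δ', hδ', -, h'⟩ := S.reverse.exists_forward
  refine ⟨min δ δ', lt_min hδ hδ', fun a b h1 h2 => ?_⟩
  have e1 := h a b fun n => (h1 n).trans (min_le_left _ _)
  have e2 := h' b a fun n => by
    rw [dist_comm]; exact (h2 n).trans (min_le_right _ _)
  exact e2.symm.trans e1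

lemma dist_bracket_lt (R : SmaleSpace X) (u v : X) (ρ : ℝ) (huv : dist u v ≤ R.eps)
    (hlt : dist (R.bracket u v) u < min R.eps ρ) (n : ℕ) :
    dist (R.φ^[n] u) (R.φ^[n] (R.bracket u v)) < ρ := by
  have h1 : dist u (R.bracket u v) ≤ R.eps := by
    rw [dist_comm]; exact hlt.le.trans (min_le_left _ _)
  have h2 : R.bracket u (R.bracket u v) = R.bracket u v :=
    R.bracket_right _ _ _ huv h1 huv
  refine lt_of_le_of_lt (R.contract_iterate h1 h2 n).1 ?_
  refine lt_of_le_of_lt (mul_le_of_le_one_left dist_nonneg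
    (pow_le_one₀ R.lam_pos.le R.lam_lt_one.le)) ?_
  rw [dist_comm]
  exact hlt.trans_le (min_le_right _ _)

/-- Continuous equivariant maps preserve the bracket of sufficiently close points. -/
lemma exists_map_bracket [CompactSpace X] {W : Type*} [MetricSpace W] [CompactSpace W]
    (S : SmaleSpace X) (T : SmaleSpace W) (f : X → W) (hf : Continuous f)
    (he : ∀ x, f (S.φ x) = T.φ (f x)) :
    ∃ r > 0, r ≤ S.eps ∧ ∀ x y, dist x y ≤ r → dist (f x) (f y) ≤ T.eps ∧
      f (S.bracket x y) = T.bracket (f x) (f y) := by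
  obtain ⟨δ, hδ, hexp⟩ := T.exists_expansive
  obtain ⟨a, ha, hae, hA⟩ := T.near_diag (lt_min T.eps_pos (half_pos hδ))
  have hu := CompactSpace.uniformContinuous_of_continuous hf
  rw [Metric.uniformContinuous_iff] at hu
  obtain ⟨b, hb, hB⟩ := hu a ha
  obtain ⟨c, hc, hC⟩ := hu (δ / 2) (half_pos hδ)
  obtain ⟨r, hr, hre, hR⟩ := S.near_diag (lt_min S.eps_pos hc)
  refine ⟨min r (b / 2), by positivity, (min_le_left _ _).trans hre, fun x y hxy => ?_⟩
  have hxr : dist x y ≤ r := hxy.trans (min_le_left _ _)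
  have hxe : dist x y ≤ S.eps := hxr.trans hre
  have hfa : dist (f x) (f y) < a :=
    hB ((hxy.trans (min_le_right _ _)).trans_lt (half_lt_self hb))
  have hfe : dist (f x) (f y) ≤ T.eps := hfa.le.trans hae
  refine ⟨hfe, ?_⟩
  have hes : ∀ x, f (S.φ.symm x) = T.φ.symm (f x) := fun x => by
    rw [T.φ.eq_symm_apply, ← he, S.φ.apply_symm_apply]
  have hit : ∀ (n : ℕ) x, T.φ^[n] (f x) = f (S.φ^[n] x) := fun n x =>
    ((Function.Semiconj.iterate_right (f := f) he n) x).symm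
  have hits : ∀ (n : ℕ) x, T.φ.symm^[n] (f x) = f (S.φ.symm^[n] x) := fun n x =>
    ((Function.Semiconj.iterate_right (f := f) hes n) x).symm
  refine hexp _ _ (fun n => ?_) (fun n => ?_)
  · have h1 := hC (dist_bracket_lt S x y c hxe (hR x y hxr).1 n)
    have h2 := dist_bracket_lt T (f x) (f y) (δ / 2) hfe (hA _ _ hfa.le).1 n
    rw [hit] at h2 ⊢
    refine (dist_triangle_left _ _ (f (S.φ^[n] x))).trans ?_
    linarith
  · have h1 := hC (dist_bracket_lt S.reverse y x c (by rw [dist_comm]; exact hxe) (hR x y hxr).2 n)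
    have h2 := dist_bracket_lt T.reverse (f y) (f x) (δ / 2) (by rw [dist_comm]; exact hfe)
      (hA _ _ hfa.le).2 n
    change dist (f (S.φ.symm^[n] y)) (f (S.φ.symm^[n] (S.bracket x y))) < _ at h1
    change dist (T.φ.symm^[n] (f y)) (T.φ.symm^[n] (T.bracket (f x) (f y))) < _ at h2
    rw [hits] at h2 ⊢
    refine (dist_triangle_left _ _ (f (S.φ.symm^[n] y))).trans ?_
    linarith

end SmaleSpace

/-- A map of Smale spaces: continuous and equivariant. -/
structure IsMap {X W : Type*} [MetricSpace X] [MetricSpace W] (S : SmaleSpace X)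
    (T : SmaleSpace W) (f : X → W) : Prop where
  continuous : Continuous f
  map_φ : ∀ x, f (S.φ x) = T.φ (f x)

/-- `f` is `s`-bijective: it restricts to bijections `X^s(x) → W^s(f x)`. -/
structure IsSBijective {X W : Type*} [MetricSpace X] [MetricSpace W] (S : SmaleSpace X)
    (T : SmaleSpace W) (f : X → W) : Prop extends IsMap S T f where
  bijOn : ∀ x, Set.BijOn f (S.stableSet x) (T.stableSet (f x))

/-- `f` is `u`-bijective: it restricts to bijections `X^u(x) → W^u(f x)`. -/
structure IsUBijective {X W : Type*} [MetricSpace X] [MetricSpace W] (S : SmaleSpace X)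
    (T : SmaleSpace W) (f : X → W) : Prop extends IsMap S T f where
  bijOn : ∀ x, Set.BijOn f (S.unstableSet x) (T.unstableSet (f x))

section Leaf

variable {X W : Type*} [MetricSpace X] [MetricSpace W] {S : SmaleSpace X} {T : SmaleSpace W}
  {f : X → W}

lemma Asymptotic.symm {g : X → X} {x y : X} (h : Asymptotic g x y) : Asymptotic g y x := by
  simpa only [Asymptotic, dist_comm] using h

lemma Asymptotic.trans {g : X → X} {x y z : X} (h : Asymptotic g x y) (h' : Asymptotic g y z) :
    Asymptotic g x z :=
  squeeze_zero (fun _ => dist_nonneg) (fun _ => dist_triangle _ _ _) (by simpa using h.add h')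

lemma Asymptotic.tail {g : X → X} {x y : X} (k : ℕ) (h : Asymptotic g (g^[k] x) (g^[k] y)) :
    Asymptotic g x y := by
  have : Tendsto (fun n : ℕ => dist (g^[n + k] x) (g^[n + k] y)) atTop (𝓝 0) := by
    simp only [Function.iterate_add_apply]
    exact h
  exact (tendsto_add_atTop_iff_nat k).mp this

lemma IsMap.iterate (hf : IsMap S T f) (n : ℕ) (x : X) : f (S.φ^[n] x) = T.φ^[n] (f x) :=
  (Function.Semiconj.iterate_right (f := f) hf.map_φ n) x

/-- `s`-bijective maps are open for the leaf topologies: lifts of close points are close. -/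
lemma IsSBijective.exists_lift_close [CompactSpace X] (hf : IsSBijective S T f) {ε : ℝ}
    (hε : 0 < ε) : ∃ δ > 0, ∀ y y', Asymptotic S.φ y y' → f y' ∈ localSet T.φ (f y) δ →
      y' ∈ localSet S.φ y ε := by
  obtain ⟨ε₀, hε₀, hε₀e, hfw⟩ := S.exists_forward
  set e := min ε ε₀ with he
  have he0 : 0 < e := lt_min hε hε₀
  suffices h : ∃ δ > 0, ∀ y y', Asymptotic S.φ y y' → f y' ∈ localSet T.φ (f y) δ →
      y' ∈ localSet S.φ y e by
    obtain ⟨δ, hδ, h⟩ := h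
    exact ⟨δ, hδ, fun y y' h1 h2 =>
      ⟨h1, fun n => ((h y y' h1 h2).2 n).trans_le (min_le_left _ _)⟩⟩
  by_contra hcon
  push Not at hcon
  -- pairs that are `e`-apart now, but `e`-close at all later times, with close images
  have step : ∀ n : ℕ, ∃ p : X × X, e ≤ dist p.1 p.2 ∧
      (∀ j : ℕ, dist (S.φ^[j + 1] p.1) (S.φ^[j + 1] p.2) ≤ e) ∧
      dist (f p.1) (f p.2) ≤ 1 / ((n : ℝ) + 1) := by
    intro n
    obtain ⟨y, y', h1, h2, h3⟩ := hcon (1 / ((n : ℝ) + 1)) (by positivity)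
    have h4 : ∃ k : ℕ, e ≤ dist (S.φ^[k] y) (S.φ^[k] y') := by
      by_contra hno
      push Not at hno
      exact h3 ⟨h1, hno⟩
    obtain ⟨N, hN⟩ := eventually_atTop.mp ((tendsto_order.mp h1).2 e he0)
    classical
    let k := Nat.findGreatest (fun k => e ≤ dist (S.φ^[k] y) (S.φ^[k] y')) N
    have hk : e ≤ dist (S.φ^[k] y) (S.φ^[k] y') := by
      obtain ⟨k₀, hk₀⟩ := h4
      refine Nat.findGreatest_spec (P := fun k => e ≤ dist (S.φ^[k] y) (S.φ^[k] y')) (m := k₀)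
        ?_ hk₀
      by_contra hlt
      exact absurd hk₀ (not_le.mpr (hN k₀ (not_le.mp hlt).le))
    refine ⟨(S.φ^[k] y, S.φ^[k] y'), hk, fun j => ?_, ?_⟩
    · rw [← Function.iterate_add_apply, ← Function.iterate_add_apply]
      by_contra hlt
      have hlt' := (not_le.mp hlt).le
      rcases le_or_gt (j + 1 + k) N with hjN | hjN
      · exact Nat.findGreatest_is_greatest
          (P := fun k => e ≤ dist (S.φ^[k] y) (S.φ^[k] y')) (show k < j + 1 + k by omega) hjN hlt'
      · exact absurd hlt' (not_le.mpr (hN _ hjN.le))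
    · simp only [hf.iterate]
      exact (h2.2 k).le
  choose p hp1 hp2 hp3 using step
  obtain ⟨q, -, s, hs, hlim⟩ := isCompact_univ.tendsto_subseq (x := p) (fun n => Set.mem_univ _)
  have q1 : e ≤ dist q.1 q.2 :=
    ge_of_tendsto ((continuous_dist.tendsto q).comp hlim) (Eventually.of_forall fun n => hp1 _)
  have hit : ∀ j : ℕ, Continuous (S.φ^[j]) := fun j => S.φ.continuous.iterate j
  have q2 : ∀ j : ℕ, dist (S.φ^[j + 1] q.1) (S.φ^[j + 1] q.2) ≤ e := fun j => by
    have hc : Continuous fun p : X × X => dist (S.φ^[j + 1] p.1) (S.φ^[j + 1] p.2) :=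
      ((hit _).comp continuous_fst).dist ((hit _).comp continuous_snd)
    exact le_of_tendsto ((hc.tendsto q).comp hlim) (Eventually.of_forall fun n => hp2 _ j)
  have q3 : f q.1 = f q.2 := by
    have hc : Continuous fun p : X × X => dist (f p.1) (f p.2) :=
      (hf.continuous.comp continuous_fst).dist (hf.continuous.comp continuous_snd)
    have h0 : Tendsto (fun n => 1 / (((s n : ℕ) : ℝ) + 1)) atTop (𝓝 0) :=
      tendsto_one_div_add_atTop_nhds_zero_nat.comp hs.tendsto_atTop
    exact dist_le_zero.mp
      (le_of_tendsto_of_tendsto' ((hc.tendsto q).comp hlim) h0 fun n => hp3 _)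
  have has : Asymptotic S.φ q.1 q.2 := by
    refine Asymptotic.tail 1 ?_
    have hb := hfw (S.φ^[1] q.1) (S.φ^[1] q.2) fun n => by
      rw [← Function.iterate_add_apply, ← Function.iterate_add_apply]
      exact (q2 n).trans (min_le_right _ _)
    exact S.asymptotic_of_bracket ((q2 0).trans ((min_le_right _ _).trans hε₀e)) hb
  have hself : q.1 ∈ S.stableSet q.1 := by
    simp [SmaleSpace.stableSet, Asymptotic]
  have := (hf.bijOn q.1).injOn hself has q3
  rw [this, dist_self] at q1
  linarith

lemma IsMap.asymptotic [CompactSpace X] (hf : IsMap S T f) {x y : X}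
    (h : Asymptotic S.φ x y) : Asymptotic T.φ (f x) (f y) := by
  have hu := CompactSpace.uniformContinuous_of_continuous hf.continuous
  rw [Metric.uniformContinuous_iff] at hu
  refine Metric.tendsto_atTop.mpr fun ε hε => ?_
  obtain ⟨δ, hδ, hd⟩ := hu ε hε
  obtain ⟨N, hN⟩ := Metric.tendsto_atTop.mp h δ hδ
  refine ⟨N, fun n hn => ?_⟩
  have h1 := hN n hn
  rw [Real.dist_eq, sub_zero, abs_of_nonneg dist_nonneg] at h1 ⊢
  rw [← hf.iterate, ← hf.iterate]
  exact hd h1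

lemma IsMap.continuous_leaf [CompactSpace X] (hf : IsMap S T f) :
    @Continuous X W (leafTopology S.φ) (leafTopology T.φ) f := by
  have hu := CompactSpace.uniformContinuous_of_continuous hf.continuous
  rw [Metric.uniformContinuous_iff] at hu
  refine @Continuous.mk _ _ (leafTopology S.φ) (leafTopology T.φ) _ fun U hU x hx => ?_
  obtain ⟨ε, hε, hεU⟩ := hU (f x) hx
  obtain ⟨δ, hδ, hd⟩ := hu ε hε
  refine ⟨δ, hδ, fun y hy => hεU ⟨hf.asymptotic hy.1, fun n => ?_⟩⟩
  rw [← hf.iterate, ← hf.iterate]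
  exact hd (hy.2 n)

lemma IsSBijective.isOpen_image [CompactSpace X] (hf : IsSBijective S T f) {U : Set X}
    (hU : IsOpen[leafTopology S.φ] U) : IsOpen[leafTopology T.φ] (f '' U) := by
  rintro _ ⟨x, hx, rfl⟩
  obtain ⟨ε, hε, hεU⟩ := hU x hx
  obtain ⟨δ, hδ, hd⟩ := hf.exists_lift_close hε
  refine ⟨δ, hδ, fun w hw => ?_⟩
  obtain ⟨y, hy, rfl⟩ := (hf.bijOn x).surjOn hw.1
  exact ⟨y, hεU (hd x y hy hw), rfl⟩

end Leaf

/-- `CO^s`: the compact open subsets of the stable orbits, for the intrinsic topology. -/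
def CompactOpen {X : Type*} [MetricSpace X] (S : SmaleSpace X) : Type _ :=
  {E : Set X // (∃ e, E ⊆ S.stableSet e) ∧ @IsCompact X (leafTopology S.φ) E ∧
    IsOpen[leafTopology S.φ] E}

/-- The smallest equivalence relation on `CO^s` that is invariant under `φ` (in both directions)
and satisfies `E ∼ F` whenever `[E, F] = E` and `[F, E] = F`, where `E` and `F` lie in local
stable sets and are so close that `[E, F]` and `[F, E]` are defined. -/
inductive DimRel {X : Type*} [MetricSpace X] (S : SmaleSpace X) :
    CompactOpen S → CompactOpen S → Prop
  | bracket (E F : CompactOpen S)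
      (hE : ∃ e, E.1 ⊆ localSet S.φ e (S.eps / 2)) (hF : ∃ f, F.1 ⊆ localSet S.φ f (S.eps / 2))
      (hEF : ∀ x ∈ E.1, ∀ y ∈ F.1, dist x y ≤ S.eps)
      (h₁ : Set.image2 S.bracket E.1 F.1 = E.1) (h₂ : Set.image2 S.bracket F.1 E.1 = F.1) :
      DimRel S E F
  | shift (E F E' F' : CompactOpen S) (hE : E'.1 = S.φ '' E.1) (hF : F'.1 = S.φ '' F.1)
      (h : DimRel S E F) : DimRel S E' F'
  | unshift (E F E' F' : CompactOpen S) (hE : E'.1 = S.φ '' E.1) (hF : F'.1 = S.φ '' F.1)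
      (h : DimRel S E' F') : DimRel S E F
  | refl (E : CompactOpen S) : DimRel S E E
  | symm (E F : CompactOpen S) (h : DimRel S E F) : DimRel S F E
  | trans (E F G : CompactOpen S) (h : DimRel S E F) (h' : DimRel S F G) : DimRel S E G

/-- The equivalence relation `∼` on `CO^s`. -/
def dimSetoid {X : Type*} [MetricSpace X] (S : SmaleSpace X) : Setoid (CompactOpen S) where
  r := DimRel S
  iseqv := ⟨DimRel.refl, DimRel.symm _ _, DimRel.trans _ _ _⟩

/-- The generator of the free abelian group given by the class of `E`. -/
def dimGen {X : Type*} [MetricSpace X] {S : SmaleSpace X} (E : CompactOpen S) :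
    FreeAbelianGroup (Quotient (dimSetoid S)) :=
  FreeAbelianGroup.of (Quotient.mk (dimSetoid S) E)

/-- The relations `[E ∪ F] = [E] + [F]` for disjoint `E`, `F` (with `E ∪ F` in `CO^s`). -/
def dimRelations {X : Type*} [MetricSpace X] (S : SmaleSpace X) :
    AddSubgroup (FreeAbelianGroup (Quotient (dimSetoid S))) :=
  AddSubgroup.closure {x | ∃ E F G : CompactOpen S, Disjoint E.1 F.1 ∧ G.1 = E.1 ∪ F.1 ∧
    x = dimGen G - dimGen E - dimGen F}

/-- The (stable) dimension group `D^s`. -/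
abbrev DimGroup {X : Type*} [MetricSpace X] (S : SmaleSpace X) : Type _ :=
  FreeAbelianGroup (Quotient (dimSetoid S)) ⧸ dimRelations S

/-- The class `[E] ∈ D^s` of a compact open set. -/
def dimClass {X : Type*} [MetricSpace X] {S : SmaleSpace X} (E : CompactOpen S) : DimGroup S :=
  QuotientAddGroup.mk (dimGen E)

/-- `s`-bijective maps that strictly respect scales and brackets. (Any `s`-bijective map respects
brackets of close enough points; all the maps considered below do so at the given scale.) -/
structure IsStrict {X W : Type*} [MetricSpace X] [MetricSpace W] (S : SmaleSpace X)
    (T : SmaleSpace W) (f : X → W) : Prop extends IsSBijective S T f where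
  eps_eq : S.eps = T.eps
  dist_le : ∀ x y, dist (f x) (f y) ≤ dist x y
  map_bracket : ∀ x y, dist x y ≤ S.eps → f (S.bracket x y) = T.bracket (f x) (f y)

lemma dimGroup_hom_ext {X : Type*} [MetricSpace X] {S : SmaleSpace X} {A : Type*} [AddCommGroup A] {u v : DimGroup S →+ A}
    (h : ∀ E, u (dimClass E) = v (dimClass E)) : u = v := by
  refine QuotientAddGroup.addMonoidHom_ext _ (FreeAbelianGroup.lift_ext _ _ ?_)
  intro q
  induction q using Quotient.inductionOn with
  | h E => exact h E

section Functor

variable {X W V : Type*} [MetricSpace X] [MetricSpace W] [MetricSpace V] [CompactSpace X] {S : SmaleSpace X} {T : SmaleSpace W} {R : SmaleSpace V} {f : X → W} {g : W → V}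

/-- The image of a compact open set under an `s`-bijective map. -/
def CompactOpen.map (hf : IsSBijective S T f) (E : CompactOpen S) : CompactOpen T :=
  ⟨f '' E.1, by
    obtain ⟨E, ⟨e, he⟩, hc, ho⟩ := E
    refine ⟨⟨f e, ?_⟩, ?_, hf.isOpen_image ho⟩
    · exact ((hf.bijOn e).mapsTo.mono_left he).image_subset
    · exact @IsCompact.image X W (leafTopology S.φ) (leafTopology T.φ) E f hc
        hf.toIsMap.continuous_leaf⟩

lemma DimRel.map (hf : IsStrict S T f) {E F : CompactOpen S} (h : DimRel S E F) :
    DimRel T (E.map hf.toIsSBijective) (F.map hf.toIsSBijective) := by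
  have hφ : ∀ A : Set X, f '' (S.φ '' A) = T.φ '' (f '' A) := fun A => by
    rw [Set.image_image, Set.image_image]
    exact Set.image_congr fun x _ => hf.map_φ x
  have hloc : ∀ (A : Set X), (∃ e, A ⊆ localSet S.φ e (S.eps / 2)) →
      ∃ e, f '' A ⊆ localSet T.φ e (T.eps / 2) := by
    rintro A ⟨e, he⟩
    refine ⟨f e, ?_⟩
    rintro _ ⟨x, hx, rfl⟩
    refine ⟨hf.toIsMap.asymptotic (he hx).1, fun n => ?_⟩
    rw [← hf.toIsMap.iterate, ← hf.toIsMap.iterate, ← hf.eps_eq]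
    exact (hf.dist_le _ _).trans_lt ((he hx).2 n)
  induction h with
  | bracket E F hE hF hEF h₁ h₂ =>
    refine DimRel.bracket _ _ (hloc _ hE) (hloc _ hF) ?_ ?_ ?_
    · rintro _ ⟨x, hx, rfl⟩ _ ⟨y, hy, rfl⟩
      rw [← hf.eps_eq]
      exact (hf.dist_le _ _).trans (hEF x hx y hy)
    · change Set.image2 T.bracket (f '' E.1) (f '' F.1) = f '' E.1
      conv_rhs => rw [← h₁]
      rw [Set.image2_image_left, Set.image2_image_right, Set.image_image2]
      exact Set.image2_congr fun x hx y hy => (hf.map_bracket x y (hEF x hx y hy)).symm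
    · change Set.image2 T.bracket (f '' F.1) (f '' E.1) = f '' F.1
      conv_rhs => rw [← h₂]
      rw [Set.image2_image_left, Set.image2_image_right, Set.image_image2]
      exact Set.image2_congr fun x hx y hy =>
        (hf.map_bracket x y (by rw [dist_comm]; exact hEF y hy x hx)).symm
  | shift E F E' F' hE hF _ ih =>
    refine DimRel.shift _ _ _ _ ?_ ?_ ih
    · change f '' E'.1 = _
      rw [hE, hφ]; rfl
    · change f '' F'.1 = _
      rw [hF, hφ]; rfl
  | unshift E F E' F' hE hF _ ih =>
    refine DimRel.unshift _ _ _ _ ?_ ?_ ih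
    · change f '' E'.1 = _
      rw [hE, hφ]; rfl
    · change f '' F'.1 = _
      rw [hF, hφ]; rfl
  | refl E => exact DimRel.refl _
  | symm E F _ ih => exact DimRel.symm _ _ ih
  | trans E F G _ _ ih ih' => exact DimRel.trans _ _ _ ih ih'

/-- The homomorphism `f^s : D^s(X) → D^s(W)`, `[E] ↦ [f(E)]`. -/
def dimMap (hf : IsStrict S T f) : DimGroup S →+ DimGroup T :=
  QuotientAddGroup.map (dimRelations S) (dimRelations T)
    (FreeAbelianGroup.map (Quotient.map (sa := dimSetoid S) (sb := dimSetoid T)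
      (CompactOpen.map hf.toIsSBijective) fun _ _ h => DimRel.map hf h)) (by
    refine (AddSubgroup.closure_le _).mpr ?_
    rintro _ ⟨E, F, G, hd, hG, rfl⟩
    refine AddSubgroup.subset_closure ⟨E.map hf.toIsSBijective, F.map hf.toIsSBijective,
      G.map hf.toIsSBijective, ?_, ?_, ?_⟩
    · obtain ⟨e, he⟩ := G.2.1
      rw [hG] at he
      exact Set.disjoint_image_image fun x hx y hy hxy =>
        Set.disjoint_left.mp hd hx ((hf.bijOn e).injOn (he (Or.inl hx)) (he (Or.inr hy)) hxy ▸ hy)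
    · change f '' G.1 = _
      rw [hG, Set.image_union]; rfl
    · simp only [map_sub]
      rfl)

lemma dimMap_dimClass (hf : IsStrict S T f) (E : CompactOpen S) :
    dimMap hf (dimClass E) = dimClass (E.map hf.toIsSBijective) := rfl

lemma dimMap_comp [CompactSpace W] (hf : IsStrict S T f) (hg : IsStrict T R g) (hgf : IsStrict S R (g ∘ f))
    (x : DimGroup S) : dimMap hgf x = dimMap hg (dimMap hf x) := by
  suffices h : dimMap hgf = (dimMap hg).comp (dimMap hf) by rw [h]; rfl
  refine dimGroup_hom_ext fun E => ?_
  simp only [AddMonoidHom.comp_apply, dimMap_dimClass]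
  congr 1
  exact Subtype.ext (Set.image_comp g f E.1)

lemma dimMap_id (h : IsStrict S S id) (x : DimGroup S) : dimMap h x = x := by
  suffices h' : dimMap h = AddMonoidHom.id _ by rw [h']; rfl
  refine dimGroup_hom_ext fun E => ?_
  simp only [AddMonoidHom.id_apply, dimMap_dimClass]
  congr 1
  exact Subtype.ext (Set.image_id E.1)

end Functor

/-- An `s/u`-bijective pair `(Y, ψ, π_s, Z, ζ, π_u)` for a Smale space `(X, φ)`. -/
structure SUPair {X Y Z : Type*} [MetricSpace X] [MetricSpace Y] [MetricSpace Z]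
    (SX : SmaleSpace X) (SY : SmaleSpace Y) (SZ : SmaleSpace Z) where
  πs : Y → X
  πu : Z → X
  πs_sBijective : IsSBijective SY SX πs
  πu_uBijective : IsUBijective SZ SX πu
  πs_surjective : Function.Surjective πs
  πu_surjective : Function.Surjective πu
  unstable_totallyDisconnected :
    ∀ y, @IsTotallyDisconnected Y (leafTopology SY.φ.symm) (SY.unstableSet y)
  stable_totallyDisconnected :
    ∀ z, @IsTotallyDisconnected Z (leafTopology SZ.φ) (SZ.stableSet z)

namespace SUPair

lemma comp_succAbove_eq_cycleIcc {L : ℕ} (l r : Fin (L + 1)) (hlr : l ≤ r)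
    (ρ : Fin (L + 2) → Fin (L + 1)) (q : Fin (L + 2)) (hqr : q = r.succ) (hρq : ρ q = l)
    (hρs : ∀ j, ρ (q.succAbove j) = j) : ρ ∘ l.castSucc.succAbove = Fin.cycleIcc l r := by
  subst hqr
  funext k
  simp only [Function.comp_apply]
  rcases lt_or_ge k l with hk | hk
  · rw [Fin.cycleIcc_of_lt hk, Fin.succAbove_castSucc_of_lt _ _ hk,
      ← Fin.succAbove_succ_of_le r k (hk.le.trans hlr), hρs]
  · rw [Fin.succAbove_castSucc_of_le _ _ hk]
    rcases lt_trichotomy k r with hkr | hkr | hkr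
    · rw [Fin.cycleIcc_of_ge_of_lt hk hkr]
      have h1 : ((k + 1 : Fin (L + 1)) : ℕ) = k + 1 := Fin.val_add_one_of_lt' (by omega)
      have h2 : k.succ = r.succ.succAbove (k + 1) := by
        rw [Fin.succAbove_succ_of_le _ _ (by rw [Fin.le_def, h1]; exact hkr)]
        exact Fin.ext (by simp [h1])
      rw [h2, hρs]
    · rw [hkr, Fin.cycleIcc_of_last hlr, hρq]
    · rw [Fin.cycleIcc_of_gt hkr, ← Fin.succAbove_succ_of_lt r k hkr, hρs]

lemma swap_comp_succAbove {L : ℕ} (i : Fin (L + 1)) :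
    Equiv.swap i.castSucc i.succ ∘ i.castSucc.succAbove = i.succ.succAbove := by
  funext k
  simp only [Function.comp_apply]
  rcases lt_trichotomy k i with hk | hk | hk
  · rw [Fin.succAbove_castSucc_of_lt _ _ hk, Fin.succAbove_succ_of_le _ _ hk.le,
      Equiv.swap_apply_of_ne_of_ne]
    · simpa using hk.ne
    · exact (Fin.castSucc_lt_succ_iff.mpr hk.le).ne
  · subst hk
    simp
  · rw [Fin.succAbove_castSucc_of_le _ _ hk.le, Fin.succAbove_succ_of_lt _ _ hk,
      Equiv.swap_apply_of_ne_of_ne]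
    · exact (Fin.castSucc_lt_succ_iff.mpr hk.le).ne'
    · simpa using hk.ne'

lemma insertNth_eq_predAbove_comp_cycleIcc {L : ℕ} (l : Fin (L + 1)) (q : Fin (L + 2))
    (h : l.castSucc < q) : Fin.insertNth (α := fun _ => Fin (L + 1)) q l id =
      l.predAbove ∘ Fin.cycleIcc l.succ q := by
  have h' : l.succ ≤ q := h
  have hs : Fin.insertNth (α := fun _ => Fin (L + 1)) q l id q = l := by simp
  funext i
  rcases lt_trichotomy i q with hk | hk | hk
  · rcases lt_or_ge i l.succ with hi | hi
    · rw [Function.comp_apply, Fin.cycleIcc_of_lt hi]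
      simp [Fin.insertNth_apply_below hk]
      rw [Fin.predAbove_of_le_castSucc _ _ (Fin.le_castSucc_iff.mpr hi)]
    · rw [Function.comp_apply, Fin.cycleIcc_of_ge_of_lt hi hk]
      simp [Fin.insertNth_apply_below hk]
      have h1 : ((i + 1 : Fin (L + 2)) : ℕ) = i + 1 := Fin.val_add_one_of_lt' (by omega)
      rw [Fin.predAbove_of_castSucc_lt]
      · ext; simp [h1]
      · rw [Fin.lt_def, h1]; simp [Fin.le_def] at hi ⊢; omega
  · subst hk
    rw [Function.comp_apply, Fin.cycleIcc_of_last h', hs]; simp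
  · rw [Function.comp_apply, Fin.cycleIcc_of_gt hk]
    simp [Fin.insertNth_apply_above hk]
    rw [Fin.predAbove_of_castSucc_lt]
    exact h.trans hk

variable {X Y Z : Type*} [MetricSpace X] [MetricSpace Y] [MetricSpace Z]
  {SX : SmaleSpace X} {SY : SmaleSpace Y} {SZ : SmaleSpace Z}

/-- The space `Σ_{L,M}(π)` of tuples `(y_0, …, y_L, z_0, …, z_M)` with `π_s(y_l) = π_u(z_m)`,
with the supremum metric. -/
abbrev Shift (π : SUPair SX SY SZ) (L M : ℕ) : Type _ :=
  {p : (Fin (L + 1) → Y) × (Fin (M + 1) → Z) // ∀ l m, π.πs (p.1 l) = π.πu (p.2 m)}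

instance [CompactSpace Y] [CompactSpace Z] (π : SUPair SX SY SZ) (L M : ℕ) :
    CompactSpace (π.Shift L M) := by
  have h : IsClosed {p : (Fin (L + 1) → Y) × (Fin (M + 1) → Z) |
      ∀ l m, π.πs (p.1 l) = π.πu (p.2 m)} := by
    simp only [Set.ofPred_forall]
    refine isClosed_iInter fun l => isClosed_iInter fun m => isClosed_eq ?_ ?_
    · exact π.πs_sBijective.continuous.comp ((continuous_apply l).comp continuous_fst)
    · exact π.πu_uBijective.continuous.comp ((continuous_apply m).comp continuous_snd)
  exact isCompact_iff_compactSpace.mp h.isCompact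

section

variable {π : SUPair SX SY SZ}

lemma dist_fst_le {L M : ℕ} (p q : π.Shift L M) (l : Fin (L + 1)) :
    dist (p.1.1 l) (q.1.1 l) ≤ dist p q :=
  (dist_le_pi_dist _ _ l).trans (le_max_left _ _)

lemma dist_snd_le {L M : ℕ} (p q : π.Shift L M) (m : Fin (M + 1)) :
    dist (p.1.2 m) (q.1.2 m) ≤ dist p q :=
  (dist_le_pi_dist _ _ m).trans (le_max_right _ _)

lemma dist_le_iff {L M : ℕ} {p q : π.Shift L M} {r : ℝ} (hr : 0 ≤ r) :
    dist p q ≤ r ↔ (∀ l, dist (p.1.1 l) (q.1.1 l) ≤ r) ∧ ∀ m, dist (p.1.2 m) (q.1.2 m) ≤ r := by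
  rw [Subtype.dist_eq, Prod.dist_eq, max_le_iff, dist_pi_le_iff hr, dist_pi_le_iff hr]

lemma shift_ext {L M : ℕ} {p q : π.Shift L M} (h₁ : ∀ l, p.1.1 l = q.1.1 l)
    (h₂ : ∀ m, p.1.2 m = q.1.2 m) : p = q :=
  Subtype.ext (Prod.ext (funext h₁) (funext h₂))

variable (π : SUPair SX SY SZ)

/-- Reindexing of the `Y`-coordinates:
`(y_0, …, y_L, z) ↦ (y_{θ 0}, …, y_{θ K}, z)`. -/
def reindex {K L : ℕ} (M : ℕ) (θ : Fin (K + 1) → Fin (L + 1)) (p : π.Shift L M) : π.Shift K M :=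
  ⟨(fun k => p.1.1 (θ k), p.1.2), fun k m => p.2 (θ k) m⟩

lemma dist_reindex_le {K L M : ℕ} (θ : Fin (K + 1) → Fin (L + 1)) (p q : π.Shift L M) :
    dist (π.reindex M θ p) (π.reindex M θ q) ≤ dist p q :=
  (dist_le_iff dist_nonneg).mpr ⟨fun k => dist_fst_le p q (θ k), fun m => dist_snd_le p q m⟩

end

section Compact

variable [CompactSpace X] [CompactSpace Y] [CompactSpace Z] (π : SUPair SX SY SZ)

/-- There is a scale below which `π_s` and `π_u` commute with the brackets. -/
lemma exists_scale : ∃ r > 0, r ≤ SY.eps ∧ r ≤ SZ.eps ∧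
    (∀ y y', dist y y' ≤ r → π.πs (SY.bracket y y') = SX.bracket (π.πs y) (π.πs y')) ∧
    (∀ z z', dist z z' ≤ r → π.πu (SZ.bracket z z') = SX.bracket (π.πu z) (π.πu z')) := by
  obtain ⟨a, ha, hae, hA⟩ := SY.exists_map_bracket SX π.πs π.πs_sBijective.continuous
    π.πs_sBijective.map_φ
  obtain ⟨b, hb, hbe, hB⟩ := SZ.exists_map_bracket SX π.πu π.πu_uBijective.continuous
    π.πu_uBijective.map_φ
  exact ⟨min a b, lt_min ha hb, (min_le_left _ _).trans hae, (min_le_right _ _).trans hbe,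
    fun y y' h => (hA y y' (h.trans (min_le_left _ _))).2,
    fun z z' h => (hB z z' (h.trans (min_le_right _ _))).2⟩

/-- A scale below which `π_s` and `π_u` commute with the brackets; it does not depend on
`L` and `M`. -/
noncomputable def scale : ℝ := Classical.choose π.exists_scale

lemma scale_spec : 0 < π.scale ∧ π.scale ≤ SY.eps ∧ π.scale ≤ SZ.eps ∧
    (∀ y y', dist y y' ≤ π.scale → π.πs (SY.bracket y y') = SX.bracket (π.πs y) (π.πs y')) ∧
    (∀ z z', dist z z' ≤ π.scale → π.πu (SZ.bracket z z') = SX.bracket (π.πu z) (π.πu z')) :=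
  Classical.choose_spec π.exists_scale

/-- The homeomorphism of `Σ_{L,M}(π)` induced by `ψ` and `ζ`. -/
def shiftMap (L M : ℕ) : π.Shift L M ≃ₜ π.Shift L M where
  toFun p := ⟨(fun l => SY.φ (p.1.1 l), fun m => SZ.φ (p.1.2 m)), fun l m => by
    change π.πs (SY.φ _) = π.πu (SZ.φ _)
    rw [π.πs_sBijective.map_φ, π.πu_uBijective.map_φ, p.2 l m]⟩
  invFun p := ⟨(fun l => SY.φ.symm (p.1.1 l), fun m => SZ.φ.symm (p.1.2 m)), fun l m => by
    apply SX.φ.injective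
    change SX.φ (π.πs (SY.φ.symm _)) = SX.φ (π.πu (SZ.φ.symm _))
    rw [← π.πs_sBijective.map_φ, ← π.πu_uBijective.map_φ, SY.φ.apply_symm_apply,
      SZ.φ.apply_symm_apply, p.2 l m]⟩
  left_inv p := by ext <;> simp
  right_inv p := by ext <;> simp
  continuous_toFun := by fun_prop
  continuous_invFun := by fun_prop

open Classical in
/-- The coordinatewise bracket on `Σ_{L,M}(π)` (with a dummy value where the coordinatewise
bracket leaves the space, which does not happen for pairs at distance at most `π.scale`). -/
noncomputable def shiftBracket (L M : ℕ) (p q : π.Shift L M) : π.Shift L M :=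
  if h : ∀ l m, π.πs (SY.bracket (p.1.1 l) (q.1.1 l)) = π.πu (SZ.bracket (p.1.2 m) (q.1.2 m))
  then ⟨(fun l => SY.bracket (p.1.1 l) (q.1.1 l), fun m => SZ.bracket (p.1.2 m) (q.1.2 m)), h⟩
  else p

lemma shiftBracket_val {L M : ℕ} {p q : π.Shift L M} (h : dist p q ≤ π.scale) :
    (π.shiftBracket L M p q).1 = (fun l => SY.bracket (p.1.1 l) (q.1.1 l),
      fun m => SZ.bracket (p.1.2 m) (q.1.2 m)) := by
  unfold shiftBracket
  rw [dif_pos]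
  intro l m
  rw [π.scale_spec.2.2.2.1 _ _ ((dist_fst_le p q l).trans h),
    π.scale_spec.2.2.2.2 _ _ ((dist_snd_le p q m).trans h), p.2 l m, q.2 l m]

lemma shiftBracket_fst {L M : ℕ} {p q : π.Shift L M} (h : dist p q ≤ π.scale) (l : Fin (L + 1)) :
    (π.shiftBracket L M p q).1.1 l = SY.bracket (p.1.1 l) (q.1.1 l) := by
  rw [π.shiftBracket_val h]

lemma shiftBracket_snd {L M : ℕ} {p q : π.Shift L M} (h : dist p q ≤ π.scale) (m : Fin (M + 1)) :
    (π.shiftBracket L M p q).1.2 m = SZ.bracket (p.1.2 m) (q.1.2 m) := by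
  rw [π.shiftBracket_val h]

/-- The Smale space structure on `Σ_{L,M}(π)`. -/
noncomputable def shiftSpace (L M : ℕ) : SmaleSpace (π.Shift L M) where
  φ := π.shiftMap L M
  bracket := π.shiftBracket L M
  eps := π.scale
  lam := max SY.lam SZ.lam
  eps_pos := π.scale_spec.1
  lam_pos := lt_max_of_lt_left SY.lam_pos
  lam_lt_one := max_lt SY.lam_lt_one SZ.lam_lt_one
  continuousOn_bracket := by
    have hY := π.scale_spec.2.1
    have hZ := π.scale_spec.2.2.1
    refine Topology.IsInducing.subtypeVal.continuousOn_iff.mpr ?_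
    refine ContinuousOn.congr (f := fun a : π.Shift L M × π.Shift L M =>
      ((fun l => SY.bracket (a.1.1.1 l) (a.2.1.1 l), fun m => SZ.bracket (a.1.1.2 m) (a.2.1.2 m)) :
        (Fin (L + 1) → Y) × (Fin (M + 1) → Z))) ?_ fun a ha => π.shiftBracket_val ha
    refine ContinuousOn.prodMk (continuousOn_pi.mpr fun l => ?_) (continuousOn_pi.mpr fun m => ?_)
    · refine SY.continuousOn_bracket.comp (f := fun a : π.Shift L M × π.Shift L M =>
        (a.1.1.1 l, a.2.1.1 l)) (by fun_prop) fun a ha => ?_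
      exact (dist_fst_le a.1 a.2 l).trans (le_trans ha hY)
    · refine SZ.continuousOn_bracket.comp (f := fun a : π.Shift L M × π.Shift L M =>
        (a.1.1.2 m, a.2.1.2 m)) (by fun_prop) fun a ha => ?_
      exact (dist_snd_le a.1 a.2 m).trans (le_trans ha hZ)
  bracket_self p := by
    have h : dist p p ≤ π.scale := by simpa using π.scale_spec.1.le
    refine shift_ext (fun l => ?_) fun m => ?_
    · rw [π.shiftBracket_fst h, SY.bracket_self]
    · rw [π.shiftBracket_snd h, SZ.bracket_self]
  bracket_right p q r h1 h2 h3 := by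
    have hY := π.scale_spec.2.1
    have hZ := π.scale_spec.2.2.1
    refine shift_ext (fun l => ?_) fun m => ?_
    · have h2' := (dist_fst_le _ _ l).trans h2
      rw [π.shiftBracket_fst h2, π.shiftBracket_fst h3]
      rw [π.shiftBracket_fst h1] at h2' ⊢
      exact SY.bracket_right _ _ _ ((dist_fst_le _ _ l).trans (h1.trans hY)) (h2'.trans hY)
        ((dist_fst_le _ _ l).trans (h3.trans hY))
    · have h2' := (dist_snd_le _ _ m).trans h2
      rw [π.shiftBracket_snd h2, π.shiftBracket_snd h3]
      rw [π.shiftBracket_snd h1] at h2' ⊢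
      exact SZ.bracket_right _ _ _ ((dist_snd_le _ _ m).trans (h1.trans hZ)) (h2'.trans hZ)
        ((dist_snd_le _ _ m).trans (h3.trans hZ))
  bracket_left p q r h1 h2 h3 := by
    have hY := π.scale_spec.2.1
    have hZ := π.scale_spec.2.2.1
    refine shift_ext (fun l => ?_) fun m => ?_
    · have h2' := (dist_fst_le _ _ l).trans h2
      rw [π.shiftBracket_fst h2, π.shiftBracket_fst h3]
      rw [π.shiftBracket_fst h1] at h2' ⊢
      exact SY.bracket_left _ _ _ ((dist_fst_le _ _ l).trans (h1.trans hY)) (h2'.trans hY)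
        ((dist_fst_le _ _ l).trans (h3.trans hY))
    · have h2' := (dist_snd_le _ _ m).trans h2
      rw [π.shiftBracket_snd h2, π.shiftBracket_snd h3]
      rw [π.shiftBracket_snd h1] at h2' ⊢
      exact SZ.bracket_left _ _ _ ((dist_snd_le _ _ m).trans (h1.trans hZ)) (h2'.trans hZ)
        ((dist_snd_le _ _ m).trans (h3.trans hZ))
  map_bracket p q h1 h2 := by
    have hY := π.scale_spec.2.1
    have hZ := π.scale_spec.2.2.1
    refine shift_ext (fun l => ?_) fun m => ?_
    · have e1 := (dist_fst_le _ _ l).trans (h1.trans hY)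
      have e2 := (dist_fst_le _ _ l).trans (h2.trans hY)
      rw [π.shiftBracket_fst h2]
      change SY.φ ((π.shiftBracket L M p q).1.1 l) = SY.bracket (SY.φ (p.1.1 l)) (SY.φ (q.1.1 l))
      rw [π.shiftBracket_fst h1]
      exact SY.map_bracket _ _ e1 e2
    · have e1 := (dist_snd_le _ _ m).trans (h1.trans hZ)
      have e2 := (dist_snd_le _ _ m).trans (h2.trans hZ)
      rw [π.shiftBracket_snd h2]
      change SZ.φ ((π.shiftBracket L M p q).1.2 m) = SZ.bracket (SZ.φ (p.1.2 m)) (SZ.φ (q.1.2 m))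
      rw [π.shiftBracket_snd h1]
      exact SZ.map_bracket _ _ e1 e2
  contract p q h hb := by
    have hY := π.scale_spec.2.1
    have hZ := π.scale_spec.2.2.1
    have h0 : 0 < max SY.lam SZ.lam := lt_max_of_lt_left SY.lam_pos
    refine (dist_le_iff (mul_nonneg h0.le dist_nonneg)).mpr ⟨fun l => ?_, fun m => ?_⟩
    · refine (SY.contract _ _ ((dist_fst_le p q l).trans (h.trans hY)) ?_).trans
        (mul_le_mul (le_max_left _ _) (dist_fst_le p q l) dist_nonneg h0.le)
      rw [← π.shiftBracket_fst h, hb]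
    · refine (SZ.contract _ _ ((dist_snd_le p q m).trans (h.trans hZ)) ?_).trans
        (mul_le_mul (le_max_right _ _) (dist_snd_le p q m) dist_nonneg h0.le)
      rw [← π.shiftBracket_snd h, hb]
  expand p q h hb := by
    have hY := π.scale_spec.2.1
    have hZ := π.scale_spec.2.2.1
    have h0 : 0 < max SY.lam SZ.lam := lt_max_of_lt_left SY.lam_pos
    refine (dist_le_iff (mul_nonneg h0.le dist_nonneg)).mpr ⟨fun l => ?_, fun m => ?_⟩
    · refine (SY.expand _ _ ((dist_fst_le p q l).trans (h.trans hY)) ?_).trans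
        (mul_le_mul (le_max_left _ _) (dist_fst_le p q l) dist_nonneg h0.le)
      rw [← π.shiftBracket_fst h, hb]
    · refine (SZ.expand _ _ ((dist_snd_le p q m).trans (h.trans hZ)) ?_).trans
        (mul_le_mul (le_max_right _ _) (dist_snd_le p q m) dist_nonneg h0.le)
      rw [← π.shiftBracket_snd h, hb]

lemma shift_iterate_fst {L M : ℕ} (n : ℕ) (p : π.Shift L M) (l : Fin (L + 1)) :
    ((π.shiftSpace L M).φ^[n] p).1.1 l = SY.φ^[n] (p.1.1 l) := by
  induction n with
  | zero => rfl
  | succ n ih =>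
    rw [Function.iterate_succ_apply', Function.iterate_succ_apply', ← ih]
    rfl

lemma shift_iterate_snd {L M : ℕ} (n : ℕ) (p : π.Shift L M) (m : Fin (M + 1)) :
    ((π.shiftSpace L M).φ^[n] p).1.2 m = SZ.φ^[n] (p.1.2 m) := by
  induction n with
  | zero => rfl
  | succ n ih =>
    rw [Function.iterate_succ_apply', Function.iterate_succ_apply', ← ih]
    rfl

lemma asymptotic_iff {L M : ℕ} {p q : π.Shift L M} :
    Asymptotic (π.shiftSpace L M).φ p q ↔ (∀ l, Asymptotic SY.φ (p.1.1 l) (q.1.1 l)) ∧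
      ∀ m, Asymptotic SZ.φ (p.1.2 m) (q.1.2 m) := by
  constructor
  · refine fun h => ⟨fun l => ?_, fun m => ?_⟩
    · refine squeeze_zero (fun _ => dist_nonneg) (fun n => ?_) h
      rw [← π.shift_iterate_fst, ← π.shift_iterate_fst]
      exact dist_fst_le _ _ l
    · refine squeeze_zero (fun _ => dist_nonneg) (fun n => ?_) h
      rw [← π.shift_iterate_snd, ← π.shift_iterate_snd]
      exact dist_snd_le _ _ m
  · rintro ⟨h1, h2⟩
    have h3 : Tendsto (fun n : ℕ => (∑ l, dist (SY.φ^[n] (p.1.1 l)) (SY.φ^[n] (q.1.1 l))) +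
        ∑ m, dist (SZ.φ^[n] (p.1.2 m)) (SZ.φ^[n] (q.1.2 m))) atTop (𝓝 0) := by
      simpa using (tendsto_finsetSum Finset.univ fun l _ => h1 l).add
        (tendsto_finsetSum Finset.univ fun m _ => h2 m)
    refine squeeze_zero (fun _ => dist_nonneg) (fun n => ?_) h3
    have n1 : ∀ l ∈ Finset.univ, 0 ≤ dist (SY.φ^[n] (p.1.1 l)) (SY.φ^[n] (q.1.1 l)) :=
      fun _ _ => dist_nonneg
    have n2 : ∀ m ∈ Finset.univ, 0 ≤ dist (SZ.φ^[n] (p.1.2 m)) (SZ.φ^[n] (q.1.2 m)) :=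
      fun _ _ => dist_nonneg
    refine (dist_le_iff (add_nonneg (Finset.sum_nonneg n1) (Finset.sum_nonneg n2))).mpr
      ⟨fun l => ?_, fun m => ?_⟩
    · rw [π.shift_iterate_fst, π.shift_iterate_fst]
      exact (Finset.single_le_sum n1 (Finset.mem_univ l)).trans
        (le_add_of_nonneg_right (Finset.sum_nonneg n2))
    · rw [π.shift_iterate_snd, π.shift_iterate_snd]
      exact (Finset.single_le_sum n2 (Finset.mem_univ m)).trans
        (le_add_of_nonneg_left (Finset.sum_nonneg n1))

/-- All reindexing maps (faces, degeneracies, permutations) are `s`-bijective. -/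
lemma reindex_isStrict {K L : ℕ} (M : ℕ) (θ : Fin (K + 1) → Fin (L + 1)) :
    IsStrict (π.shiftSpace L M) (π.shiftSpace K M) (π.reindex M θ) where
  continuous := by unfold reindex; fun_prop
  map_φ _ := rfl
  eps_eq := rfl
  dist_le := π.dist_reindex_le θ
  map_bracket p q h := by
    have h' := (π.dist_reindex_le θ p q).trans h
    refine shift_ext (fun k => ?_) fun m => ?_
    · exact (π.shiftBracket_fst h (θ k)).trans (π.shiftBracket_fst h' k).symm
    · exact (π.shiftBracket_snd h m).trans (π.shiftBracket_snd h' m).symm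
  bijOn e := by
    refine ⟨fun p hp => ?_, fun p hp q hq hpq => ?_, fun q hq => ?_⟩
    · exact π.asymptotic_iff.mpr ⟨fun k => (π.asymptotic_iff.mp hp).1 (θ k),
        (π.asymptotic_iff.mp hp).2⟩
    · have hz : ∀ m, p.1.2 m = q.1.2 m := fun m => congrFun (congrArg (fun x => x.1.2) hpq) m
      refine shift_ext (fun l => ?_) hz
      refine (π.πs_sBijective.bijOn (e.1.1 l)).injOn ((π.asymptotic_iff.mp hp).1 l)
        ((π.asymptotic_iff.mp hq).1 l) ?_
      rw [p.2 l 0, q.2 l 0, hz 0]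
    · have hq' := π.asymptotic_iff.mp hq
      have hx : ∀ l, π.πu (q.1.2 0) ∈ SX.stableSet (π.πs (e.1.1 l)) := fun l => by
        rw [e.2 l 0]
        exact π.πu_uBijective.toIsMap.asymptotic (hq'.2 0)
      choose y hy hyx using fun l => (π.πs_sBijective.bijOn (e.1.1 l)).surjOn (hx l)
      refine ⟨⟨(y, q.1.2), fun l m => ?_⟩, π.asymptotic_iff.mpr ⟨hy, hq'.2⟩, ?_⟩
      · rw [hyx, ← q.2 0 0, ← q.2 0 m]
      · refine shift_ext (fun k => ?_) fun m => rfl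
        refine (π.πs_sBijective.bijOn (e.1.1 (θ k))).injOn (hy (θ k)) (hq'.1 k) ?_
        rw [hyx, q.2 k 0]

/-- The group `C_{L,M} = D^s(Σ_{L,M}(π))`. -/
def chains (L M : ℕ) : Type _ := DimGroup (π.shiftSpace L M)

noncomputable instance (L M : ℕ) : AddCommGroup (π.chains L M) :=
  inferInstanceAs (AddCommGroup (DimGroup (π.shiftSpace L M)))

/-- The homomorphism on dimension groups induced by a reindexing map. -/
noncomputable def pull {K L : ℕ} (M : ℕ) (θ : Fin (K + 1) → Fin (L + 1)) :
    π.chains L M →+ π.chains K M :=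
  dimMap (π.reindex_isStrict M θ)

/-- The face map `δ_l^s`, induced by deleting the entry `y_l`. -/
noncomputable def face {L : ℕ} (M : ℕ) (l : Fin (L + 2)) : π.chains (L + 1) M →+ π.chains L M :=
  π.pull M l.succAbove

/-- The generalized degeneracy `(σ_j s_l)^s` for `q = l + j > l`. It is induced by the map that
repeats the entry `y_l` at coordinate `q`:
`(y_0, …, y_L) ↦ (y_0, …, y_{q-1}, y_l, y_q, …, y_L)`. -/
noncomputable def degeneracy {L : ℕ} (M : ℕ) (l : Fin (L + 1)) (q : Fin (L + 2)) :
    π.chains L M →+ π.chains (L + 1) M :=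
  π.pull M (Fin.insertNth (α := fun _ => Fin (L + 1)) q l id)

/-- The action of a permutation of the `Y`-coordinates: the entry `y_i` of a tuple is moved to
position `α i`. -/
noncomputable def perm {L : ℕ} (M : ℕ) (α : Equiv.Perm (Fin (L + 1))) :
    π.chains L M →+ π.chains L M :=
  π.pull M (α⁻¹ : Equiv.Perm (Fin (L + 1)))

/-- The differential `∂^s = ∑ (-1)^l δ_l^s`. -/
noncomputable def boundary (L M : ℕ) : π.chains (L + 1) M →+ π.chains L M :=
  ∑ l : Fin (L + 2), ((-1 : ℤ) ^ (l : ℕ)) • π.face M l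

/-- The subgroup `∑_{l,j} (σ_j s_l)^s(C_{L-1,M})` of `C_{L,M}`. -/
noncomputable def degenerate (M : ℕ) : (L : ℕ) → AddSubgroup (π.chains L M)
  | 0 => ⊥
  | L + 1 => ⨆ (l : Fin (L + 1)) (q : Fin (L + 2)) (_ : l.castSucc < q), (π.degeneracy M l q).range

/-- The subgroup of `C_{L,M}` generated by the elements `α(a) - sgn(α) a`. -/
noncomputable def signed (M L : ℕ) : AddSubgroup (π.chains L M) :=
  AddSubgroup.closure {x | ∃ (α : Equiv.Perm (Fin (L + 1))) (a : π.chains L M),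
    x = π.perm M α a - (Equiv.Perm.sign α : ℤ) • a}

/-- The group of degenerate chains `DC_{L,M}`. -/
noncomputable def DC (M L : ℕ) : AddSubgroup (π.chains L M) :=
  π.degenerate M L ⊔ π.signed M L

lemma pull_pull {J K L M : ℕ} (θ : Fin (K + 1) → Fin (L + 1)) (τ : Fin (J + 1) → Fin (K + 1))
    (a : π.chains L M) : π.pull M τ (π.pull M θ a) = π.pull M (θ ∘ τ) a :=
  (dimMap_comp (π.reindex_isStrict M θ) (π.reindex_isStrict M τ)
    (π.reindex_isStrict M (θ ∘ τ)) a).symm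

lemma pull_id {L M : ℕ} (a : π.chains L M) : π.pull M id a = a :=
  dimMap_id (π.reindex_isStrict M id) a

lemma boundary_apply {L M : ℕ} (a : π.chains (L + 1) M) :
    π.boundary L M a = ∑ l : Fin (L + 2), ((-1 : ℤ) ^ (l : ℕ)) • π.face M l a := by
  simp [boundary, AddMonoidHom.finsetSum_apply]

open CategoryTheory in
/-- The simplicial group `L ↦ D^s(Σ_{L,M}(π))`. -/
noncomputable def simplicialGroup (M : ℕ) : SimplicialObject AddCommGrpCat where
  obj n := AddCommGrpCat.of (π.chains n.unop.len M)
  map θ := AddCommGrpCat.ofHom (π.pull M θ.unop.toOrderHom)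
  map_id _ := AddCommGrpCat.hom_ext (AddMonoidHom.ext fun a => π.pull_id a)
  map_comp θ τ := AddCommGrpCat.hom_ext (AddMonoidHom.ext fun a =>
    (π.pull_pull (M := M) θ.unop.toOrderHom τ.unop.toOrderHom a).symm)

open CategoryTheory in
lemma boundary_boundary {L M : ℕ} (a : π.chains (L + 2) M) :
    π.boundary L M (π.boundary (L + 1) M a) = 0 := by
  have key : ∀ n : ℕ, AlgebraicTopology.AlternatingFaceMapComplex.objD (π.simplicialGroup M) n =
      AddCommGrpCat.ofHom (π.boundary n M) := by
    intro n
    apply AddCommGrpCat.homAddEquiv.injective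
    simp only [AlgebraicTopology.AlternatingFaceMapComplex.objD, map_sum, map_zsmul]
    rfl
  have h := AlgebraicTopology.AlternatingFaceMapComplex.d_squared (π.simplicialGroup M) L
  rw [key, key] at h
  exact congrArg (fun f => f.hom a) h

/-- The generalized degeneracy is the composite of the usual degeneracy `s_l` (repeating `y_l` at
coordinate `l + 1`) and the cycle `σ_j = (q q-1 ⋯ l+1)`, `q = l + j`. -/
lemma degeneracy_eq_perm {L M : ℕ} (l : Fin (L + 1)) (q : Fin (L + 2)) (h : l.castSucc < q)
    (a : π.chains L M) : π.degeneracy M l q a =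
      π.perm M (Fin.cycleIcc l.succ q)⁻¹ (π.pull M l.predAbove a) := by
  rw [degeneracy, insertNth_eq_predAbove_comp_cycleIcc l q h, perm, inv_inv, pull_pull]

/-- Everything that comes from tuples with two equal entries is degenerate. -/
lemma pull_mem_degenerate {K L M : ℕ} (θ : Fin (L + 1) → Fin (K + 1)) (p q : Fin (L + 1))
    (hpq : p < q) (h : θ p = θ q) (a : π.chains K M) : π.pull M θ a ∈ π.degenerate M L := by
  cases L with
  | zero => omega
  | succ L =>
    have hp : p ≠ Fin.last _ := (hpq.trans_le (Fin.le_last _)).ne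
    have e : θ = (θ ∘ q.succAbove) ∘
        (Fin.insertNth (α := fun _ => Fin (L + 1)) q (p.castPred hp) id) := by
      funext i
      refine Fin.succAboveCases q ?_ (fun j => ?_) i
      · simp only [Function.comp_apply, Fin.insertNth_apply_same]
        rw [Fin.succAbove_of_castSucc_lt _ _ (by simpa using hpq), Fin.castSucc_castPred, h]
      · simp
    rw [e, ← π.pull_pull]
    refine AddSubgroup.mem_iSup_of_mem (p.castPred hp) (AddSubgroup.mem_iSup_of_mem q
      (AddSubgroup.mem_iSup_of_mem (by simpa using hpq) ⟨_, rfl⟩))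

lemma perm_sub_mem {L M : ℕ} (α : Equiv.Perm (Fin (L + 1))) (a : π.chains L M) :
    π.perm M α a - (Equiv.Perm.sign α : ℤ) • a ∈ π.signed M L :=
  AddSubgroup.subset_closure ⟨α, a, rfl⟩

lemma boundary_degeneracy_mem {L M : ℕ} (l : Fin (L + 1)) (q : Fin (L + 2))
    (hlq : l.castSucc < q) (a : π.chains L M) :
    π.boundary L M (π.degeneracy M l q a) ∈ π.DC M L := by
  set ρ : Fin (L + 2) → Fin (L + 1) := Fin.insertNth (α := fun _ => Fin (L + 1)) q l id with hρ
  have hρq : ρ q = l := by simp [hρ]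
  have hρs : ∀ j, ρ (q.succAbove j) = j := fun j => by simp [hρ]
  have hρl : ρ l.castSucc = l := by
    have := hρs l
    rwa [Fin.succAbove_of_castSucc_lt _ _ hlq] at this
  have hne : l.castSucc ≠ q := hlq.ne
  have hf : ∀ i, π.face M i (π.degeneracy M l q a) = π.pull M (ρ ∘ i.succAbove) a :=
    fun i => π.pull_pull _ _ a
  rw [boundary_apply]
  simp only [hf]
  rw [← Finset.add_sum_erase _ _ (Finset.mem_univ q),
    ← Finset.add_sum_erase _ _ (Finset.mem_erase.mpr ⟨hne, Finset.mem_univ l.castSucc⟩),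
    ← add_assoc]
  refine add_mem ?_ (sum_mem fun i hi => ?_)
  · have e1 : ρ ∘ q.succAbove = id := funext hρs
    have hq0 : q ≠ 0 := (lt_of_le_of_lt (Fin.zero_le _) hlq).ne'
    set r := q.pred hq0 with hr
    have hqr : q = r.succ := (Fin.succ_pred q hq0).symm
    have hlr : l ≤ r := by
      rw [hqr] at hlq
      exact Fin.castSucc_lt_succ_iff.mp hlq
    have e2 : ρ ∘ l.castSucc.succAbove = Fin.cycleIcc l r :=
      comp_succAbove_eq_cycleIcc l r hlr ρ q hqr hρq hρs
    have hs : Equiv.Perm.sign (Fin.cycleIcc l r)⁻¹ = (-1) ^ ((r : ℕ) - l) := by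
      rw [Equiv.Perm.sign_inv, Fin.sign_cycleIcc_of_le hlr]
    have hm := π.perm_sub_mem (M := M) (Fin.cycleIcc l r)⁻¹ a
    rw [hs] at hm
    have hm' := AddSubgroup.zsmul_mem _ hm ((-1 : ℤ) ^ (l : ℕ))
    refine AddSubgroup.mem_sup_right ?_
    convert hm' using 1
    rw [e1, π.pull_id, e2, perm, inv_inv, smul_sub, smul_smul]
    have : ((-1 : ℤ) ^ (q : ℕ)) = -((-1) ^ (l : ℕ) * (((-1 : ℤˣ) ^ ((r : ℕ) - l) : ℤˣ) : ℤ)) := by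
      have hle : (l : ℕ) ≤ r := hlr
      rw [Units.val_pow_eq_pow_val, Units.val_neg, Units.val_one, ← pow_add,
        Nat.add_sub_cancel' hle, hqr, Fin.val_succ, pow_succ]
      ring
    rw [this, neg_smul, Fin.val_castSucc]
    abel
  · refine AddSubgroup.zsmul_mem _ (AddSubgroup.mem_sup_left ?_) _
    have hil : i ≠ l.castSucc := (Finset.mem_erase.mp hi).1
    have hiq : i ≠ q := (Finset.mem_erase.mp (Finset.mem_erase.mp hi).2).1
    obtain ⟨u, hu⟩ := Fin.exists_succAbove_eq hil.symm
    obtain ⟨v, hv⟩ := Fin.exists_succAbove_eq hiq.symm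
    refine π.pull_mem_degenerate _ u v ?_ ?_ a
    · rw [← Fin.succAbove_lt_succAbove_iff (p := i), hu, hv]
      exact hlq
    · simp only [Function.comp_apply, hu, hv, hρl, hρq]

lemma boundary_swap_mem {L M : ℕ} (i : Fin (L + 1)) (a : π.chains (L + 1) M) :
    π.boundary L M (π.perm M (Equiv.swap i.castSucc i.succ) a) + π.boundary L M a ∈
      π.signed M L := by
  set t := Equiv.swap i.castSucc i.succ with ht
  have hne : i.castSucc ≠ i.succ := Fin.castSucc_lt_succ.ne
  have htinv : t⁻¹ = t := Equiv.swap_inv _ _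
  have hf : ∀ k, π.face M k (π.perm M t a) = π.pull M (t ∘ k.succAbove) a := fun k => by
    rw [perm, htinv]
    exact π.pull_pull _ _ a
  rw [boundary_apply, boundary_apply, ← Finset.sum_add_distrib]
  simp only [hf, ← smul_add]
  rw [← Finset.add_sum_erase _ _ (Finset.mem_univ i.castSucc),
    ← Finset.add_sum_erase _ _ (Finset.mem_erase.mpr ⟨hne.symm, Finset.mem_univ i.succ⟩),
    ← add_assoc]
  refine add_mem ?_ (sum_mem fun k hk => ?_)
  · have e1 : t ∘ i.castSucc.succAbove = i.succ.succAbove := swap_comp_succAbove i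
    have e2 : t ∘ i.succ.succAbove = i.castSucc.succAbove := by
      rw [← e1, ← Function.comp_assoc, ht]
      funext x
      simp
    rw [e1, e2, Fin.val_succ, Fin.val_castSucc, pow_succ]
    convert zero_mem (π.signed M L) using 1
    simp only [face, mul_neg, mul_one, neg_smul, smul_add]
    abel
  · refine AddSubgroup.zsmul_mem _ ?_ _
    have hks : k ≠ i.succ := (Finset.mem_erase.mp hk).1
    have hkc : k ≠ i.castSucc := (Finset.mem_erase.mp (Finset.mem_erase.mp hk).2).1
    obtain ⟨u, hu⟩ := Fin.exists_succAbove_eq hkc.symm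
    obtain ⟨v, hv⟩ := Fin.exists_succAbove_eq hks.symm
    have huv : u ≠ v := by
      rintro rfl
      exact hne (hu.symm.trans hv)
    have e : t ∘ k.succAbove = k.succAbove ∘ Equiv.swap u v := by
      rw [ht, ← hu, ← hv]
      exact (Fin.succAbove_right_injective (p := k)).swap_comp u v
    have hm := π.perm_sub_mem (M := M) (Equiv.swap u v) (π.face M k a)
    rw [Equiv.Perm.sign_swap huv] at hm
    convert hm using 1
    rw [e, ← π.pull_pull, perm, Equiv.swap_inv]
    simp [face]

lemma boundary_perm_mem {L M : ℕ} (α : Equiv.Perm (Fin (L + 2))) : ∀ a : π.chains (L + 1) M,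
    π.boundary L M (π.perm M α a - (Equiv.Perm.sign α : ℤ) • a) ∈ π.signed M L := by
  have hα : α ∈ Submonoid.closure
      (Set.range fun i : Fin (L + 1) => Equiv.swap i.castSucc i.succ) := by
    rw [Equiv.Perm.mclosure_swap_castSucc_succ]
    trivial
  induction hα using Submonoid.closure_induction with
  | mem x hx =>
    obtain ⟨i, rfl⟩ := hx
    intro a
    have := π.boundary_swap_mem (M := M) i a
    simp only [Equiv.Perm.sign_swap Fin.castSucc_lt_succ.ne]
    simpa using this
  | one =>
    intro a
    have : π.perm M (1 : Equiv.Perm (Fin (L + 2))) a = a := by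
      rw [perm, inv_one]
      exact π.pull_id a
    simp [this]
  | mul x y _ _ hx hy =>
    intro a
    have e : π.perm M (x * y) a = π.perm M x (π.perm M y a) := by
      simp only [perm, pull_pull, mul_inv_rev]
      rfl
    have e' : π.perm M (x * y) a - (Equiv.Perm.sign (x * y) : ℤ) • a =
        (π.perm M x (π.perm M y a) - (Equiv.Perm.sign x : ℤ) • π.perm M y a) +
          (Equiv.Perm.sign x : ℤ) • (π.perm M y a - (Equiv.Perm.sign y : ℤ) • a) := by
      rw [e, smul_sub, smul_smul, Equiv.Perm.sign_mul, Units.val_mul]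
      abel
    rw [e', map_add, map_zsmul]
    exact add_mem (hx _) (AddSubgroup.zsmul_mem _ (hy a) _)

/-- The differential preserves degenerate chains. -/
lemma boundary_mem {L M : ℕ} : π.DC M (L + 1) ≤ (π.DC M L).comap (π.boundary L M) := by
  refine sup_le ?_ ((AddSubgroup.closure_le _).mpr ?_)
  · refine iSup_le fun l => iSup_le fun q => iSup_le fun hlq => ?_
    rintro _ ⟨a, rfl⟩
    exact π.boundary_degeneracy_mem l q hlq a
  · rintro _ ⟨α, a, rfl⟩
    exact AddSubgroup.mem_sup_right (π.boundary_perm_mem α a)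

lemma boundary_mem_DC {L M : ℕ} {a : π.chains (L + 1) M} (ha : a ∈ π.DC M (L + 1)) :
    π.boundary L M a ∈ π.DC M L :=
  AddSubgroup.mem_comap.mp (π.boundary_mem ha)

open CategoryTheory

/-- The chain complex `(C_{•,M}, ∂^s)`. -/
noncomputable def chainComplex (M : ℕ) : ChainComplex AddCommGrpCat ℕ :=
  ChainComplex.of (fun L => AddCommGrpCat.of (π.chains L M))
    (fun L => AddCommGrpCat.ofHom (π.boundary L M)) fun _ =>
      AddCommGrpCat.hom_ext (AddMonoidHom.ext fun a => π.boundary_boundary a)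

/-- The restriction of the differential to degenerate chains. -/
noncomputable def boundaryDC (L M : ℕ) : π.DC M (L + 1) →+ π.DC M L where
  toFun a := ⟨π.boundary L M a.1, π.boundary_mem_DC a.2⟩
  map_zero' := Subtype.ext (map_zero (π.boundary L M))
  map_add' a b := Subtype.ext (map_add (π.boundary L M) a.1 b.1)

/-- The chain complex `(DC_{•,M}, ∂^s)`. -/
noncomputable def degenerateComplex (M : ℕ) : ChainComplex AddCommGrpCat ℕ :=
  ChainComplex.of (fun L => AddCommGrpCat.of (π.DC M L))
    (fun L => AddCommGrpCat.ofHom (π.boundaryDC L M)) fun L =>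
      AddCommGrpCat.hom_ext (AddMonoidHom.ext fun a => Subtype.ext (π.boundary_boundary a.1))

/-- The differential induced on the quotients `C_{L,M} / DC_{L,M}`. -/
noncomputable def boundaryQuotient (L M : ℕ) :
    π.chains (L + 1) M ⧸ π.DC M (L + 1) →+ π.chains L M ⧸ π.DC M L :=
  QuotientAddGroup.map _ _ (π.boundary L M) π.boundary_mem

/-- The chain complex `(C_{•,M} / DC_{•,M}, ∂^s)`. -/
noncomputable def quotientComplex (M : ℕ) : ChainComplex AddCommGrpCat ℕ :=
  ChainComplex.of (fun L => AddCommGrpCat.of (π.chains L M ⧸ π.DC M L))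
    (fun L => AddCommGrpCat.ofHom (π.boundaryQuotient L M)) fun _ =>
      AddCommGrpCat.hom_ext (QuotientAddGroup.addMonoidHom_ext _ (AddMonoidHom.ext fun a =>
        congrArg (QuotientAddGroup.mk (s := π.DC M _)) (π.boundary_boundary a)))

/-- The inclusion `DC_{•,M} → C_{•,M}`. -/
noncomputable def inclusion (M : ℕ) : π.degenerateComplex M ⟶ π.chainComplex M :=
  ChainComplex.ofHom (fun L => AddCommGrpCat.ofHom (π.DC M L).subtype) fun L => by
    simp only [degenerateComplex, chainComplex, ChainComplex.of_d]
    rfl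

/-- The projection `C_{•,M} → C_{•,M} / DC_{•,M}`. -/
noncomputable def projection (M : ℕ) : π.chainComplex M ⟶ π.quotientComplex M :=
  ChainComplex.ofHom
    (fun L => AddCommGrpCat.ofHom (QuotientAddGroup.mk' (π.DC M L))) fun L => by
    simp only [quotientComplex, chainComplex, ChainComplex.of_d]
    rfl

/-- The sequence `0 → DC_{•,M} → C_{•,M} → C_{•,M} / DC_{•,M} → 0`. -/
noncomputable def shortComplex (M : ℕ) : ShortComplex (ChainComplex AddCommGrpCat ℕ) :=
  ShortComplex.mk (π.inclusion M) (π.projection M) (by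
    refine HomologicalComplex.hom_ext _ _ fun L => AddCommGrpCat.hom_ext (AddMonoidHom.ext fun a => ?_)
    exact (QuotientAddGroup.eq_zero_iff _).mpr a.2)

end Compact

end SUPair

end SmaleHomology

/-! The algebra behind the theorem is the classical comparison of ordered and oriented simplicial
chains. Sorting a tuple, with its sign and with value zero on repeated entries, is a chain map, and
iterated cones give a homotopy h with ∂h + h∂ = id − sort that uses only the vertices of the given
tuple. Sorting kills degenerate chains, and x − sort(x) is always degenerate. So a degenerate cycle
x of positive degree equals ∂(hx), and then also ∂(hx − sort(hx)), because sort commutes with ∂ and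
sort(x) = 0; this filling is degenerate (`LabelledSystem.exists_bdy_eq`).

To make the dimension groups look like ordered chains, cut Σ_{0,M} into small clopen pieces, which
is possible because its stable and unstable leaves are totally disconnected, and label a point (y_0,
…, y_L, z) by the symbols of the points (y_l, z). The partition can be chosen so that two points of
Σ_{0,M} with the same z and the same symbol have the same symbols at all past times
(`exists_partition`): nearby points with equal z lie on a common local unstable set. Hence, on a
compact open set whose label at time −n is a, two reindexings θ and θ' with a ∘ θ = a ∘ θ' have
images matched by a leafwise homeomorphism that preserves the itinerary at all times −k, k ≥ n. For
a fine partition, sets matched in this way have the same class in D^s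
(`SmaleSpace.exists_dimClass_eq`).

Labels at a fixed time are not invariants of ∼, since equivalent sets share only a sufficiently
remote past. Therefore D^s is approximated by groups `Approx n`, in which only sets with a matching
past from time −n backwards are identified. Each level splits by labels at time −n and forms a
`LabelledSystem`, so the simplicial argument applies to it. Conversely ∼ always gives a matching
past from some time on (`exists_leafHomeo_of_dimRel`), so an element of level 0 that dies in D^s
dies at a finite level (`exists_trans_eq_zero`). A degenerate cycle of D^s is lifted to a degenerate
chain at level 0, pushed to a level where its boundary vanishes, filled there, and mapped back. In
degree 0 there are no nonzero degenerate chains, and the quasi-isomorphism follows from the long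
exact homology sequence. -/

namespace SmaleHomology

/-! ### Ordered chains -/

/-- A function on tuples is alternating if it vanishes on tuples with repeated entries and changes
by the sign under permutations. -/
structure IsAlternating {V G : Type*} [AddCommGroup G] {K : ℕ} (t : (Fin K → V) → G) : Prop where
  perm : ∀ (a : Fin K → V) (α : Equiv.Perm (Fin K)),
    t (a ∘ α) = (Equiv.Perm.sign α : ℤ) • t a
  eq_zero : ∀ a : Fin K → V, ¬ Function.Injective a → t a = 0

/-- The alternating sum of the values on the faces of a tuple. -/
def faceSum {V G : Type*} [AddCommGroup G] {K : ℕ} (t : (Fin K → V) → G) (a : Fin (K + 1) → V) :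
    G :=
  ∑ l : Fin (K + 1), (-1 : ℤ) ^ (l : ℕ) • t (a ∘ l.succAbove)

/-! ### Alternating functions on tuples and their face sums -/

namespace IsAlternating

variable {V G : Type*} [AddCommGroup G] {K : ℕ} {t t' : (Fin K → V) → G}


/-- The transposition exchanges faces i and i + 1, which carry opposite signs; on any other face it
acts as a transposition of two remaining entries, where `t` changes sign. -/
lemma faceSum_swap {t : (Fin (K + 1) → V) → G} (ht : IsAlternating t) (a : Fin (K + 2) → V)
    (i : Fin (K + 1)) : faceSum t (a ∘ Equiv.swap i.castSucc i.succ) = -faceSum t a := by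
  rw [eq_neg_iff_add_eq_zero, faceSum, faceSum, ← Finset.sum_add_distrib]
  simp only [← smul_add]
  have hne : i.castSucc ≠ i.succ := Fin.castSucc_lt_succ.ne
  rw [← Finset.add_sum_erase _ _ (Finset.mem_univ i.castSucc),
    ← Finset.add_sum_erase _ _ (Finset.mem_erase.mpr ⟨hne.symm, Finset.mem_univ i.succ⟩),
    Finset.sum_eq_zero, add_zero]
  · have e1 := SUPair.swap_comp_succAbove i
    have e2 : Equiv.swap i.castSucc i.succ ∘ i.succ.succAbove = i.castSucc.succAbove := by
      rw [← e1, ← Function.comp_assoc]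
      funext x
      simp
    rw [Function.comp_assoc, Function.comp_assoc, e1, e2, Fin.val_succ, Fin.val_castSucc, pow_succ]
    simp only [mul_neg, mul_one, neg_smul, smul_add]
    abel
  · intro k hk
    have hks : k ≠ i.succ := (Finset.mem_erase.mp hk).1
    have hkc : k ≠ i.castSucc := (Finset.mem_erase.mp (Finset.mem_erase.mp hk).2).1
    obtain ⟨u, hu⟩ := Fin.exists_succAbove_eq hkc.symm
    obtain ⟨v, hv⟩ := Fin.exists_succAbove_eq hks.symm
    have huv : u ≠ v := by
      rintro rfl
      exact hne (hu.symm.trans hv)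
    have e : Equiv.swap i.castSucc i.succ ∘ k.succAbove = k.succAbove ∘ Equiv.swap u v := by
      rw [← hu, ← hv]
      exact (Fin.succAbove_right_injective (p := k)).swap_comp u v
    rw [Function.comp_assoc, e, ← Function.comp_assoc, ht.perm, Equiv.Perm.sign_swap huv]
    simp

lemma faceSum_perm {t : (Fin K → V) → G} (ht : IsAlternating t) (α : Equiv.Perm (Fin (K + 1))) :
    ∀ a : Fin (K + 1) → V, faceSum t (a ∘ α) = (Equiv.Perm.sign α : ℤ) • faceSum t a := by
  cases K with
  | zero =>
    intro a
    rw [show α = 1 from Equiv.ext fun i => Subsingleton.elim (α := Fin 1) _ _]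
    simp
  | succ K =>
    have hα : α ∈ Submonoid.closure
        (Set.range fun i : Fin (K + 1) => Equiv.swap i.castSucc i.succ) := by
      rw [Equiv.Perm.mclosure_swap_castSucc_succ]
      trivial
    induction hα using Submonoid.closure_induction with
    | mem x hx =>
      obtain ⟨i, rfl⟩ := hx
      intro a
      simp only [Equiv.Perm.sign_swap Fin.castSucc_lt_succ.ne, faceSum_swap ht]
      simp
    | one => simp
    | mul x y _ _ hx hy =>
      intro a
      rw [Equiv.Perm.coe_mul, ← Function.comp_assoc, hy, hx, smul_smul, Equiv.Perm.sign_mul,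
        Units.val_mul, mul_comm]

/-- If the entries at i < j agree, every face other than i and j still has a repetition. Faces i and
j differ by a cycle of j − i entries, whose sign makes the two terms cancel. -/
lemma faceSum_eq_zero {t : (Fin K → V) → G} (ht : IsAlternating t) (a : Fin (K + 1) → V)
    (ha : ¬ Function.Injective a) : faceSum t a = 0 := by
  obtain ⟨i, j, hij, hne⟩ : ∃ i j, a i = a j ∧ i < j := by
    simp only [Function.Injective] at ha
    push Not at ha
    obtain ⟨i, j, h, hne⟩ := ha
    rcases lt_or_gt_of_ne hne with h' | h'
    · exact ⟨i, j, h, h'⟩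
    · exact ⟨j, i, h.symm, h'⟩
  cases K with
  | zero => omega
  | succ K =>
    rw [faceSum, ← Finset.add_sum_erase _ _ (Finset.mem_univ j),
      ← Finset.add_sum_erase _ _ (Finset.mem_erase.mpr ⟨hne.ne, Finset.mem_univ i⟩),
      Finset.sum_eq_zero, add_zero]
    · obtain ⟨l, rfl⟩ : ∃ l : Fin (K + 1), l.castSucc = i :=
        ⟨i.castPred (hne.trans_le (Fin.le_last _)).ne, Fin.castSucc_castPred _ _⟩
      obtain ⟨r, rfl⟩ : ∃ r : Fin (K + 1), r.succ = j :=
        ⟨j.pred ((Fin.zero_le _).trans_lt hne).ne', Fin.succ_pred _ _⟩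
      have hlr : l ≤ r := Fin.castSucc_lt_succ_iff.mp hne
      set ρ : Fin (K + 2) → Fin (K + 1) := Fin.insertNth (α := fun _ => Fin (K + 1)) r.succ l id
        with hρ
      have hρq : ρ r.succ = l := by simp [hρ]
      have hρs : ∀ k, ρ (r.succ.succAbove k) = k := fun k => by simp [hρ]
      have ha' : a = (a ∘ r.succ.succAbove) ∘ ρ := by
        funext k
        refine Fin.succAboveCases r.succ ?_ (fun k => ?_) k
        · simp only [Function.comp_apply, hρq]
          rw [Fin.succAbove_of_castSucc_lt _ _ hne, hij]
        · simp only [Function.comp_apply, hρs]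
      have e2 : a ∘ l.castSucc.succAbove = (a ∘ r.succ.succAbove) ∘ Fin.cycleIcc l r := by
        rw [← SUPair.comp_succAbove_eq_cycleIcc l r hlr ρ r.succ rfl hρq hρs, ← Function.comp_assoc,
          ← ha']
      rw [e2, ht.perm, Fin.sign_cycleIcc_of_le hlr, smul_smul, ← add_smul, Fin.val_succ,
        Fin.val_castSucc, Units.val_pow_eq_pow_val, Units.val_neg, Units.val_one, ← pow_add,
        Nat.add_sub_cancel' (show (l : ℕ) ≤ r from hlr), pow_succ]
      simp
    · intro k hk
      have hki : k ≠ i := (Finset.mem_erase.mp hk).1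
      have hkj : k ≠ j := (Finset.mem_erase.mp (Finset.mem_erase.mp hk).2).1
      obtain ⟨u, rfl⟩ := Fin.exists_succAbove_eq hki.symm
      obtain ⟨v, rfl⟩ := Fin.exists_succAbove_eq hkj.symm
      rw [ht.eq_zero _ fun h => ?_, smul_zero]
      have : u = v := h hij
      exact hne.ne (by rw [this])

lemma isAlternating_faceSum {t : (Fin K → V) → G} (ht : IsAlternating t) : IsAlternating (faceSum t) :=
  ⟨fun a α => faceSum_perm ht α a, faceSum_eq_zero ht⟩

/-- An injective tuple is a permutation of an increasing one, and all others give zero. This reduces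
identities between alternating expressions to increasing tuples. -/
lemma ext [LinearOrder V] (ht : IsAlternating t) (ht' : IsAlternating t')
    (h : ∀ a : Fin K → V, StrictMono a → t a = t' a) : t = t' := by
  funext a
  by_cases ha : Function.Injective a
  · have h1 := h (a ∘ Tuple.sort a)
      ((Tuple.monotone_sort a).strictMono_of_injective (ha.comp (Tuple.sort a).injective))
    rw [ht.perm, ht'.perm] at h1
    have h2 := congrArg (fun z => (Equiv.Perm.sign (Tuple.sort a) : ℤ) • z) h1
    simpa [smul_smul, Int.units_coe_mul_self] using h2
  · rw [ht.eq_zero a ha, ht'.eq_zero a ha]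

lemma map {H : Type*} [AddCommGroup H] (u : G →+ H) (ht : IsAlternating t) :
    IsAlternating (fun a => u (t a)) :=
  ⟨fun a α => by rw [ht.perm, map_zsmul], fun a ha => by rw [ht.eq_zero a ha, map_zero]⟩

end IsAlternating

/-- Ordered chains: the free abelian group on the tuples of length `K`. -/
abbrev OrderedChain (V : Type*) (K : ℕ) := FreeAbelianGroup (Fin K → V)

/-! ### Cones, sorting and the natural homotopy on ordered chains -/

namespace OrderedChain

variable {V : Type*} {K : ℕ}

/-- The augmented simplicial differential of ordered chains. -/
def bd (V : Type*) (K : ℕ) : OrderedChain V (K + 1) →+ OrderedChain V K :=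
  FreeAbelianGroup.lift (faceSum FreeAbelianGroup.of)

lemma bd_of (a : Fin (K + 1) → V) : bd V K (.of a) = faceSum FreeAbelianGroup.of a :=
  FreeAbelianGroup.lift_apply_of _ _

/-- The cone operator, putting the vertex `v` in front. -/
def cone (v : V) (K : ℕ) : OrderedChain V K →+ OrderedChain V (K + 1) :=
  FreeAbelianGroup.map fun a => (Fin.cons v a : Fin (K + 1) → V)

lemma cone_of (v : V) (a : Fin K → V) : cone v K (.of a) = .of (Fin.cons v a : Fin (K + 1) → V) :=
  FreeAbelianGroup.map_of_apply _

/-- Face 0 of the cone returns the base and face l + 1 is the cone over face l, with the opposite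
sign. In particular the cone over a cycle is a filling of it. -/
lemma bd_cone (v : V) (x : OrderedChain V (K + 1)) :
    bd V (K + 1) (cone v (K + 1) x) = x - cone v K (bd V K x) := by
  suffices h : (bd V (K + 1)).comp (cone v (K + 1)) =
      AddMonoidHom.id _ - (cone v K).comp (bd V K) from DFunLike.congr_fun h x
  refine FreeAbelianGroup.lift_ext _ _ fun a => ?_
  simp only [AddMonoidHom.comp_apply, AddMonoidHom.sub_apply, AddMonoidHom.id_apply, cone_of,
    bd_of, faceSum, map_sum, map_zsmul]
  rw [Fin.sum_univ_succ, sub_eq_add_neg, ← Finset.sum_neg_distrib]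
  congr 1
  · refine Finset.sum_congr rfl fun l _ => ?_
    have : (Fin.cons v a : Fin (K + 2) → V) ∘ l.succ.succAbove =
        Fin.cons v (a ∘ l.succAbove) := by
      funext i
      refine Fin.cases ?_ (fun i => ?_) i <;> simp
    rw [this, Fin.val_succ, pow_succ, mul_neg, mul_one, neg_smul]

/-- Every nonempty tuple is the cone over its tail from its own first entry. -/
lemma hom_ext_cone {G : Type*} [AddCommGroup G] {f g : OrderedChain V (K + 1) →+ G}
    (h : ∀ v, f.comp (cone v K) = g.comp (cone v K)) : f = g := by
  refine FreeAbelianGroup.lift_ext _ _ fun a => ?_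
  have := DFunLike.congr_fun (h (a 0)) (.of (Fin.tail a))
  simpa only [AddMonoidHom.comp_apply, cone_of, Fin.cons_self_tail] using this

lemma bd_bd (x : OrderedChain V (K + 2)) : bd V K (bd V (K + 1) x) = 0 := by
  induction K with
  | zero =>
    suffices h : (bd V 0).comp (bd V 1) = 0 from DFunLike.congr_fun h x
    refine FreeAbelianGroup.lift_ext _ _ fun a => ?_
    simp [bd_of, faceSum, Subsingleton.elim (_ : Fin 0 → V) default]
  | succ K ih =>
    suffices h : (bd V (K + 1)).comp (bd V (K + 2)) = 0 from DFunLike.congr_fun h x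
    refine hom_ext_cone fun v => AddMonoidHom.ext fun y => ?_
    simp only [AddMonoidHom.comp_apply, bd_cone, map_sub, ih, map_zero, AddMonoidHom.zero_apply]
    abel

section Sorted

variable [LinearOrder V]

open Classical in
/-- The increasing rearrangement of a tuple with its sign (zero for repeated entries). -/
noncomputable def sorted (a : Fin K → V) : OrderedChain V K :=
  if Function.Injective a then (Equiv.Perm.sign (Tuple.sort a) : ℤ) • .of (a ∘ Tuple.sort a) else 0

lemma sorted_of_injective {a : Fin K → V} (ha : Function.Injective a) :
    sorted a = (Equiv.Perm.sign (Tuple.sort a) : ℤ) • .of (a ∘ Tuple.sort a) := if_pos ha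

lemma isAlternating_sorted : IsAlternating (sorted : (Fin K → V) → OrderedChain V K) where
  perm a α := by
    by_cases ha : Function.Injective a
    · have ha' : Function.Injective (a ∘ α) := ha.comp α.injective
      have h1 : (a ∘ α) ∘ Tuple.sort (a ∘ α) = a ∘ Tuple.sort a :=
        Tuple.comp_perm_comp_sort_eq_comp_sort
      -- Injectivity of `a` turns equality of the sorted tuples into equality of the sorting
      -- permutations, hence of their signs.
      have h2 : α * Tuple.sort (a ∘ α) = Tuple.sort a :=
        Equiv.ext fun i => ha (congrFun h1 i)
      rw [sorted_of_injective ha, sorted_of_injective ha', h1, ← h2, Equiv.Perm.sign_mul,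
        Units.val_mul, smul_smul, ← mul_assoc, Int.units_coe_mul_self, one_mul]
    · have ha' : ¬ Function.Injective (a ∘ α) := fun h => ha (by
        have := h.comp α.symm.injective
        rwa [Function.comp_assoc, Equiv.self_comp_symm] at this)
      rw [sorted, sorted, if_neg ha, if_neg ha', smul_zero]
  eq_zero a ha := if_neg ha

lemma sorted_of_strictMono {a : Fin K → V} (ha : StrictMono a) : sorted a = .of a := by
  have : Tuple.sort a = Equiv.refl _ := Tuple.sort_eq_refl_iff_monotone.mpr ha.monotone
  rw [sorted_of_injective ha.injective, this]
  simp

/-- Both sides alternate in `a`, so increasing tuples suffice; there all faces are increasing too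
and sorting is the identity. -/
lemma bd_sorted (a : Fin (K + 1) → V) :
    bd V K (sorted a) = FreeAbelianGroup.lift sorted (bd V K (.of a)) := by
  have h : (fun a : Fin (K + 1) → V => bd V K (sorted a)) = faceSum sorted := by
    refine (isAlternating_sorted.map _).ext isAlternating_sorted.isAlternating_faceSum fun a ha => ?_
    rw [sorted_of_strictMono ha, bd_of, faceSum, faceSum]
    refine Finset.sum_congr rfl fun l _ => ?_
    rw [sorted_of_strictMono (ha.comp (Fin.strictMono_succAbove l))]
  rw [bd_of]
  refine (congrFun h a).trans ?_
  simp [faceSum]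

/-- The natural homotopy between the identity and the sorting map. -/
noncomputable def homotopy (V : Type*) [LinearOrder V] :
    (K : ℕ) → (Fin K → V) → OrderedChain V (K + 1)
  | 0, _ => 0
  -- The chain in parentheses is a cycle by the homotopy identity one degree lower, so the cone
  -- fills it. The apex `a 0` is taken among the entries of `a`, which keeps the homotopy inside the
  -- carrier of `a`.
  | K + 1, a => cone (a 0) (K + 1)
      (.of a - sorted a - FreeAbelianGroup.lift (homotopy V K) (bd V K (.of a)))

lemma bd_homotopy (a : Fin (K + 1) → V) :
    bd V (K + 1) (homotopy V (K + 1) a) + FreeAbelianGroup.lift (homotopy V K) (bd V K (.of a)) =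
      .of a - sorted a := by
  -- The hypothesis says that the chain coned off in `homotopy` has zero boundary, so `bd_cone`
  -- returns this chain unchanged. Both the base case and the induction step then only have to
  -- supply that hypothesis.
  have step : ∀ K : ℕ,
      (∀ a : Fin (K + 1) → V, bd V K (FreeAbelianGroup.lift (homotopy V K) (bd V K (.of a))) =
        bd V K (.of a) - FreeAbelianGroup.lift sorted (bd V K (.of a))) →
      ∀ a : Fin (K + 1) → V, bd V (K + 1) (homotopy V (K + 1) a) +
        FreeAbelianGroup.lift (homotopy V K) (bd V K (.of a)) = .of a - sorted a := by
    intro K h a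
    rw [homotopy, bd_cone, map_sub (bd V K), map_sub (bd V K), h, bd_sorted]
    simp
  induction K with
  | zero =>
    refine step 0 (fun a => ?_) a
    have h1 : FreeAbelianGroup.lift (homotopy V 0) = 0 :=
      FreeAbelianGroup.lift_ext _ _ fun a => by simp [homotopy]
    have h2 : FreeAbelianGroup.lift (sorted (K := 0) (V := V)) = AddMonoidHom.id _ :=
      FreeAbelianGroup.lift_ext _ _ fun a => by
        simp [sorted_of_strictMono (Subsingleton.strictMono a)]
    rw [h1, h2]
    simp
  | succ K ih =>
    refine step (K + 1) (fun a => ?_) a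
    -- The induction hypothesis is extended linearly and applied to the cycle ∂a, where its second
    -- term vanishes.
    have h : (bd V (K + 1)).comp (FreeAbelianGroup.lift (homotopy V (K + 1))) +
        (FreeAbelianGroup.lift (homotopy V K)).comp (bd V K) =
        AddMonoidHom.id _ - FreeAbelianGroup.lift sorted :=
      FreeAbelianGroup.lift_ext _ _ fun a => by simpa using ih a
    have := DFunLike.congr_fun h (bd V (K + 1) (.of a))
    simpa [bd_bd] using this

end Sorted

/-- The chains supported on the vertices of `a`. -/
def carrier {L : ℕ} (a : Fin L → V) (K : ℕ) : AddSubgroup (OrderedChain V K) :=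
  AddSubgroup.closure (Set.range fun τ : Fin K → Fin L => FreeAbelianGroup.of (a ∘ τ))

lemma of_mem_carrier {L : ℕ} (a : Fin L → V) (τ : Fin K → Fin L) :
    FreeAbelianGroup.of (a ∘ τ) ∈ carrier a K :=
  AddSubgroup.subset_closure ⟨τ, rfl⟩

/-- Linear identities on the carrier can be checked on tuples of vertices. -/
lemma eqOn_carrier {L : ℕ} {a : Fin L → V} {G : Type*} [AddCommGroup G]
    {f g : OrderedChain V K →+ G} (h : ∀ θ : Fin K → Fin L, f (.of (a ∘ θ)) = g (.of (a ∘ θ)))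
    {o : OrderedChain V K} (ho : o ∈ carrier a K) : f o = g o := by
  refine AddMonoidHom.eqOn_closure (f := f) (g := g) ?_ ho
  rintro _ ⟨θ, rfl⟩
  exact h θ

lemma carrier_comp_le {J L : ℕ} (a : Fin L → V) (θ : Fin J → Fin L) :
    carrier (a ∘ θ) K ≤ carrier a K := by
  refine (AddSubgroup.closure_le _).mpr ?_
  rintro _ ⟨τ, rfl⟩
  exact of_mem_carrier a (θ ∘ τ)

lemma cone_mem_carrier {L : ℕ} (a : Fin L → V) (i : Fin L) {x : OrderedChain V K}
    (hx : x ∈ carrier a K) : cone (a i) K x ∈ carrier a (K + 1) := by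
  suffices h : carrier a K ≤ (carrier a (K + 1)).comap (cone (a i) K) from h hx
  refine (AddSubgroup.closure_le _).mpr ?_
  rintro _ ⟨τ, rfl⟩
  change cone (a i) K (.of (a ∘ τ)) ∈ carrier a (K + 1)
  rw [cone_of]
  convert of_mem_carrier a (Fin.cons i τ : Fin (K + 1) → Fin L) using 2
  funext j
  refine Fin.cases ?_ (fun j => ?_) j <;> simp

lemma lift_mem_carrier {J L : ℕ} (a : Fin L → V) {f : (Fin K → V) → OrderedChain V J}
    (hf : ∀ τ : Fin K → Fin L, f (a ∘ τ) ∈ carrier a J) {x : OrderedChain V K}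
    (hx : x ∈ carrier a K) : FreeAbelianGroup.lift f x ∈ carrier a J := by
  suffices h : carrier a K ≤ (carrier a J).comap (FreeAbelianGroup.lift f) from h hx
  refine (AddSubgroup.closure_le _).mpr ?_
  rintro _ ⟨τ, rfl⟩
  simpa using hf τ

lemma self_mem_carrier (a : Fin K → V) : FreeAbelianGroup.of a ∈ carrier a K :=
  of_mem_carrier a id

lemma bd_of_mem_carrier (a : Fin (K + 1) → V) : bd V K (.of a) ∈ carrier a K := by
  rw [bd_of]
  exact sum_mem fun l _ => zsmul_mem (of_mem_carrier a _) _

lemma sorted_mem_carrier [LinearOrder V] (a : Fin K → V) : sorted a ∈ carrier a K := by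
  unfold sorted
  split_ifs
  · exact zsmul_mem (of_mem_carrier a _) _
  · exact zero_mem _

/-- Only entries of `a` are ever used as vertices. A labelled system can evaluate just such chains,
so this is what lets the homotopy act on it. -/
lemma homotopy_mem_carrier [LinearOrder V] (a : Fin K → V) :
    homotopy V K a ∈ carrier a (K + 1) := by
  induction K with
  | zero => exact zero_mem _
  | succ K ih =>
    exact cone_mem_carrier a 0 (sub_mem (sub_mem (self_mem_carrier a) (sorted_mem_carrier a))
      (lift_mem_carrier a (fun τ => carrier_comp_le a τ (ih (a ∘ τ))) (bd_of_mem_carrier a)))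

end OrderedChain

end SmaleHomology

namespace SmaleHomology

/-! ### Labelled systems -/

/-- A functor on the nonempty finite sets `Fin (L + 1)` with values in abelian groups, graded by
tuples of labels, in which reindexing maps with the same effect on labels coincide. -/
structure LabelledSystem (V : Type*) [Fintype V] where
  obj : ℕ → Type*
  [grp : ∀ L, AddCommGroup (obj L)]
  pull : ∀ {K L : ℕ}, (Fin (K + 1) → Fin (L + 1)) → obj L →+ obj K
  proj : ∀ {L : ℕ}, (Fin (L + 1) → V) → obj L →+ obj L
  pull_pull : ∀ {J K L : ℕ} (θ : Fin (K + 1) → Fin (L + 1)) (τ : Fin (J + 1) → Fin (K + 1))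
    (x : obj L), pull τ (pull θ x) = pull (θ ∘ τ) x
  pull_id : ∀ {L : ℕ} (x : obj L), pull id x = x
  sum_proj : ∀ {L : ℕ} (x : obj L), ∑ a, proj a x = x
  proj_pull_proj : ∀ {K L : ℕ} (θ : Fin (K + 1) → Fin (L + 1)) (a : Fin (L + 1) → V) (x : obj L),
    proj (a ∘ θ) (pull θ (proj a x)) = pull θ (proj a x)
  proj_pull_proj_of_ne : ∀ {K L : ℕ} (θ : Fin (K + 1) → Fin (L + 1)) (a : Fin (L + 1) → V)
    (b : Fin (K + 1) → V) (x : obj L), b ≠ a ∘ θ → proj b (pull θ (proj a x)) = 0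
  pull_congr : ∀ {K L : ℕ} (θ θ' : Fin (K + 1) → Fin (L + 1)) (a : Fin (L + 1) → V) (x : obj L),
    a ∘ θ = a ∘ θ' → pull θ (proj a x) = pull θ' (proj a x)

namespace LabelledSystem

attribute [instance] LabelledSystem.grp

variable {V : Type*} [Fintype V] (A : LabelledSystem V) {J K L : ℕ}

/-- The differential of a labelled system. -/
def bdy (L : ℕ) : A.obj (L + 1) →+ A.obj L :=
  ∑ l : Fin (L + 2), (-1 : ℤ) ^ (l : ℕ) • A.pull l.succAbove

lemma bdy_apply (x : A.obj (L + 1)) :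
    A.bdy L x = ∑ l : Fin (L + 2), (-1 : ℤ) ^ (l : ℕ) • A.pull l.succAbove x := by
  simp [bdy, AddMonoidHom.finsetSum_apply]

/-- The degenerate chains of a labelled system. -/
def DC (L : ℕ) : AddSubgroup (A.obj L) :=
  AddSubgroup.closure {x | (∃ (i j : Fin (L + 1)) (y : A.obj L),
      i ≠ j ∧ x = A.pull (Function.update id j i) y) ∨
    ∃ (α : Equiv.Perm (Fin (L + 1))) (y : A.obj L),
      x = A.pull (α⁻¹ : Equiv.Perm (Fin (L + 1))) y - (Equiv.Perm.sign α : ℤ) • y}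

lemma comp_update_id {ι T : Type*} [DecidableEq ι] {f : ι → T} {i j : ι} (h : f i = f j) :
    f ∘ Function.update id j i = f := by
  funext k
  by_cases hk : k = j
  · subst hk; simpa using h
  · simp [Function.update_of_ne hk]

/-- A map that identifies i and j factors through the collapse of j onto i. -/
lemma pull_mem_DC (θ : Fin (L + 1) → Fin (K + 1)) (hθ : ¬ Function.Injective θ) (y : A.obj K) :
    A.pull θ y ∈ A.DC L := by
  simp only [Function.Injective] at hθ
  push Not at hθ
  obtain ⟨i, j, hij, hne⟩ := hθ
  rw [← comp_update_id hij, ← A.pull_pull]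
  exact AddSubgroup.subset_closure (Or.inl ⟨i, j, _, hne, rfl⟩)

lemma pull_perm_sub_mem_DC (α : Equiv.Perm (Fin (L + 1))) (y : A.obj L) :
    A.pull α y - (Equiv.Perm.sign α : ℤ) • y ∈ A.DC L :=
  AddSubgroup.subset_closure (Or.inr ⟨α⁻¹, y, by simp⟩)

lemma mem_DC_of_eq_pull_update {i j : Fin (L + 1)} (hij : i ≠ j) (y : A.obj L) {z : A.obj L}
    (hz : z = A.pull (Function.update id j i) y) : z ∈ A.DC L :=
  AddSubgroup.subset_closure (Or.inl ⟨i, j, y, hij, hz⟩)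

lemma sub_mem_DC_of_eq_pull (α : Equiv.Perm (Fin (L + 1))) (y : A.obj L) {z : A.obj L}
    (hz : z = A.pull (α⁻¹ : Equiv.Perm (Fin (L + 1))) y) :
    z - (Equiv.Perm.sign α : ℤ) • y ∈ A.DC L :=
  AddSubgroup.subset_closure (Or.inr ⟨α, y, by rw [hz]⟩)

lemma hom_bdy {G : Type*} [AddCommGroup G] (f : A.obj L →+ G) (x : A.obj (L + 1)) :
    f (A.bdy L x) = ∑ l : Fin (L + 2), (-1 : ℤ) ^ (l : ℕ) • f (A.pull l.succAbove x) := by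
  simp only [bdy_apply, map_sum, map_zsmul]

lemma hom_mem_of_mem_DC {G : Type*} [AddCommGroup G] (f : A.obj L →+ G) (H : AddSubgroup G)
    (h₁ : ∀ (i j : Fin (L + 1)) (y : A.obj L), i ≠ j → f (A.pull (Function.update id j i) y) ∈ H)
    (h₂ : ∀ (α : Equiv.Perm (Fin (L + 1))) (y : A.obj L),
      f (A.pull (α⁻¹ : Equiv.Perm (Fin (L + 1))) y) - (Equiv.Perm.sign α : ℤ) • f y ∈ H)
    {x : A.obj L} (hx : x ∈ A.DC L) : f x ∈ H := by
  suffices h : A.DC L ≤ H.comap f from h hx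
  refine (AddSubgroup.closure_le _).mpr ?_
  rintro _ (⟨i, j, y, hij, rfl⟩ | ⟨α, y, rfl⟩)
  · exact h₁ i j y hij
  · have := h₂ α y
    rwa [← map_zsmul, ← map_sub] at this

open Classical in
/-- Evaluation of an ordered chain supported on the vertices of `a` at an element with label `a`. -/
noncomputable def eval (a : Fin (L + 1) → V) (K : ℕ) :
    OrderedChain V (K + 1) →+ A.obj L →+ A.obj K :=
  FreeAbelianGroup.lift fun b =>
    -- By `pull_congr` the choice of θ does not matter on the component labelled `a`. The value 0
    -- outside the carrier of `a` is a dummy.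
    if h : ∃ θ : Fin (K + 1) → Fin (L + 1), a ∘ θ = b then (A.pull h.choose).comp (A.proj a) else 0

lemma eval_of (a : Fin (L + 1) → V) (θ : Fin (K + 1) → Fin (L + 1)) (x : A.obj L) :
    A.eval a K (.of (a ∘ θ)) x = A.pull θ (A.proj a x) := by
  have h : ∃ τ : Fin (K + 1) → Fin (L + 1), a ∘ τ = a ∘ θ := ⟨θ, rfl⟩
  rw [eval, FreeAbelianGroup.lift_apply_of, dif_pos h]
  exact A.pull_congr _ _ a x h.choose_spec

lemma eval_self (a : Fin (L + 1) → V) (x : A.obj L) : A.eval a L (.of a) x = A.proj a x :=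
  (A.eval_of a id x).trans (A.pull_id _)

lemma eval_eq_zero (a : Fin (L + 1) → V) (o : OrderedChain V (K + 1)) (x : A.obj L)
    (hx : A.proj a x = 0) : A.eval a K o x = 0 := by
  suffices h : (A.eval a K).flip x = 0 from DFunLike.congr_fun h o
  refine FreeAbelianGroup.lift_ext _ _ fun b => ?_
  rw [AddMonoidHom.flip_apply, eval, FreeAbelianGroup.lift_apply_of]
  split_ifs <;> simp [hx]

/-- Naturality of evaluation: the pulled-back component has the single label a ∘ θ, and successive
reindexings compose. -/
lemma eval_pull (a : Fin (L + 1) → V) (θ : Fin (K + 1) → Fin (L + 1)) (x : A.obj L)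
    {o : OrderedChain V (J + 1)} (ho : o ∈ OrderedChain.carrier (a ∘ θ) (J + 1)) :
    A.eval (a ∘ θ) J o (A.pull θ (A.proj a x)) = A.eval a J o x := by
  refine OrderedChain.eqOn_carrier (f := (A.eval (a ∘ θ) J).flip (A.pull θ (A.proj a x)))
    (g := (A.eval a J).flip x) (fun τ => ?_) ho
  rw [AddMonoidHom.flip_apply, AddMonoidHom.flip_apply, eval_of, Function.comp_assoc, eval_of,
    proj_pull_proj, pull_pull]

lemma bdy_eval (a : Fin (L + 1) → V) (x : A.obj L)
    {o : OrderedChain V (K + 2)} (ho : o ∈ OrderedChain.carrier a (K + 2)) :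
    A.bdy K (A.eval a (K + 1) o x) = A.eval a K (OrderedChain.bd V (K + 1) o) x := by
  refine OrderedChain.eqOn_carrier (f := (A.bdy K).comp ((A.eval a (K + 1)).flip x))
    (g := ((A.eval a K).flip x).comp (OrderedChain.bd V (K + 1))) (fun τ => ?_) ho
  simp only [AddMonoidHom.comp_apply, AddMonoidHom.flip_apply, eval_of, OrderedChain.bd_of,
    faceSum, bdy_apply, pull_pull, map_sum, map_zsmul, Function.comp_assoc]

/-- The operation on a labelled system given by a natural family of ordered chains. -/
noncomputable def op (t : (Fin (L + 1) → V) → OrderedChain V (K + 1)) : A.obj L →+ A.obj K :=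
  ∑ a, A.eval a K (t a)

lemma op_apply (t : (Fin (L + 1) → V) → OrderedChain V (K + 1)) (x : A.obj L) :
    A.op t x = ∑ a, A.eval a K (t a) x := by
  simp [op, AddMonoidHom.finsetSum_apply]

lemma op_pull_proj (t : (Fin (K + 1) → V) → OrderedChain V (J + 1))
    (ht : ∀ b, t b ∈ OrderedChain.carrier b (J + 1)) (a : Fin (L + 1) → V)
    (θ : Fin (K + 1) → Fin (L + 1)) (x : A.obj L) :
    A.op t (A.pull θ (A.proj a x)) = A.eval a J (t (a ∘ θ)) x := by
  rw [op_apply, Finset.sum_eq_single (a ∘ θ), A.eval_pull a θ x (ht _)]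
  · exact fun b _ hb => A.eval_eq_zero _ _ _ (A.proj_pull_proj_of_ne θ a b x hb)
  · simp

lemma op_pull (t : (Fin (K + 1) → V) → OrderedChain V (J + 1))
    (ht : ∀ b, t b ∈ OrderedChain.carrier b (J + 1))
    (θ : Fin (K + 1) → Fin (L + 1)) (x : A.obj L) :
    A.op t (A.pull θ x) = ∑ a : Fin (L + 1) → V, A.eval a J (t (a ∘ θ)) x := by
  conv_lhs => rw [← A.sum_proj x, map_sum, map_sum]
  exact Finset.sum_congr rfl fun a _ => A.op_pull_proj t ht a θ x

/-- Together with `bdy_op`, this translates identities between carried families of ordered chains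
into identities between operators on the labelled system. -/
lemma op_bdy (t : (Fin (L + 1) → V) → OrderedChain V (J + 1))
    (ht : ∀ b, t b ∈ OrderedChain.carrier b (J + 1)) (x : A.obj (L + 1)) :
    A.op t (A.bdy L x) = ∑ a : Fin (L + 2) → V,
      A.eval a J (FreeAbelianGroup.lift t (OrderedChain.bd V (L + 1) (.of a))) x := by
  simp only [bdy_apply, map_sum, map_zsmul, A.op_pull t ht, OrderedChain.bd_of, faceSum,
    FreeAbelianGroup.lift_apply_of, AddMonoidHom.finsetSum_apply, AddMonoidHom.zsmul_apply,
    Finset.smul_sum]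
  exact Finset.sum_comm

lemma bdy_op (t : (Fin (L + 1) → V) → OrderedChain V (K + 2))
    (ht : ∀ b, t b ∈ OrderedChain.carrier b (K + 2)) (x : A.obj L) :
    A.bdy K (A.op t x) = ∑ a, A.eval a K (OrderedChain.bd V (K + 1) (t a)) x := by
  rw [op_apply, map_sum]
  exact Finset.sum_congr rfl fun a _ => A.bdy_eval a x (ht a)

section Sorted

variable [LinearOrder V]

lemma bdy_op_sorted (x : A.obj (L + 1)) :
    A.bdy L (A.op OrderedChain.sorted x) = A.op OrderedChain.sorted (A.bdy L x) := by
  rw [bdy_op _ _ OrderedChain.sorted_mem_carrier, op_bdy _ _ OrderedChain.sorted_mem_carrier]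
  simp only [OrderedChain.bd_sorted]

lemma bdy_op_homotopy (x : A.obj (L + 1)) :
    A.bdy (L + 1) (A.op (OrderedChain.homotopy V (L + 2)) x) +
      A.op (OrderedChain.homotopy V (L + 1)) (A.bdy L x) = x - A.op OrderedChain.sorted x := by
  rw [bdy_op _ _ OrderedChain.homotopy_mem_carrier, op_bdy _ _ OrderedChain.homotopy_mem_carrier,
    op_apply, ← Finset.sum_add_distrib]
  conv_rhs => rw [← A.sum_proj x, ← Finset.sum_sub_distrib]
  refine Finset.sum_congr rfl fun a _ => ?_
  rw [A.sum_proj, ← AddMonoidHom.add_apply, ← map_add, OrderedChain.bd_homotopy, map_sub,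
    AddMonoidHom.sub_apply, eval_self]

/-- On a collapsed element sorting sees only tuples with a repeated entry, and a permutation changes
the sorted tuple by its sign; so both kinds of generators die. -/
lemma op_sorted_eq_zero {x : A.obj L} (hx : x ∈ A.DC L) : A.op OrderedChain.sorted x = 0 := by
  suffices h : A.DC L ≤ (A.op OrderedChain.sorted).ker from h hx
  refine (AddSubgroup.closure_le _).mpr ?_
  rintro _ (⟨i, j, y, hij, rfl⟩ | ⟨α, y, rfl⟩)
  · change A.op OrderedChain.sorted _ = 0
    rw [op_pull _ _ OrderedChain.sorted_mem_carrier]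
    refine Finset.sum_eq_zero fun a _ => ?_
    rw [OrderedChain.isAlternating_sorted.eq_zero _ fun h => hij (h.of_comp ?_)]
    · simp
    · simp [Function.update_of_ne hij]
  · change A.op OrderedChain.sorted _ = 0
    rw [map_sub, map_zsmul, op_pull _ _ OrderedChain.sorted_mem_carrier, op_apply, Finset.smul_sum,
      sub_eq_zero]
    refine Finset.sum_congr rfl fun a _ => ?_
    rw [OrderedChain.isAlternating_sorted.perm]
    simp

/-- Argue on each label. On an injective label sorting is a signed permutation, which is the
identity modulo degenerate chains. On a label with a repetition sorting gives zero, and the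
component itself is degenerate because there the identity reindexing agrees with a collapse. -/
lemma sub_op_sorted_mem (x : A.obj L) : x - A.op OrderedChain.sorted x ∈ A.DC L := by
  rw [op_apply]
  nth_rewrite 1 [← A.sum_proj x]
  rw [← Finset.sum_sub_distrib]
  refine sum_mem fun a _ => ?_
  by_cases ha : Function.Injective a
  · have h := zsmul_mem (A.pull_perm_sub_mem_DC (Tuple.sort a) (A.proj a x))
      (-(Equiv.Perm.sign (Tuple.sort a) : ℤ))
    rw [OrderedChain.sorted_of_injective ha, map_zsmul, AddMonoidHom.zsmul_apply, eval_of]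
    convert h using 1
    rw [smul_sub, neg_smul, neg_smul, smul_smul, Int.units_coe_mul_self, one_smul]
    abel
  · rw [OrderedChain.isAlternating_sorted.eq_zero _ ha, map_zero, AddMonoidHom.zero_apply, sub_zero]
    simp only [Function.Injective] at ha
    push Not at ha
    obtain ⟨i, j, hij, hne⟩ := ha
    rw [← A.pull_id (A.proj a x), A.pull_congr id (Function.update id j i) a x
      (comp_update_id hij).symm]
    exact AddSubgroup.subset_closure (Or.inl ⟨i, j, _, hne, rfl⟩)

/-- The degenerate chains of a labelled system are acyclic in positive degrees. -/
theorem exists_bdy_eq {x : A.obj (L + 1)} (hx : x ∈ A.DC (L + 1)) (h : A.bdy L x = 0) :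
    ∃ y ∈ A.DC (L + 2), A.bdy (L + 1) y = x := by
  have h1 := A.bdy_op_homotopy x
  rw [h, map_zero, add_zero, A.op_sorted_eq_zero hx, sub_zero] at h1
  -- The homotopy already fills `x`, but by a chain that need not be degenerate. Subtracting its
  -- sorted part makes it so, and this part is a cycle since sorting kills `x`.
  refine ⟨_, A.sub_op_sorted_mem (A.op (OrderedChain.homotopy V (L + 2)) x), ?_⟩
  rw [map_sub, bdy_op_sorted, h1, A.op_sorted_eq_zero hx, sub_zero]

end Sorted

end LabelledSystem

end SmaleHomology

namespace SmaleHomology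

open Filter Topology

/-! ### Leafwise continuity -/

section Leafwise

variable {X W U : Type*} [MetricSpace X] [MetricSpace W] [MetricSpace U]

lemma localSet_mono {φ : X → X} {x : X} {δ δ' : ℝ} (h : δ ≤ δ') :
    localSet φ x δ ⊆ localSet φ x δ' := fun _ hy => ⟨hy.1, fun n => (hy.2 n).trans_le h⟩

lemma dist_lt_of_mem_localSet {φ : X → X} {x y : X} {δ : ℝ} (h : y ∈ localSet φ x δ) :
    dist x y < δ := h.2 0

/-- Continuity for the leaf topologies. -/
def LeafContinuous (φ : X → X) (ψ : W → W) {E : Set X} {F : Set W} (h : E → F) : Prop :=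
  ∀ x : E, ∀ ε > 0, ∃ δ > 0, ∀ x' : E, (x' : X) ∈ localSet φ x δ →
    (h x' : W) ∈ localSet ψ (h x) ε

/-- Local constancy for the leaf topology. -/
def LeafConstant (φ : X → X) {E : Set X} {T : Type*} (ℓ : E → T) : Prop :=
  ∀ x : E, ∃ δ > 0, ∀ x' : E, (x' : X) ∈ localSet φ x δ → ℓ x' = ℓ x

lemma LeafContinuous.comp {φ : X → X} {ψ : W → W} {χ : U → U} {E : Set X} {F : Set W} {G : Set U}
    {g : F → G} {h : E → F} (hg : LeafContinuous ψ χ g) (hh : LeafContinuous φ ψ h) :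
    LeafContinuous φ χ (g ∘ h) := by
  intro x ε hε
  obtain ⟨δ, hδ, h1⟩ := hg (h x) ε hε
  obtain ⟨δ', hδ', h2⟩ := hh x δ hδ
  exact ⟨δ', hδ', fun x' hx' => h1 _ (h2 _ hx')⟩

lemma LeafContinuous.id {φ : X → X} {E : Set X} : LeafContinuous φ φ (id : E → E) :=
  fun _ ε hε => ⟨ε, hε, fun _ h => h⟩

lemma LeafConstant.comp {φ : X → X} {ψ : W → W} {E : Set X} {F : Set W} {T : Type*}
    {ℓ : F → T} {h : E → F} (hℓ : LeafConstant ψ ℓ) (hh : LeafContinuous φ ψ h) :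
    LeafConstant φ (ℓ ∘ h) := by
  intro x
  obtain ⟨δ, hδ, h1⟩ := hℓ (h x)
  obtain ⟨δ', hδ', h2⟩ := hh x δ hδ
  exact ⟨δ', hδ', fun x' hx' => h1 _ (h2 _ hx')⟩

lemma LeafConstant.prodMk {φ : X → X} {E : Set X} {T T' : Type*} {ℓ : E → T} {ℓ' : E → T'}
    (h : LeafConstant φ ℓ) (h' : LeafConstant φ ℓ') : LeafConstant φ fun x => (ℓ x, ℓ' x) := by
  intro x
  obtain ⟨δ, hδ, h1⟩ := h x
  obtain ⟨δ', hδ', h2⟩ := h' x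
  exact ⟨min δ δ', lt_min hδ hδ', fun x' hx' => Prod.ext
    (h1 _ (localSet_mono (min_le_left _ _) hx')) (h2 _ (localSet_mono (min_le_right _ _) hx'))⟩

lemma LeafConstant.pi {φ : X → X} {E : Set X} {ι T : Type*} [Finite ι] {ℓ : ι → E → T}
    (h : ∀ i, LeafConstant φ (ℓ i)) : LeafConstant φ fun x i => ℓ i x := by
  intro x
  choose δ hδ h1 using fun i => h i x
  have h2 : ∀ᶠ r in 𝓝[>] (0 : ℝ), ∀ i, r < δ i :=
    eventually_all.mpr fun i => nhdsWithin_le_nhds (Iio_mem_nhds (hδ i))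
  obtain ⟨r, hr, hr0⟩ := (h2.and self_mem_nhdsWithin).exists
  exact ⟨r, hr0, fun x' hx' => funext fun i => h1 i _ (localSet_mono (hr i).le hx')⟩

variable {S : SmaleSpace X} {T : SmaleSpace W} {f : X → W}

lemma IsMap.exists_localSet [CompactSpace X] (hf : IsMap S T f) {ε : ℝ} (hε : 0 < ε) :
    ∃ δ > 0, ∀ x y, y ∈ localSet S.φ x δ → f y ∈ localSet T.φ (f x) ε := by
  have hu := CompactSpace.uniformContinuous_of_continuous hf.continuous
  rw [Metric.uniformContinuous_iff] at hu
  obtain ⟨δ, hδ, hd⟩ := hu ε hε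
  refine ⟨δ, hδ, fun x y hy => ⟨hf.asymptotic hy.1, fun n => ?_⟩⟩
  rw [← hf.iterate, ← hf.iterate]
  exact hd (hy.2 n)

/-- An `s`-bijective map is injective on every subset of a leaf. -/
lemma IsSBijective.injOn (hf : IsSBijective S T f) {E : Set X} (hE : ∃ e, E ⊆ S.stableSet e) :
    Set.InjOn f E :=
  hE.elim fun e he => (hf.bijOn e).injOn.mono he

lemma asymptotic_of_subset {E : Set X} (hE : ∃ e, E ⊆ S.stableSet e) {x y : X} (hx : x ∈ E)
    (hy : y ∈ E) : Asymptotic S.φ x y :=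
  hE.elim fun _ he => (he hx : Asymptotic S.φ _ x).symm.trans (he hy)

/-- The bijection from a subset of a leaf to its image under an `s`-bijective map. -/
noncomputable def IsSBijective.imageEquiv (hf : IsSBijective S T f) {E : Set X}
    (hE : ∃ e, E ⊆ S.stableSet e) : E ≃ f '' E :=
  Equiv.Set.imageOfInjOn f E (hf.injOn hE)

lemma IsSBijective.leafContinuous_imageEquiv [CompactSpace X] (hf : IsSBijective S T f)
    {E : Set X} (hE : ∃ e, E ⊆ S.stableSet e) : LeafContinuous S.φ T.φ (hf.imageEquiv hE) := by
  intro x ε hε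
  obtain ⟨δ, hδ, h⟩ := hf.toIsMap.exists_localSet hε
  exact ⟨δ, hδ, fun x' hx' => h _ _ hx'⟩

lemma IsSBijective.leafContinuous_imageEquiv_symm [CompactSpace X] (hf : IsSBijective S T f)
    {E : Set X} (hE : ∃ e, E ⊆ S.stableSet e) :
    LeafContinuous T.φ S.φ (hf.imageEquiv hE).symm := by
  intro y ε hε
  obtain ⟨δ, hδ, h⟩ := hf.exists_lift_close hε
  refine ⟨δ, hδ, fun y' hy' => ?_⟩
  obtain ⟨x, rfl⟩ := (hf.imageEquiv hE).surjective y
  obtain ⟨x', rfl⟩ := (hf.imageEquiv hE).surjective y'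
  rw [Equiv.symm_apply_apply, Equiv.symm_apply_apply]
  exact h _ _ (asymptotic_of_subset hE x.2 x'.2) hy'

/-- There is a leafwise homeomorphism between `E` and `F` that moves points along `r`. -/
def LeafHomeo (φ : X → X) (E F : Set X) (r : X → X → Prop) : Prop :=
  ∃ e : E ≃ F, LeafContinuous φ φ e ∧ LeafContinuous φ φ e.symm ∧ ∀ x : E, r x (e x)

namespace LeafHomeo

variable {φ : X → X} {E F G : Set X} {r r' : X → X → Prop}

lemma refl (h : ∀ x, r x x) : LeafHomeo φ E E r :=
  ⟨Equiv.refl E, .id, .id, fun x => h x⟩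

lemma symm (h : LeafHomeo φ E F r) (hr : ∀ x y, r x y → r' y x) : LeafHomeo φ F E r' := by
  obtain ⟨e, h1, h2, h3⟩ := h
  refine ⟨e.symm, h2, h1, fun y => ?_⟩
  have := hr _ _ (h3 (e.symm y))
  rwa [Equiv.apply_symm_apply] at this

lemma trans {r'' : X → X → Prop} (h : LeafHomeo φ E F r) (h' : LeafHomeo φ F G r')
    (hr : ∀ x y z, r x y → r' y z → r'' x z) : LeafHomeo φ E G r'' := by
  obtain ⟨e, h1, h2, h3⟩ := h
  obtain ⟨e', h1', h2', h3'⟩ := h'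
  exact ⟨e.trans e', h1'.comp h1, h2.comp h2', fun x => hr _ _ _ (h3 x) (h3' _)⟩

lemma mono (h : LeafHomeo φ E F r) (hr : ∀ x y, r x y → r' x y) : LeafHomeo φ E F r' := by
  obtain ⟨e, h1, h2, h3⟩ := h
  exact ⟨e, h1, h2, fun x => hr _ _ (h3 x)⟩

/-- An `s`-bijective map is a leafwise homeomorphism onto the image of any subset of a leaf, so `h`
can be conjugated. Two different maps are allowed in order to compare the images of one set under
two reindexings. -/
lemma map [CompactSpace X] {E F : Set X} {f' : X → W} {r' : W → W → Prop}
    (hE : ∃ e, E ⊆ S.stableSet e) (hF : ∃ e, F ⊆ S.stableSet e) (hf : IsSBijective S T f)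
    (hf' : IsSBijective S T f') (h : LeafHomeo S.φ E F r)
    (hr : ∀ x ∈ E, ∀ y ∈ F, r x y → r' (f x) (f' y)) : LeafHomeo T.φ (f '' E) (f' '' F) r' := by
  obtain ⟨e, h1, h2, h3⟩ := h
  refine ⟨((hf.imageEquiv hE).symm.trans e).trans (hf'.imageEquiv hF),
    (hf'.leafContinuous_imageEquiv hF).comp (h1.comp (hf.leafContinuous_imageEquiv_symm hE)),
    (hf.leafContinuous_imageEquiv hE).comp (h2.comp (hf'.leafContinuous_imageEquiv_symm hF)),
    fun y => ?_⟩
  obtain ⟨x, rfl⟩ := (hf.imageEquiv hE).surjective y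
  simp only [Equiv.trans_apply, Equiv.symm_apply_apply]
  exact hr _ x.2 _ (e x).2 (h3 x)

lemma inter_preimage {T : Type*} (h : LeafHomeo φ E F r) (ℓ : X → T)
    (hr : ∀ x y, r x y → ℓ x = ℓ y) (s : Set T) :
    LeafHomeo φ (E ∩ ℓ ⁻¹' s) (F ∩ ℓ ⁻¹' s) r := by
  obtain ⟨e, h1, h2, h3⟩ := h
  have hm : ∀ x : E, ℓ (e x) = ℓ x := fun x => (hr _ _ (h3 x)).symm
  have hm' : ∀ y : F, ℓ (e.symm y) = ℓ y := fun y => by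
    rw [← hm, Equiv.apply_symm_apply]
  let e' : ↥(E ∩ ℓ ⁻¹' s) ≃ ↥(F ∩ ℓ ⁻¹' s) :=
    { toFun := fun x => ⟨e ⟨x, x.2.1⟩, (e _).2, by
        rw [Set.mem_preimage, hm]; exact x.2.2⟩
      invFun := fun y => ⟨e.symm ⟨y, y.2.1⟩, (e.symm _).2, by
        rw [Set.mem_preimage, hm']; exact y.2.2⟩
      left_inv := fun x => by simp
      right_inv := fun y => by simp }
  refine ⟨e', fun x ε hε => ?_, fun y ε hε => ?_, fun x => h3 ⟨x, x.2.1⟩⟩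
  · obtain ⟨δ, hδ, h⟩ := h1 ⟨x, x.2.1⟩ ε hε
    exact ⟨δ, hδ, fun x' hx' => h ⟨x', x'.2.1⟩ hx'⟩
  · obtain ⟨δ, hδ, h⟩ := h2 ⟨y, y.2.1⟩ ε hε
    exact ⟨δ, hδ, fun y' hy' => h ⟨y', y'.2.1⟩ hy'⟩

end LeafHomeo

/-! ### Cutting compact open sets -/

namespace CompactOpen

lemma isOpen_image_preimage {E : Set X} (hE : IsOpen[leafTopology S.φ] E) {T : Type*}
    {ℓ : E → T} (hℓ : LeafConstant S.φ ℓ) (s : Set T) :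
    IsOpen[leafTopology S.φ] (Subtype.val '' (ℓ ⁻¹' s)) := by
  rintro _ ⟨x, hx, rfl⟩
  obtain ⟨δ, hδ, h⟩ := hE x x.2
  obtain ⟨δ', hδ', h'⟩ := hℓ x
  refine ⟨min δ δ', lt_min hδ hδ', fun y hy => ?_⟩
  have hyE : y ∈ E := h (localSet_mono (min_le_left _ _) hy)
  refine ⟨⟨y, hyE⟩, ?_, rfl⟩
  rw [Set.mem_preimage, h' ⟨y, hyE⟩ (localSet_mono (min_le_right _ _) hy)]
  exact hx

/-- The part of `E` on which the leafwise locally constant function `ℓ` takes values in `s`. -/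
def cut (E : CompactOpen S) {T : Type*} (ℓ : E.1 → T) (hℓ : LeafConstant S.φ ℓ) (s : Set T) :
    CompactOpen S :=
  ⟨Subtype.val '' (ℓ ⁻¹' s), by
    obtain ⟨e, he⟩ := E.2.1
    refine ⟨⟨e, (Subtype.coe_image_subset _ _).trans he⟩, ?_,
      isOpen_image_preimage E.2.2.2 hℓ s⟩
    -- Compactness: the piece is the compact set minus the open complementary piece.
    have h1 : Subtype.val '' (ℓ ⁻¹' s) = E.1 \ Subtype.val '' (ℓ ⁻¹' sᶜ) := by
      ext x
      constructor
      · rintro ⟨y, hy, rfl⟩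
        exact ⟨y.2, fun ⟨z, hz, hzy⟩ => hz (Subtype.ext hzy ▸ hy)⟩
      · rintro ⟨hx, hn⟩
        refine ⟨⟨x, hx⟩, ?_, rfl⟩
        by_contra hs
        exact hn ⟨⟨x, hx⟩, hs, rfl⟩
    rw [h1]
    exact @IsCompact.diff _ (leafTopology S.φ) _ _ E.2.2.1
      (isOpen_image_preimage E.2.2.2 hℓ sᶜ)⟩

lemma cut_val (E : CompactOpen S) {T : Type*} (ℓ : X → T)
    (hℓ : LeafConstant S.φ fun x : E.1 => ℓ x) (s : Set T) :
    (E.cut (fun x : E.1 => ℓ x) hℓ s).1 = E.1 ∩ ℓ ⁻¹' s := by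
  ext x
  constructor
  · rintro ⟨y, hy, rfl⟩
    exact ⟨y.2, hy⟩
  · rintro ⟨hx, hs⟩
    exact ⟨⟨x, hx⟩, hs, rfl⟩

/-- Functions on compact open sets that are additive on disjoint unions. -/
def IsAdditive {G : Type*} [AddCommGroup G] (μ : CompactOpen S → G) : Prop :=
  ∀ E F H : CompactOpen S, Disjoint E.1 F.1 → H.1 = E.1 ∪ F.1 → μ H = μ E + μ F

lemma IsAdditive.eq_zero {G : Type*} [AddCommGroup G] {μ : CompactOpen S → G} (hμ : IsAdditive μ)
    {E : CompactOpen S} (hE : E.1 = ∅) : μ E = 0 := by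
  have := hμ E E E (by simp [hE]) (by simp)
  simpa using this

lemma IsAdditive.sum_cut {G : Type*} [AddCommGroup G] {μ : CompactOpen S → G}
    (hμ : IsAdditive μ) (E : CompactOpen S) {T : Type*} [Fintype T] (ℓ : E.1 → T)
    (hℓ : LeafConstant S.φ ℓ) : ∑ t, μ (E.cut ℓ hℓ {t}) = μ E := by
  classical
  have h : ∀ s : Finset T, ∑ t ∈ s, μ (E.cut ℓ hℓ {t}) = μ (E.cut ℓ hℓ s) := by
    intro s
    induction s using Finset.induction_on with
    | empty => exact (hμ.eq_zero (by simp [cut])).symm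
    | insert t s ht ih =>
      rw [Finset.sum_insert ht, ih, eq_comm]
      refine hμ _ _ _ ?_ ?_
      · refine Set.disjoint_image_image fun x hx y hy hxy => ?_
        obtain rfl := Subtype.ext hxy
        have hx' : ℓ x = t := hx
        have hy' : ℓ x ∈ s := hy
        exact ht (hx' ▸ hy')
      · simp only [cut, Finset.coe_insert, Set.insert_eq, Set.preimage_union, Set.image_union]
  rw [h Finset.univ]
  congr 1
  exact Subtype.ext (by simp [cut])

lemma isAdditive_dimClass : IsAdditive (dimClass : CompactOpen S → DimGroup S) := by
  intro E F H hd hH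
  rw [← sub_eq_zero, ← sub_sub]
  exact (QuotientAddGroup.eq_zero_iff _).mpr (AddSubgroup.subset_closure ⟨E, F, H, hd, hH, rfl⟩)

end CompactOpen

/-! ### Holonomy along itineraries -/

namespace SmaleSpace

variable (S)

lemma asymptotic_iff_tail (n : ℕ) (x y : X) :
    Asymptotic S.φ (S.φ^[n] x) (S.φ^[n] y) ↔ Asymptotic S.φ x y := by
  refine ⟨Asymptotic.tail n, fun h => ?_⟩
  simp only [Asymptotic, ← Function.iterate_add_apply]
  exact (tendsto_add_atTop_iff_nat n).mpr h

lemma isMap_iterate (n : ℕ) : IsMap S S S.φ^[n] :=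
  ⟨S.φ.continuous.iterate n, fun x => (Function.Commute.iterate_self S.φ n).eq x⟩

lemma isMap_symm_iterate (n : ℕ) : IsMap S S S.φ.symm^[n] :=
  ⟨S.φ.symm.continuous.iterate n, fun x => by
    have h : Function.Commute S.φ.symm S.φ := fun x => by simp
    exact (h.iterate_left n).eq x⟩

lemma isSBijective_φ : IsSBijective S S S.φ where
  toIsMap := S.isMap_iterate 1
  bijOn x := by
    refine ⟨fun y hy => (S.asymptotic_iff_tail 1 x y).mpr hy, S.φ.injective.injOn, fun y hy => ?_⟩
    refine ⟨S.φ.symm y, (S.asymptotic_iff_tail 1 x _).mp ?_, by simp⟩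
    change Asymptotic S.φ (S.φ x) (S.φ (S.φ.symm y))
    rw [S.φ.apply_symm_apply]
    exact hy

lemma isSBijective_symm : IsSBijective S S S.φ.symm where
  toIsMap := S.isMap_symm_iterate 1
  bijOn x := by
    refine ⟨fun y hy => (S.asymptotic_iff_tail 1 _ _).mp ?_, S.φ.symm.injective.injOn,
      fun y hy => ⟨S.φ y, ?_, by simp⟩⟩
    · change Asymptotic S.φ (S.φ (S.φ.symm x)) (S.φ (S.φ.symm y))
      rw [S.φ.apply_symm_apply, S.φ.apply_symm_apply]
      exact hy
    · have h : Asymptotic S.φ (S.φ (S.φ.symm x)) (S.φ y) := (S.asymptotic_iff_tail 1 _ _).mpr hy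
      rwa [S.φ.apply_symm_apply] at h

lemma symm_iterate_iterate (n : ℕ) (x : X) : S.φ^[n] (S.φ.symm^[n] x) = x :=
  (Function.RightInverse.iterate S.φ.apply_symm_apply n) x

/-- On local stable sets the bracket is the second projection. -/
lemma bracket_eq_of_asymptotic [CompactSpace X] {a b : X}
    (h : ∀ n : ℕ, dist (S.φ^[n] a) (S.φ^[n] b) ≤ S.eps) (hab : Asymptotic S.φ a b) :
    S.bracket a b = b := by
  obtain ⟨δ, hδ, -, hfw⟩ := S.exists_forward
  -- From time `N` on the orbits stay within the scale at which the bracket identity is known; it is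
  -- then pulled back, since the bracket commutes with the first `N` iterates.
  obtain ⟨N, hN⟩ := eventually_atTop.mp ((tendsto_order.mp hab).2 δ hδ)
  have h1 := hfw (S.φ^[N] a) (S.φ^[N] b) fun n => by
    rw [← Function.iterate_add_apply, ← Function.iterate_add_apply]
    exact (hN (n + N) (by omega)).le
  rw [← S.iterate_bracket h] at h1
  exact S.φ.injective.iterate N h1

/-- Compact subsets of a leaf contract uniformly. -/
lemma exists_uniform_contract {S : SmaleSpace X} (E : CompactOpen S) {δ : ℝ} (hδ : 0 < δ) :
    ∃ J : ℕ, ∀ x ∈ E.1, ∀ x' ∈ E.1, ∀ j ≥ J, dist (S.φ^[j] x) (S.φ^[j] x') ≤ δ := by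
  obtain ⟨e, he⟩ := E.2.1
  -- The margin ρ makes these sets open in the leaf topology. They increase with `J` and cover the
  -- leaf, so one of them contains the compact set.
  let U : ℕ → Set X := fun J => {y | ∃ ρ > 0, ∀ j ≥ J, dist (S.φ^[j] e) (S.φ^[j] y) + ρ ≤ δ / 2}
  have hU : ∀ J, IsOpen[leafTopology S.φ] (U J) := by
    rintro J y ⟨ρ, hρ, hy⟩
    refine ⟨ρ / 2, half_pos hρ, fun z hz => ⟨ρ / 2, half_pos hρ, fun j hj => ?_⟩⟩
    have h1 := hz.2 j
    have h2 := hy j hj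
    have h3 := dist_triangle (S.φ^[j] e) (S.φ^[j] y) (S.φ^[j] z)
    linarith
  have hmono : Monotone U := fun J J' h y ⟨ρ, hρ, hy⟩ =>
    ⟨ρ, hρ, fun j hj => hy j (h.trans hj)⟩
  obtain ⟨J, hJ⟩ := @IsCompact.elim_directed_cover X (leafTopology S.φ) E.1 ℕ _ E.2.2.1 U hU
    (fun y hy => by
      obtain ⟨N, hN⟩ := eventually_atTop.mp
        ((tendsto_order.mp (he hy : Asymptotic S.φ e y)).2 (δ / 4) (by positivity))
      refine Set.mem_iUnion.mpr ⟨N, δ / 4, by positivity, fun j hj => ?_⟩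
      have := hN j hj
      linarith) hmono.directed_le
  refine ⟨J, fun x hx x' hx' j hj => ?_⟩
  obtain ⟨ρ, hρ, h1⟩ := hJ hx
  obtain ⟨ρ', hρ', h2⟩ := hJ hx'
  have h1 := h1 j hj
  have h2 := h2 j hj
  have h3 := dist_triangle_left (S.φ^[j] x) (S.φ^[j] x') (S.φ^[j] e)
  linarith

/-- Small sets in local stable leaves that are related by a small unstable holonomy are
equivalent. -/
lemma exists_dimRel [CompactSpace X] : ∃ δ > 0, ∀ (E F : CompactOpen S) (e : E.1 ≃ F.1),
    (∀ x x' : E.1, ∀ j : ℕ, dist (S.φ^[j] x) (S.φ^[j] x') ≤ δ) →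
    (∀ y y' : F.1, ∀ j : ℕ, dist (S.φ^[j] y) (S.φ^[j] y') ≤ δ) →
    (∀ x : E.1, ∀ k : ℕ, dist (S.φ.symm^[k] x) (S.φ.symm^[k] (e x)) ≤ δ) → DimRel S E F := by
  obtain ⟨δ, hδ, -, hfw⟩ := S.reverse.exists_forward
  have h0 := S.eps_pos
  -- With ε/4 for each of the two legs, points of `E` and `F` are within ε/2, and all brackets below
  -- are defined.
  refine ⟨min δ (S.eps / 4), lt_min hδ (by positivity), fun E F e hE hF hEF => ?_⟩
  have hle : min δ (S.eps / 4) ≤ S.eps / 4 := min_le_right _ _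
  have hu : ∀ x : E.1, S.bracket (e x) x = e x := fun x =>
    hfw x (e x) fun k => (hEF x k).trans (min_le_left _ _)
  have hs : ∀ x x' : E.1, S.bracket x x' = x' := fun x x' =>
    S.bracket_eq_of_asymptotic (fun n => (hE x x' n).trans (by linarith))
      (asymptotic_of_subset E.2.1 x.2 x'.2)
  have hs' : ∀ y y' : F.1, S.bracket y y' = y' := fun y y' =>
    S.bracket_eq_of_asymptotic (fun n => (hF y y' n).trans (by linarith))
      (asymptotic_of_subset F.2.1 y.2 y'.2)
  have hxe : ∀ x : E.1, dist (x : X) (e x) ≤ S.eps / 4 := fun x => (hEF x 0).trans hle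
  have hd : ∀ x x' : E.1, dist (x : X) (e x') ≤ S.eps / 2 := fun x x' => by
    have h1 := dist_triangle (x : X) x' (e x')
    have h2 := (hE x x' 0).trans hle
    have h3 := hxe x'
    simp only [Function.iterate_zero, id_eq] at h2
    linarith
  -- The bracket with any point of `F` realises the same holonomy: [e x', x] = [[e x', e x], x] = [e
  -- x, x] = e x. The next claim is the analogue for the inverse.
  have hb : ∀ x x' : E.1, S.bracket (e x') x = e x := fun x x' => by
    have h1 := S.bracket_left (e x') (e x) x
      (((hF (e x') (e x) 0).trans hle).trans (by linarith))
      (by rw [hs', dist_comm]; linarith [hxe x])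
      (by rw [dist_comm]; linarith [hd x x'])
    rw [← h1, hs', hu]
  have hb' : ∀ x x' : E.1, S.bracket x (e x') = x' := fun x x' => by
    have h1 := S.bracket_right x (e x') x' (by rw [dist_comm]; linarith [hxe x'])
      (by rw [hu]; linarith [hd x x']) (((hE x x' 0).trans hle).trans (by linarith))
    rw [hu, hs] at h1
    exact h1
  rcases isEmpty_or_nonempty E.1 with hE0 | ⟨⟨x₀⟩⟩
  · have hF0 : IsEmpty F.1 := e.symm.isEmpty
    have : E = F := Subtype.ext (by
      rw [Set.isEmpty_coe_sort.mp hE0, Set.isEmpty_coe_sort.mp hF0])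
    rw [this]
    exact DimRel.refl F
  · refine DimRel.bracket E F ⟨x₀, fun x hx => ⟨asymptotic_of_subset E.2.1 x₀.2 hx, fun n => ?_⟩⟩
      ⟨e x₀, fun y hy => ⟨asymptotic_of_subset F.2.1 (e x₀).2 hy, fun n => ?_⟩⟩
      (fun x hx y hy => ?_) ?_ ?_
    · exact ((hE x₀ ⟨x, hx⟩ n).trans hle).trans_lt (by linarith)
    · exact ((hF (e x₀) ⟨y, hy⟩ n).trans hle).trans_lt (by linarith)
    · have := hd ⟨x, hx⟩ (e.symm ⟨y, hy⟩)
      rw [Equiv.apply_symm_apply] at this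
      exact this.trans (by linarith)
    · ext z
      constructor
      · rintro ⟨x, hx, y, hy, rfl⟩
        have := hb' ⟨x, hx⟩ (e.symm ⟨y, hy⟩)
        rw [Equiv.apply_symm_apply] at this
        rw [this]
        exact Subtype.coe_prop _
      · intro hz
        exact ⟨x₀, x₀.2, e ⟨z, hz⟩, (e _).2, hb' x₀ ⟨z, hz⟩⟩
    · ext z
      constructor
      · rintro ⟨y, hy, x, hx, rfl⟩
        have := hb ⟨x, hx⟩ (e.symm ⟨y, hy⟩)
        rw [Equiv.apply_symm_apply] at this
        rw [this]
        exact Subtype.coe_prop _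
      · intro hz
        refine ⟨e x₀, (e x₀).2, e.symm ⟨z, hz⟩, Subtype.coe_prop _, ?_⟩
        rw [hb, Equiv.apply_symm_apply]

lemma dimRel_of_symm_iterate [CompactSpace X] {S : SmaleSpace X} (n : ℕ) :
    ∀ E F E' F' : CompactOpen S, E'.1 = S.φ.symm^[n] '' E.1 → F'.1 = S.φ.symm^[n] '' F.1 →
      DimRel S E' F' → DimRel S E F := by
  induction n with
  | zero =>
    intro E F E' F' hE hF h
    obtain rfl : E' = E := Subtype.ext (by simpa using hE)
    obtain rfl : F' = F := Subtype.ext (by simpa using hF)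
    exact h
  | succ n ih =>
    intro E F E' F' hE hF h
    have hs : ∀ A : CompactOpen S, A.1 = S.φ '' (A.map S.isSBijective_symm).1 := fun A => by
      change A.1 = S.φ '' (S.φ.symm '' A.1)
      rw [Set.image_image]
      simp
    have hi : ∀ A : CompactOpen S, S.φ.symm^[n + 1] '' A.1 =
        S.φ.symm^[n] '' (A.map S.isSBijective_symm).1 := fun A => by
      change _ = S.φ.symm^[n] '' (S.φ.symm '' A.1)
      rw [← Set.image_comp, Function.iterate_succ]
    exact DimRel.shift _ _ _ _ (hs E) (hs F) (ih _ _ E' F' (hE.trans (hi E)) (hF.trans (hi F)) h)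

lemma exists_symm_iterate_image [CompactSpace X] {S : SmaleSpace X} (n : ℕ) (E : CompactOpen S) :
    ∃ E' : CompactOpen S, E'.1 = S.φ.symm^[n] '' E.1 := by
  induction n with
  | zero => exact ⟨E, by simp⟩
  | succ n ih =>
    obtain ⟨E', hE'⟩ := ih
    refine ⟨E'.map S.isSBijective_symm, ?_⟩
    change S.φ.symm '' E'.1 = _
    rw [hE', ← Set.image_comp, Function.iterate_succ']

/-- Sets whose pasts are small and related by a small unstable holonomy are equivalent. -/
lemma exists_dimRel_past [CompactSpace X] : ∃ δ > 0, ∀ (n : ℕ) (E F : CompactOpen S)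
    (e : E.1 ≃ F.1),
    (∀ x x' : E.1, ∀ j : ℕ, dist (S.φ^[j] (S.φ.symm^[n] x)) (S.φ^[j] (S.φ.symm^[n] x')) ≤ δ) →
    (∀ y y' : F.1, ∀ j : ℕ, dist (S.φ^[j] (S.φ.symm^[n] y)) (S.φ^[j] (S.φ.symm^[n] y')) ≤ δ) →
    (∀ x : E.1, ∀ k ≥ n, dist (S.φ.symm^[k] x) (S.φ.symm^[k] (e x)) ≤ δ) → DimRel S E F := by
  obtain ⟨δ, hδ, h⟩ := S.exists_dimRel
  refine ⟨δ, hδ, fun n E F e hE hF hEF => ?_⟩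
  obtain ⟨E', hE'⟩ := exists_symm_iterate_image n E
  obtain ⟨F', hF'⟩ := exists_symm_iterate_image n F
  refine dimRel_of_symm_iterate n E F E' F' hE' hF' ?_
  have hinj : Function.Injective S.φ.symm^[n] := S.φ.symm.injective.iterate n
  let u : E.1 ≃ E'.1 := (Equiv.Set.image _ E.1 hinj).trans (Equiv.setCongr hE'.symm)
  let v : F.1 ≃ F'.1 := (Equiv.Set.image _ F.1 hinj).trans (Equiv.setCongr hF'.symm)
  have hu : ∀ x, (u x : X) = S.φ.symm^[n] x := fun x => rfl
  have hv : ∀ x, (v x : X) = S.φ.symm^[n] x := fun x => rfl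
  refine h E' F' ((u.symm.trans e).trans v) (fun x x' j => ?_) (fun y y' j => ?_) fun x k => ?_
  · obtain ⟨x, rfl⟩ := u.surjective x
    obtain ⟨x', rfl⟩ := u.surjective x'
    exact hE x x' j
  · obtain ⟨y, rfl⟩ := v.surjective y
    obtain ⟨y', rfl⟩ := v.surjective y'
    exact hF y y' j
  · obtain ⟨x, rfl⟩ := u.surjective x
    simp only [Equiv.trans_apply, Equiv.symm_apply_apply, hu, hv, ← Function.iterate_add_apply]
    exact hEF x (k + n) (by omega)

lemma leafConstant_comp [CompactSpace X] {S : SmaleSpace X} {T : Type*} {q : X → T}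
    (hq : ∃ η > 0, ∀ p p', dist p p' < η → q p = q p') {f : X → X} (hf : IsMap S S f)
    (E : Set X) : LeafConstant S.φ fun x : E => q (f x) := by
  intro x
  obtain ⟨η, hη, h⟩ := hq
  obtain ⟨δ, hδ, h'⟩ := hf.exists_localSet hη
  refine ⟨δ, hδ, fun x' hx' => (h _ _ ?_).symm⟩
  exact dist_lt_of_mem_localSet (h' _ _ hx')

/-- Sets related by a leafwise homeomorphism that preserves the itineraries before time `-n` with
respect to a fine enough partition have the same class. -/
theorem exists_dimClass_eq [CompactSpace X] : ∃ δ > 0, ∀ {T : Type} [Finite T] (q : X → T),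
    (∀ p p', q p = q p' → dist p p' ≤ δ) → (∃ η > 0, ∀ p p', dist p p' < η → q p = q p') →
    ∀ (n : ℕ) (E F : CompactOpen S), LeafHomeo S.φ E.1 F.1
      (fun x y => ∀ k ≥ n, q (S.φ.symm^[k] x) = q (S.φ.symm^[k] y)) → dimClass E = dimClass F := by
  obtain ⟨δ, hδ, h⟩ := S.exists_dimRel_past
  refine ⟨δ, hδ, fun {T} _ q hq hq' n E F ⟨e, he, he', her⟩ => ?_⟩
  obtain ⟨J, hJ⟩ := exists_uniform_contract E hδ
  obtain ⟨J', hJ'⟩ := exists_uniform_contract F hδ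
  -- The window of times −n, …, max(J, J') − 1. Equal symbols control distances inside it, and
  -- uniform contraction takes over afterwards.
  let N := max J J' + n
  let κ : X → Fin N → T := fun x j => q (S.φ^[j] (S.φ.symm^[n] x))
  have hκ : ∀ A : Set X, LeafConstant S.φ fun x : A => κ x := fun A =>
    LeafConstant.pi fun j : Fin N => leafConstant_comp hq' (f := fun x => S.φ^[j] (S.φ.symm^[n] x))
      ⟨(S.isMap_iterate j).continuous.comp (S.isMap_symm_iterate n).continuous, fun x => by
        rw [(S.isMap_symm_iterate n).map_φ, (S.isMap_iterate j).map_φ]⟩ A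
  have hdist : ∀ (A : CompactOpen S) (I : ℕ), I ≤ max J J' →
      (∀ x ∈ A.1, ∀ x' ∈ A.1, ∀ j ≥ I, dist (S.φ^[j] x) (S.φ^[j] x') ≤ δ) →
      ∀ x ∈ A.1, ∀ x' ∈ A.1, κ x = κ x' → ∀ j : ℕ,
        dist (S.φ^[j] (S.φ.symm^[n] x)) (S.φ^[j] (S.φ.symm^[n] x')) ≤ δ := by
    intro A I hI hA x hx x' hx' hxx j
    rcases lt_or_ge j N with hj | hj
    · exact hq _ _ (congrFun hxx ⟨j, hj⟩)
    · have hjn : j = (j - n) + n := by omega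
      rw [hjn, Function.iterate_add_apply, Function.iterate_add_apply, S.symm_iterate_iterate,
        S.symm_iterate_iterate]
      exact hA x hx x' hx' _ (by omega)
  -- Cutting by the symbols of a point and of its partner makes corresponding pieces of `E` and `F`
  -- small simultaneously; the hypothesis on the past supplies the small holonomy between them.
  let ℓ : E.1 → (Fin N → T) × (Fin N → T) := fun x => (κ x, κ (e x))
  have hℓ : LeafConstant S.φ ℓ := (hκ E.1).prodMk ((hκ F.1).comp he)
  have hℓ' : LeafConstant S.φ (ℓ ∘ e.symm) := hℓ.comp he'
  have := Fintype.ofFinite ((Fin N → T) × (Fin N → T))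
  rw [← CompactOpen.isAdditive_dimClass.sum_cut E ℓ hℓ,
    ← CompactOpen.isAdditive_dimClass.sum_cut F (ℓ ∘ e.symm) hℓ']
  refine Finset.sum_congr rfl fun t _ => ?_
  have hE : ∀ x : (E.cut ℓ hℓ {t}).1, ∃ hx : (x : X) ∈ E.1, ℓ ⟨x, hx⟩ = t := by
    rintro ⟨_, x, hx, rfl⟩
    exact ⟨x.2, hx⟩
  have hF : ∀ y : (F.cut (ℓ ∘ e.symm) hℓ' {t}).1,
      ∃ hy : (y : X) ∈ F.1, ℓ (e.symm ⟨y, hy⟩) = t := by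
    rintro ⟨_, y, hy, rfl⟩
    exact ⟨y.2, hy⟩
  let e' : (E.cut ℓ hℓ {t}).1 ≃ (F.cut (ℓ ∘ e.symm) hℓ' {t}).1 :=
    { toFun := fun x => ⟨e ⟨x, (hE x).1⟩, e ⟨x, (hE x).1⟩, by
        simpa using (hE x).2, rfl⟩
      invFun := fun y => ⟨e.symm ⟨y, (hF y).1⟩, e.symm ⟨y, (hF y).1⟩, by
        simpa using (hF y).2, rfl⟩
      left_inv := fun x => by simp
      right_inv := fun y => by simp }
  refine congrArg QuotientAddGroup.mk (congrArg FreeAbelianGroup.of (Quotient.sound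
    (h n _ _ e' (fun x x' => ?_) (fun y y' => ?_) fun x k hk => ?_)))
  · refine hdist E J (le_max_left _ _) hJ x (hE x).1 x' (hE x').1 ?_
    exact congrArg Prod.fst ((hE x).2.trans (hE x').2.symm)
  · refine hdist F J' (le_max_right _ _) hJ' y (hF y).1 y' (hF y').1 ?_
    have := congrArg Prod.snd ((hF y).2.trans (hF y').2.symm)
    simpa [ℓ] using this
  · exact hq _ _ (her ⟨x, (hE x).1⟩ k hk)

end SmaleSpace

end Leafwise

end SmaleHomology

namespace SmaleHomology

open Filter Topology

section Partition

variable {X W : Type*} [MetricSpace X] [MetricSpace W]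

/-! ### Equivalent sets have the same past itineraries -/

namespace SmaleSpace

variable (S : SmaleSpace X)

lemma exists_pow_mul_lt {c η : ℝ} (hη : 0 < η) : ∃ n : ℕ, ∀ k ≥ n, S.lam ^ k * c < η := by
  have h : Tendsto (fun k : ℕ => S.lam ^ k * c) atTop (𝓝 0) := by
    simpa using (tendsto_pow_atTop_nhds_zero_of_lt_one S.lam_pos.le S.lam_lt_one).mul_const c
  exact eventually_atTop.mp ((tendsto_order.mp h).2 η hη)

lemma mem_localSet_of_bracket {x y : X} {ε : ℝ} (h : dist x y ≤ S.eps) (hε : dist x y < ε)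
    (hb : S.bracket x y = y) : y ∈ localSet S.φ x ε :=
  ⟨S.asymptotic_of_bracket h hb, fun n => ((S.contract_iterate h hb n).1.trans
    (mul_le_of_le_one_left dist_nonneg (pow_le_one₀ S.lam_pos.le S.lam_lt_one.le))).trans_lt hε⟩

lemma continuousOn_bracket_right (y : X) :
    ContinuousOn (fun x => S.bracket y x) {x | dist y x ≤ S.eps} :=
  S.continuousOn_bracket.comp (f := fun x => (y, x)) (by fun_prop) fun _ h => h

variable {S}

/-- Inside a local stable set metric closeness already implies leaf closeness, so metric continuity
of the bracket is enough. -/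
lemma leafContinuous_bracket {E F : Set X} {y : X} (h : E → F)
    (hh : ∀ x : E, (h x : X) = S.bracket y x) (hy : ∀ x ∈ E, dist y x ≤ S.eps)
    (hF : ∀ z ∈ F, ∀ z' ∈ F, dist z z' ≤ S.eps ∧ S.bracket z z' = z') :
    LeafContinuous S.φ S.φ h := by
  intro x ε hε
  obtain ⟨δ, hδ, hd⟩ := Metric.continuousOn_iff.mp (S.continuousOn_bracket_right y) x (hy x x.2) ε hε
  refine ⟨δ, hδ, fun x' hx' => ?_⟩
  obtain ⟨h1, h2⟩ := hF (h x) (h x).2 (h x') (h x').2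
  refine S.mem_localSet_of_bracket h1 ?_ h2
  rw [hh, hh, dist_comm]
  exact hd x' (hy x' x'.2) (by rw [dist_comm]; exact dist_lt_of_mem_localSet hx')

/-- The maps x ↦ [y₀, x] and y ↦ [x₀, y] are mutually inverse, and a point and its image lie on a
common local unstable set. Backward contraction brings them uniformly within the Lebesgue scale η,
so their symbols agree at all times before some −n. -/
lemma exists_leafHomeo_of_bracket [CompactSpace X] {T : Type*} {q : X → T}
    (hq : ∃ η > 0, ∀ p p', dist p p' < η → q p = q p') (E F : CompactOpen S)
    (hE : ∃ e, E.1 ⊆ localSet S.φ e (S.eps / 2)) (hF : ∃ f, F.1 ⊆ localSet S.φ f (S.eps / 2))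
    (hEF : ∀ x ∈ E.1, ∀ y ∈ F.1, dist x y ≤ S.eps)
    (h₁ : Set.image2 S.bracket E.1 F.1 = E.1) (h₂ : Set.image2 S.bracket F.1 E.1 = F.1) :
    ∃ n, LeafHomeo S.φ E.1 F.1 fun x y => ∀ k ≥ n, q (S.φ.symm^[k] x) = q (S.φ.symm^[k] y) := by
  rcases Set.eq_empty_or_nonempty E.1 with hE0 | ⟨x₀, hx₀⟩
  · rw [hE0, Set.image2_empty_right] at h₂
    rw [hE0, ← h₂]
    exact ⟨0, .refl fun _ _ _ => rfl⟩
  rcases Set.eq_empty_or_nonempty F.1 with hF0 | ⟨y₀, hy₀⟩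
  · rw [hF0, Set.image2_empty_right] at h₁
    rw [hF0, ← h₁]
    exact ⟨0, .refl fun _ _ _ => rfl⟩
  obtain ⟨η, hη, hq⟩ := hq
  have hloc : ∀ A : Set X, (∃ e, A ⊆ localSet S.φ e (S.eps / 2)) → ∀ z ∈ A, ∀ z' ∈ A,
      dist z z' ≤ S.eps ∧ S.bracket z z' = z' := by
    rintro A ⟨e, he⟩ z hz z' hz'
    have hd : ∀ n : ℕ, dist (S.φ^[n] z) (S.φ^[n] z') ≤ S.eps := fun n => by
      have h1 := (he hz).2 n
      have h2 := (he hz').2 n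
      have h3 := dist_triangle_left (S.φ^[n] z) (S.φ^[n] z') (S.φ^[n] e)
      linarith
    exact ⟨hd 0, S.bracket_eq_of_asymptotic hd ((he hz).1.symm.trans (he hz').1)⟩
  have hE' := hloc _ hE
  have hF' := hloc _ hF
  have hFE : ∀ y ∈ F.1, ∀ x ∈ E.1, dist y x ≤ S.eps := fun y hy x hx => by
    rw [dist_comm]; exact hEF x hx y hy
  have mF : ∀ y ∈ F.1, ∀ x ∈ E.1, S.bracket y x ∈ F.1 := fun y hy x hx => by
    rw [← h₂]; exact ⟨y, hy, x, hx, rfl⟩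
  have mE : ∀ x ∈ E.1, ∀ y ∈ F.1, S.bracket x y ∈ E.1 := fun x hx y hy => by
    rw [← h₁]; exact ⟨x, hx, y, hy, rfl⟩
  let e : E.1 ≃ F.1 :=
    { toFun := fun x => ⟨S.bracket y₀ x, mF y₀ hy₀ x x.2⟩
      invFun := fun y => ⟨S.bracket x₀ y, mE x₀ hx₀ y y.2⟩
      left_inv := fun x => Subtype.ext (by
        change S.bracket x₀ (S.bracket y₀ x) = x
        rw [S.bracket_right _ _ _ (hFE _ hy₀ _ x.2) (hEF _ hx₀ _ (mF y₀ hy₀ x x.2))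
          (hE' x₀ hx₀ x x.2).1, (hE' x₀ hx₀ x x.2).2])
      right_inv := fun y => Subtype.ext (by
        change S.bracket y₀ (S.bracket x₀ y) = y
        rw [S.bracket_right _ _ _ (hEF _ hx₀ _ y.2) (hFE _ hy₀ _ (mE x₀ hx₀ y y.2))
          (hF' y₀ hy₀ y y.2).1, (hF' y₀ hy₀ y y.2).2]) }
  obtain ⟨n, hn⟩ := S.exists_pow_mul_lt (c := S.eps) hη
  refine ⟨n, e, leafContinuous_bracket (y := y₀) e (fun _ => rfl) (hFE y₀ hy₀) hF',
    leafContinuous_bracket (y := x₀) e.symm (fun _ => rfl) (hEF x₀ hx₀) hE', fun x k hk => ?_⟩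
  have hd : dist (x : X) (e x) ≤ S.eps := hEF x x.2 _ (e x).2
  have hb : S.bracket (e x) x = e x :=
    S.bracket_left y₀ x x (hFE y₀ hy₀ x x.2) (hFE _ (mF y₀ hy₀ x x.2) x x.2) (hFE y₀ hy₀ x x.2)
  have h := (S.reverse.contract_iterate (y := (x : X)) (z := (e x : X)) hd hb k).1
  exact hq _ _ ((h.trans (mul_le_mul_of_nonneg_left hd (pow_nonneg S.lam_pos.le _))).trans_lt
    (hn k hk))

/-- Equivalent compact open sets are related by a leafwise homeomorphism that preserves the
remote past of itineraries. -/
lemma exists_leafHomeo_of_dimRel [CompactSpace X] {T : Type*} {q : X → T}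
    (hq : ∃ η > 0, ∀ p p', dist p p' < η → q p = q p') {E F : CompactOpen S} (h : DimRel S E F) :
    ∃ n, LeafHomeo S.φ E.1 F.1 fun x y => ∀ k ≥ n, q (S.φ.symm^[k] x) = q (S.φ.symm^[k] y) := by
  induction h with
  | bracket E F hE hF hEF h₁ h₂ => exact exists_leafHomeo_of_bracket hq E F hE hF hEF h₁ h₂
  | shift E F E' F' hE hF _ ih =>
    obtain ⟨n, h⟩ := ih
    -- Applying φ turns time −k of the old set into time −(k + 1) of the new one, so the threshold
    -- moves by one; in the inverse case the old threshold still works.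
    refine ⟨n + 1, ?_⟩
    rw [hE, hF]
    refine h.map E.2.1 F.2.1 S.isSBijective_φ S.isSBijective_φ fun x _ y _ hxy k hk => ?_
    obtain ⟨k, rfl⟩ : ∃ j, k = j + 1 := ⟨k - 1, by omega⟩
    simpa using hxy k (by omega)
  | unshift E F E' F' hE hF _ ih =>
    obtain ⟨n, h⟩ := ih
    refine ⟨n, ?_⟩
    have hs : ∀ A : Set X, S.φ.symm '' (S.φ '' A) = A := fun A => by
      rw [Set.image_image]
      simp
    rw [← hs E.1, ← hs F.1, ← hE, ← hF]
    refine h.map E'.2.1 F'.2.1 S.isSBijective_symm S.isSBijective_symm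
      fun x _ y _ hxy k hk => ?_
    simpa using hxy (k + 1) (by omega)
  | refl E => exact ⟨0, .refl fun _ _ _ => rfl⟩
  | symm E F _ ih =>
    obtain ⟨n, h⟩ := ih
    exact ⟨n, h.symm fun x y hxy k hk => (hxy k hk).symm⟩
  | trans E F G _ _ ih ih' =>
    obtain ⟨n, h⟩ := ih
    obtain ⟨n', h'⟩ := ih'
    exact ⟨max n n', h.trans h' fun x y z hxy hyz k hk =>
      (hxy k ((le_max_left _ _).trans hk)).trans (hyz k ((le_max_right _ _).trans hk))⟩

/-! ### Fine clopen partitions -/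

variable (S)

/-- The map x ↦ [p, x] sends a small neighbourhood of `p` into a local stable set, where it is
continuous even for the finer leaf topology; so it carries connected sets to leafwise connected
sets. -/
lemma exists_isPreconnected_image [CompactSpace X] : ∃ δ > 0, ∀ (p : X) (K : Set X),
    IsPreconnected K → (∀ x ∈ K, dist p x ≤ δ) →
      @IsPreconnected X (leafTopology S.φ) (S.bracket p '' K) ∧
        S.bracket p '' K ⊆ S.stableSet p := by
  have h0 := S.eps_pos
  obtain ⟨δ, hδ, hδe, hd⟩ := S.near_diag (half_pos h0)
  refine ⟨δ, hδ, fun p K hK hp => ?_⟩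
  have hpx : ∀ x ∈ K, dist p x ≤ S.eps := fun x hx => (hp x hx).trans hδe
  have hpb : ∀ x ∈ K, dist p (S.bracket p x) ≤ S.eps / 2 := fun x hx => by
    rw [dist_comm]; exact (hd p x (hp x hx)).1.le
  have hb : ∀ x ∈ K, S.bracket p (S.bracket p x) = S.bracket p x := fun x hx =>
    S.bracket_right _ _ _ (hpx x hx) ((hpb x hx).trans (by linarith)) (hpx x hx)
  have hxx : ∀ x ∈ K, ∀ x' ∈ K, dist (S.bracket p x) (S.bracket p x') ≤ S.eps :=
    fun x hx x' hx' => by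
      have := dist_triangle_left (S.bracket p x) (S.bracket p x') p
      linarith [hpb x hx, hpb x' hx']
  have hbb : ∀ x ∈ K, ∀ x' ∈ K, S.bracket (S.bracket p x) (S.bracket p x') = S.bracket p x' :=
    fun x hx x' hx' => by
      have h1 := S.bracket_left p x (S.bracket p x') (hpx x hx) (hxx x hx x' hx')
        ((hpb x' hx').trans (by linarith))
      rw [h1, hb x' hx']
  constructor
  · refine @IsPreconnected.image X X _ (leafTopology S.φ) K hK _ ?_
    refine (@continuousOn_iff X X _ (leafTopology S.φ) _ _).mpr fun x hx t ht hxt => ?_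
    obtain ⟨ε, hε, hεt⟩ := ht _ hxt
    obtain ⟨ρ, hρ, h⟩ := Metric.continuousOn_iff.mp (S.continuousOn_bracket_right p) x (hpx x hx)
      ε hε
    refine ⟨Metric.ball x ρ, Metric.isOpen_ball, Metric.mem_ball_self hρ, fun x' hx' => hεt ?_⟩
    refine S.mem_localSet_of_bracket (hxx x hx x' hx'.2) ?_ (hbb x hx x' hx'.2)
    rw [dist_comm]
    exact h x' (hpx x' hx'.2) hx'.1
  · rintro _ ⟨x, hx, rfl⟩
    exact S.asymptotic_of_bracket ((hpb x hx).trans (by linarith)) (hb x hx)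

variable {S}

/-- If all leaves are totally disconnected, small connected sets are points. -/
lemma exists_subsingleton_of_isPreconnected [CompactSpace X]
    (hs : ∀ x, @IsTotallyDisconnected X (leafTopology S.φ) (S.stableSet x))
    (hu : ∀ x, @IsTotallyDisconnected X (leafTopology S.φ.symm) (S.unstableSet x)) :
    ∃ δ > 0, ∀ K : Set X, IsPreconnected K → (∀ x ∈ K, ∀ y ∈ K, dist x y ≤ δ) →
      K.Subsingleton := by
  obtain ⟨δ, hδ, h⟩ := S.exists_isPreconnected_image
  obtain ⟨δ', hδ', h'⟩ := S.reverse.exists_isPreconnected_image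
  have h0 := S.eps_pos
  refine ⟨min (min δ δ') S.eps, by positivity, fun K hK hd p hp x hx => ?_⟩
  obtain ⟨h1, h2⟩ := h p K hK fun y hy =>
    (hd p hp y hy).trans ((min_le_left _ _).trans (min_le_left _ _))
  obtain ⟨h1', h2'⟩ := h' p K hK fun y hy =>
    (hd p hp y hy).trans ((min_le_left _ _).trans (min_le_right _ _))
  -- Both projections of `K` are connected in a totally disconnected leaf, so [p, x] = p = [x, p].
  -- Then x = [x, x] = [x, [p, x]] = [x, p] = p.
  have e1 : S.bracket p x = S.bracket p p :=
    hs p _ h2 h1 (Set.mem_image_of_mem _ hx) (Set.mem_image_of_mem _ hp)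
  have e2 : S.bracket x p = S.bracket p p :=
    hu p _ h2' h1' (Set.mem_image_of_mem _ hx) (Set.mem_image_of_mem _ hp)
  rw [S.bracket_self] at e1 e2
  have hxp : dist x p ≤ S.eps := (hd x hx p hp).trans (min_le_right _ _)
  have e3 := S.bracket_right x p x (by rw [dist_comm]; exact hxp) (by rw [e1]; exact hxp)
    (by rw [dist_self]; exact h0.le)
  rw [e1, e2, S.bracket_self] at e3
  exact e3

/-- A small closed ball is compact and totally disconnected, hence has a basis of clopen sets. -/
lemma exists_isClopen_subset_ball [CompactSpace X]
    (hs : ∀ x, @IsTotallyDisconnected X (leafTopology S.φ) (S.stableSet x))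
    (hu : ∀ x, @IsTotallyDisconnected X (leafTopology S.φ.symm) (S.unstableSet x))
    (p : X) {ε : ℝ} (hε : 0 < ε) : ∃ V : Set X, IsClopen V ∧ p ∈ V ∧ V ⊆ Metric.ball p ε := by
  obtain ⟨δ, hδ, h⟩ := exists_subsingleton_of_isPreconnected hs hu
  set r := min ε (δ / 2) with hr
  have hr0 : 0 < r := lt_min hε (half_pos hδ)
  have hc : CompactSpace (Metric.closedBall p r) :=
    isCompact_iff_compactSpace.mp (Metric.isClosed_closedBall.isCompact)
  have ht : TotallyDisconnectedSpace (Metric.closedBall p r) := by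
    refine totallyDisconnectedSpace_subtype_iff.mpr fun K hK hKc => h K hKc fun x hx y hy => ?_
    have h1 := Metric.mem_closedBall.mp (hK hx)
    have h2 := Metric.mem_closedBall.mp (hK hy)
    have h3 := dist_triangle_right x y p
    have h4 : r ≤ δ / 2 := min_le_right _ _
    linarith
  obtain ⟨V, hV, hpV, hVU⟩ := compact_exists_isClopen_in_isOpen
    (X := Metric.closedBall p r) (x := ⟨p, Metric.mem_closedBall_self hr0.le⟩)
    (U := Subtype.val ⁻¹' Metric.ball p r) (Metric.isOpen_ball.preimage continuous_subtype_val)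
    (Metric.mem_ball_self hr0)
  have hsub : Subtype.val '' V ⊆ Metric.ball p r := by
    rintro _ ⟨x, hx, rfl⟩
    exact hVU hx
  refine ⟨Subtype.val '' V, ⟨?_, ?_⟩, ⟨_, hpV, rfl⟩,
    hsub.trans (Metric.ball_subset_ball (min_le_left _ _))⟩
  · exact (hV.1.isCompact.image continuous_subtype_val).isClosed
  · obtain ⟨O, hO, hOV⟩ := isOpen_induced_iff.mp hV.2
    -- `V` is only relatively open in the closed ball; being contained in the open ball, it is open
    -- in the whole space.
    have : Subtype.val '' V = O ∩ Metric.ball p r := by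
      ext x
      constructor
      · intro hx
        refine ⟨?_, hsub hx⟩
        obtain ⟨y, hy, rfl⟩ := hx
        rw [← hOV] at hy
        exact hy
      · rintro ⟨hxO, hxb⟩
        refine ⟨⟨x, Metric.ball_subset_closedBall hxb⟩, ?_, rfl⟩
        rw [← hOV]
        exact hxO
    rw [this]
    exact hO.inter Metric.isOpen_ball

/-- If all leaves are totally disconnected, there are partitions into small clopen sets. -/
lemma exists_clopen_partition [CompactSpace X]
    (hs : ∀ x, @IsTotallyDisconnected X (leafTopology S.φ) (S.stableSet x))
    (hu : ∀ x, @IsTotallyDisconnected X (leafTopology S.φ.symm) (S.unstableSet x))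
    {ε : ℝ} (hε : 0 < ε) : ∃ (N : ℕ) (P : X → Fin N), (∀ p p', P p = P p' → dist p p' ≤ ε) ∧
      ∃ η > 0, ∀ p p', dist p p' < η → P p = P p' := by
  choose V hV hpV hVb using fun p : X => exists_isClopen_subset_ball hs hu p (half_pos hε)
  obtain ⟨t, ht⟩ := isCompact_univ.elim_nhds_subcover V
    fun p _ => (hV p).2.mem_nhds (hpV p)
  have hfin : Finite (t → Prop) := inferInstance
  obtain ⟨N, ⟨u⟩⟩ := hfin.exists_equiv_fin
  -- The symbol records membership in each set of a finite clopen cover.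
  let P : X → Fin N := fun p => u fun i => p ∈ V i
  have hP : ∀ p p', P p = P p' → ∀ i : t, p ∈ V i ↔ p' ∈ V i := fun p p' h i =>
    iff_of_eq (congrFun (u.injective h) i)
  refine ⟨N, P, fun p p' h => ?_, ?_⟩
  · obtain ⟨i, hi, hpi⟩ := Set.mem_iUnion₂.mp (ht.2 (Set.mem_univ p))
    have h1 := hVb i hpi
    have h2 := hVb i ((hP p p' h ⟨i, hi⟩).mp hpi)
    have h3 := dist_triangle_right p p' i
    rw [Metric.mem_ball] at h1 h2
    linarith
  · have hopen : ∀ c : t → Prop, IsOpen {p : X | ∀ i : t, p ∈ V i ↔ c i} := fun c => by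
      simp only [Set.ofPred_forall]
      refine isOpen_iInter_of_finite fun i => ?_
      by_cases hc : c i
      · simpa [hc] using (hV i).2
      · simp only [hc, iff_false]
        exact (hV i).1.isOpen_compl
    obtain ⟨η, hη, h⟩ := lebesgue_number_lemma_of_metric (isCompact_univ (X := X)) hopen
      (fun p _ => Set.mem_iUnion.mpr ⟨fun i => p ∈ V i, fun i => Iff.rfl⟩)
    refine ⟨η, hη, fun p p' hpp => ?_⟩
    obtain ⟨c, hc⟩ := h p (Set.mem_univ p)
    refine congrArg u (funext fun i => propext ?_)
    exact (hc (Metric.mem_ball_self hη) i).trans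
      (hc (Metric.mem_ball'.mpr hpp) i).symm

end SmaleSpace

end Partition

namespace SUPair

variable {X Y Z : Type*} [MetricSpace X] [MetricSpace Y] [MetricSpace Z]
  {SX : SmaleSpace X} {SY : SmaleSpace Y} {SZ : SmaleSpace Z}
variable [CompactSpace X] [CompactSpace Y] [CompactSpace Z] (π : SUPair SX SY SZ) {L M : ℕ}

/-! ### Itineraries in `Σ_{L,M}` -/

lemma isMap_snd (m : Fin (M + 1)) : IsMap (π.shiftSpace L M) SZ fun p => p.1.2 m :=
  ⟨by fun_prop, fun _ => rfl⟩

lemma isMap_fst_reverse (l : Fin (L + 1)) :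
    IsMap (π.shiftSpace L M).reverse SY.reverse fun p => p.1.1 l :=
  ⟨by fun_prop, fun _ => rfl⟩

lemma isMap_snd_reverse (m : Fin (M + 1)) :
    IsMap (π.shiftSpace L M).reverse SZ.reverse fun p => p.1.2 m :=
  ⟨by fun_prop, fun _ => rfl⟩

variable {π} in
-- The `Z`-coordinates determine the common image in `X`, and `π.πs` is injective on each stable set
-- of `Y`. The companion below uses injectivity of `π.πu` on unstable sets.
lemma eq_of_asymptotic_of_snd_eq {p q : π.Shift L M} (h : Asymptotic (π.shiftSpace L M).φ p q)
    (hz : ∀ m, p.1.2 m = q.1.2 m) : p = q := by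
  refine shift_ext (fun l => ?_) hz
  have hp : p.1.1 l ∈ SY.stableSet (p.1.1 l) := by simp [SmaleSpace.stableSet, Asymptotic]
  refine (π.πs_sBijective.bijOn (p.1.1 l)).injOn hp ((π.asymptotic_iff.mp h).1 l) ?_
  rw [p.2 l 0, q.2 l 0, hz 0]

variable {π} in
lemma eq_of_asymptotic_of_fst_eq {p q : π.Shift L M}
    (h : Asymptotic (π.shiftSpace L M).φ.symm p q) (hy : ∀ l, p.1.1 l = q.1.1 l) : p = q := by
  refine shift_ext hy fun m => ?_
  have hp : p.1.2 m ∈ SZ.unstableSet (p.1.2 m) := by simp [SmaleSpace.unstableSet, Asymptotic]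
  refine (π.πu_uBijective.bijOn (p.1.2 m)).injOn hp ((π.isMap_snd_reverse m).asymptotic h) ?_
  rw [← p.2 0 m, ← q.2 0 m, hy 0]

/-- A leafwise connected set has constant `Z`-coordinates, since stable sets of `Z` are totally
disconnected, and these determine the point within its leaf. The unstable case exchanges the roles
of `Y` and `Z`. -/
lemma isTotallyDisconnected_stableSet (p : π.Shift L M) :
    @IsTotallyDisconnected _ (leafTopology (π.shiftSpace L M).φ)
      ((π.shiftSpace L M).stableSet p) := by
  intro K hK hKc x hx y hy
  refine eq_of_asymptotic_of_snd_eq ((hK hx : Asymptotic _ p x).symm.trans (hK hy)) fun m => ?_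
  refine π.stable_totallyDisconnected (p.1.2 m) ((fun p => p.1.2 m) '' K) ?_
    (@IsPreconnected.image _ _ (leafTopology (π.shiftSpace L M).φ) (leafTopology SZ.φ) K hKc _
      (@Continuous.continuousOn _ _ (leafTopology (π.shiftSpace L M).φ) (leafTopology SZ.φ) _ _
        (π.isMap_snd m).continuous_leaf))
    (Set.mem_image_of_mem _ hx) (Set.mem_image_of_mem _ hy)
  rintro _ ⟨z, hz, rfl⟩
  exact (π.isMap_snd m).asymptotic (hK hz)

lemma isTotallyDisconnected_unstableSet (p : π.Shift L M) :
    @IsTotallyDisconnected _ (leafTopology (π.shiftSpace L M).φ.symm)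
      ((π.shiftSpace L M).unstableSet p) := by
  intro K hK hKc x hx y hy
  refine eq_of_asymptotic_of_fst_eq ((hK hx : Asymptotic _ p x).symm.trans (hK hy)) fun l => ?_
  refine π.unstable_totallyDisconnected (p.1.1 l) ((fun p => p.1.1 l) '' K) ?_
    (@IsPreconnected.image _ _ (leafTopology (π.shiftSpace L M).φ.symm) (leafTopology SY.φ.symm)
      K hKc _ (@Continuous.continuousOn _ _ (leafTopology (π.shiftSpace L M).φ.symm)
        (leafTopology SY.φ.symm) _ _ (π.isMap_fst_reverse l).continuous_leaf))
    (Set.mem_image_of_mem _ hx) (Set.mem_image_of_mem _ hy)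
  rintro _ ⟨z, hz, rfl⟩
  exact (π.isMap_fst_reverse l).asymptotic (hK hz)

/-- Close points of `Σ_{L,M}` with the same `Z`-coordinates have the same remote past. -/
lemma exists_dist_symm_iterate_le (L M : ℕ) : ∃ δ > 0, ∀ p q : π.Shift L M, dist p q ≤ δ →
    p.1.2 = q.1.2 → ∀ k : ℕ, dist ((π.shiftSpace L M).φ.symm^[k] p)
      ((π.shiftSpace L M).φ.symm^[k] q) ≤ (π.shiftSpace L M).lam ^ k * (π.shiftSpace L M).eps := by
  set S := π.shiftSpace L M with hS
  obtain ⟨δ, hδ, hδe, hd⟩ := S.near_diag S.eps_pos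
  refine ⟨δ, hδ, fun p q hpq hz k => ?_⟩
  have h1 : dist p q ≤ S.eps := hpq.trans hδe
  have h2 : dist p (S.bracket p q) ≤ S.eps := by
    rw [dist_comm]; exact (hd p q hpq).1.le
  have h3 := S.asymptotic_of_bracket h2 (S.bracket_right _ _ _ h1 h2 h1)
  -- [p, q] is stably equivalent to `p` and has the same `Z`-coordinates, so it equals `p`. Thus `p`
  -- and `q` lie on a common local unstable set, where the past contracts.
  have h4 : p = S.bracket p q := eq_of_asymptotic_of_snd_eq h3 fun m => by
    have : (S.bracket p q).1.2 m = SZ.bracket (p.1.2 m) (q.1.2 m) := π.shiftBracket_snd h1 m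
    rw [this, ← hz, SZ.bracket_self]
  have h5 := (S.reverse.contract_iterate (y := q) (z := p) (by rw [dist_comm]; exact h1)
    h4.symm k).1
  rw [dist_comm]
  refine h5.trans (mul_le_mul_of_nonneg_left ?_ (pow_nonneg S.lam_pos.le _))
  rw [dist_comm]
  exact h1

/-- A partition of `Σ_{0,M}` into small clopen sets, such that for points with the same
`Z`-coordinates the present symbol determines the past itinerary. -/
structure Partition (π : SUPair SX SY SZ) (M : ℕ) where
  size : ℕ
  symbol : π.Shift 0 M → Fin size
  symbol_eq_of_dist_lt : ∃ η > 0, ∀ p p', dist p p' < η → symbol p = symbol p'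
  past_eq : ∀ p p' : π.Shift 0 M, p.1.2 = p'.1.2 → symbol p = symbol p' → ∀ k : ℕ,
    symbol ((π.shiftSpace 0 M).φ.symm^[k] p) = symbol ((π.shiftSpace 0 M).φ.symm^[k] p')

lemma exists_partition (M : ℕ) {ε : ℝ} (hε : 0 < ε) :
    ∃ Q : π.Partition M, ∀ p p', Q.symbol p = Q.symbol p' → dist p p' ≤ ε := by
  set S := π.shiftSpace 0 M with hS
  obtain ⟨δ, hδ, hpast⟩ := π.exists_dist_symm_iterate_le 0 M
  obtain ⟨N, P, hP, η, hη, hPη⟩ := SmaleSpace.exists_clopen_partition (S := S)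
    π.isTotallyDisconnected_stableSet π.isTotallyDisconnected_unstableSet (lt_min hε hδ)
  obtain ⟨n, hn⟩ := S.exists_pow_mul_lt (c := S.eps) hη
  have hfin : Finite (Fin (n + 1) → Fin N) := inferInstance
  obtain ⟨N', ⟨u⟩⟩ := hfin.exists_equiv_fin
  -- The new symbol records the old ones at times 0, −1, …, −n. For points with equal
  -- `Z`-coordinates, those before −n agree automatically by backward contraction, so the present
  -- symbol determines all past ones.
  let Q : π.Shift 0 M → Fin N' := fun p => u fun j => P (S.φ.symm^[j] p)
  have hQ : ∀ p p', Q p = Q p' → ∀ j ≤ n, P (S.φ.symm^[j] p) = P (S.φ.symm^[j] p') :=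
    fun p p' h j hj => congrFun (u.injective h) ⟨j, Nat.lt_succ_of_le hj⟩
  refine ⟨⟨N', Q, ?_, fun p p' hz h k => ?_⟩, fun p p' h =>
    (hP p p' (hQ p p' h 0 (Nat.zero_le _))).trans (min_le_left _ _)⟩
  · have hc : ∀ j : Fin (n + 1), ∃ ρ > 0, ∀ p p' : π.Shift 0 M, dist p p' < ρ →
        dist (S.φ.symm^[j] p) (S.φ.symm^[j] p') < η := fun j => by
      have hu := CompactSpace.uniformContinuous_of_continuous (S.isMap_symm_iterate j).continuous
      rw [Metric.uniformContinuous_iff] at hu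
      obtain ⟨ρ, hρ, h⟩ := hu η hη
      exact ⟨ρ, hρ, fun p p' hpp => h hpp⟩
    choose ρ hρ h using hc
    have h2 : ∀ᶠ r in 𝓝[>] (0 : ℝ), ∀ i, r < ρ i :=
      eventually_all.mpr fun i => nhdsWithin_le_nhds (Iio_mem_nhds (hρ i))
    obtain ⟨r, hr, hr0⟩ := (h2.and self_mem_nhdsWithin).exists
    exact ⟨r, hr0, fun p p' hpp => congrArg u (funext fun j =>
      hPη _ _ (h j p p' (hpp.trans (hr j))))⟩
  · refine congrArg u (funext fun j => ?_)
    rw [← Function.iterate_add_apply, ← Function.iterate_add_apply]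
    rcases le_or_gt ((j : ℕ) + k) n with hj | hj
    · exact hQ p p' h _ hj
    · refine hPη _ _ ((hpast p p' ?_ hz _).trans_lt (hn _ hj.le))
      exact (hP p p' (hQ p p' h 0 (Nat.zero_le _))).trans (min_le_right _ _)

end SUPair

end SmaleHomology

namespace SmaleHomology

section Additive

variable {X W : Type*} [MetricSpace X] [MetricSpace W] {S : SmaleSpace X} {T : SmaleSpace W}
  {G : Type*} [AddCommGroup G]

lemma CompactOpen.IsAdditive.map [CompactSpace X] {μ : CompactOpen T → G}
    (hμ : CompactOpen.IsAdditive μ) {f : X → W} (hf : IsSBijective S T f) :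
    CompactOpen.IsAdditive fun E : CompactOpen S => μ (E.map hf) := by
  intro E F H hd hH
  refine hμ _ _ _ ?_ ?_
  · have hinj : Set.InjOn f (E.1 ∪ F.1) := hH ▸ hf.injOn H.2.1
    exact Set.disjoint_image_image fun x hx y hy hxy =>
      Set.disjoint_left.mp hd hx (hinj (Or.inl hx) (Or.inr hy) hxy ▸ hy)
  · change f '' H.1 = _
    rw [hH, Set.image_union]
    rfl

lemma CompactOpen.IsAdditive.cut {μ : CompactOpen S → G} (hμ : CompactOpen.IsAdditive μ)
    {V : Type*} (ℓ : X → V) (hℓ : ∀ E : Set X, LeafConstant S.φ fun x : E => ℓ x) (s : Set V) :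
    CompactOpen.IsAdditive fun E : CompactOpen S => μ (E.cut (fun x => ℓ x) (hℓ E.1) s) := by
  intro E F H hd hH
  refine hμ _ _ _ ?_ ?_
  · rw [CompactOpen.cut_val, CompactOpen.cut_val]
    exact hd.mono Set.inter_subset_left Set.inter_subset_left
  · rw [CompactOpen.cut_val, CompactOpen.cut_val, CompactOpen.cut_val, hH, Set.union_inter_distrib_right]

end Additive

namespace SUPair

variable {X Y Z : Type*} [MetricSpace X] [MetricSpace Y] [MetricSpace Z]
  {SX : SmaleSpace X} {SY : SmaleSpace Y} {SZ : SmaleSpace Z}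
variable [CompactSpace X] [CompactSpace Y] [CompactSpace Z] {π : SUPair SX SY SZ} {J K L M : ℕ}

lemma reindex_symm_iterate (θ : Fin (K + 1) → Fin (L + 1)) (k : ℕ) (p : π.Shift L M) :
    π.reindex M θ ((π.shiftSpace L M).φ.symm^[k] p) =
      (π.shiftSpace K M).φ.symm^[k] (π.reindex M θ p) :=
  (Function.Semiconj.iterate_right (f := π.reindex M θ) (ga := (π.shiftSpace L M).φ.symm)
    (gb := (π.shiftSpace K M).φ.symm) (fun _ => rfl) k) p

/-! ### Approximations of the dimension groups by holonomies with a prescribed past -/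

namespace Partition

variable (Q : π.Partition M)

/-- The symbols of the points `(y_l, z_0, …, z_M)`. -/
def label (p : π.Shift L M) : Fin (L + 1) → Fin Q.size :=
  fun l => Q.symbol (π.reindex M (fun _ : Fin (0 + 1) => l) p)

lemma label_reindex (θ : Fin (K + 1) → Fin (L + 1)) (p : π.Shift L M) :
    Q.label (π.reindex M θ p) = Q.label p ∘ θ := rfl

lemma label_eq_of_dist_lt (L : ℕ) :
    ∃ η > 0, ∀ p p' : π.Shift L M, dist p p' < η → Q.label p = Q.label p' := by
  obtain ⟨η, hη, h⟩ := Q.symbol_eq_of_dist_lt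
  exact ⟨η, hη, fun p p' hpp => funext fun l =>
    h _ _ ((π.dist_reindex_le _ p p').trans_lt hpp)⟩

/-- Equality of the itineraries up to time `-n`. -/
def SamePast (n : ℕ) (p q : π.Shift L M) : Prop :=
  ∀ k ≥ n, Q.label ((π.shiftSpace L M).φ.symm^[k] p) = Q.label ((π.shiftSpace L M).φ.symm^[k] q)

lemma samePast_reindex {n : ℕ} {p q : π.Shift L M} (h : Q.SamePast n p q)
    (θ : Fin (K + 1) → Fin (L + 1)) : Q.SamePast n (π.reindex M θ p) (π.reindex M θ q) :=
  fun k hk => by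
    rw [← reindex_symm_iterate, ← reindex_symm_iterate, label_reindex, label_reindex, h k hk]

/-- Reindexings with the same effect on the label at time `-n` have the same past. -/
lemma samePast_reindex_of_label {n : ℕ} {p : π.Shift L M} {a : Fin (L + 1) → Fin Q.size}
    (hp : Q.label ((π.shiftSpace L M).φ.symm^[n] p) = a) {θ θ' : Fin (K + 1) → Fin (L + 1)}
    (h : a ∘ θ = a ∘ θ') : Q.SamePast n (π.reindex M θ p) (π.reindex M θ' p) := by
  intro k hk
  obtain ⟨j, rfl⟩ : ∃ j, k = j + n := ⟨k - n, by omega⟩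
  simp only [Function.iterate_add_apply, ← reindex_symm_iterate, label_reindex]
  set p' := (π.shiftSpace L M).φ.symm^[n] p
  funext l
  -- The two points (y_{θ l}, z) and (y_{θ' l}, z) have the same `Z`-coordinates, and at time −n
  -- also the same symbol, so `past_eq` covers all earlier times.
  have h1 := Q.past_eq (π.reindex M (fun _ => θ l) p') (π.reindex M (fun _ => θ' l) p') rfl
    ((congrFun hp (θ l)).trans ((congrFun h l).trans (congrFun hp (θ' l)).symm)) j
  rwa [← reindex_symm_iterate, ← reindex_symm_iterate] at h1

/-- Holonomy preserving the itineraries up to time `-n`. -/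
def Hol (n : ℕ) (E F : CompactOpen (π.shiftSpace L M)) : Prop :=
  LeafHomeo (π.shiftSpace L M).φ E.1 F.1 (Q.SamePast n)

/-- Additivity and invariance under holonomy preserving the itineraries up to time `-n`. -/
def relations (n L : ℕ) : AddSubgroup (FreeAbelianGroup (CompactOpen (π.shiftSpace L M))) :=
  AddSubgroup.closure ({x | ∃ E F H : CompactOpen (π.shiftSpace L M), Disjoint E.1 F.1 ∧
      H.1 = E.1 ∪ F.1 ∧ x = .of H - .of E - .of F} ∪
    {x | ∃ E F, Q.Hol n E F ∧ x = .of E - .of F})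

/-- The approximation of `D^s(Σ_{L,M})` in which only sets related by a holonomy preserving the
itineraries up to time `-n` are identified. -/
abbrev Approx (n L : ℕ) : Type _ :=
  FreeAbelianGroup (CompactOpen (π.shiftSpace L M)) ⧸ Q.relations n L

/-- The class of a compact open set. -/
def cls (n : ℕ) (E : CompactOpen (π.shiftSpace L M)) : Q.Approx n L :=
  QuotientAddGroup.mk (.of E)

lemma cls_eq {n : ℕ} {E F : CompactOpen (π.shiftSpace L M)} (h : Q.Hol n E F) :
    Q.cls n E = Q.cls n F := by
  rw [← sub_eq_zero]
  exact (QuotientAddGroup.eq_zero_iff _).mpr (AddSubgroup.subset_closure (Or.inr ⟨E, F, h, rfl⟩))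

lemma isAdditive_cls (n : ℕ) :
    CompactOpen.IsAdditive (Q.cls n : CompactOpen (π.shiftSpace L M) → Q.Approx n L) := by
  intro E F H hd hH
  rw [← sub_eq_zero, ← sub_sub]
  exact (QuotientAddGroup.eq_zero_iff _).mpr
    (AddSubgroup.subset_closure (Or.inl ⟨E, F, H, hd, hH, rfl⟩))

lemma relations_le_ker {n : ℕ} {G : Type*} [AddCommGroup G]
    {μ : CompactOpen (π.shiftSpace L M) → G} (hμ : CompactOpen.IsAdditive μ)
    (h : ∀ E F, Q.Hol n E F → μ E = μ F) : Q.relations n L ≤ (FreeAbelianGroup.lift μ).ker := by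
  refine (AddSubgroup.closure_le _).mpr ?_
  rintro _ (⟨E, F, H, hd, hH, rfl⟩ | ⟨E, F, hEF, rfl⟩)
  · change FreeAbelianGroup.lift μ _ = 0
    simp [hμ E F H hd hH]
  · change FreeAbelianGroup.lift μ _ = 0
    simp [h E F hEF]

/-- Additive holonomy invariant functions extend to homomorphisms. -/
noncomputable def lift {n : ℕ} {G : Type*} [AddCommGroup G] (μ : CompactOpen (π.shiftSpace L M) → G)
    (hμ : CompactOpen.IsAdditive μ) (h : ∀ E F, Q.Hol n E F → μ E = μ F) : Q.Approx n L →+ G :=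
  QuotientAddGroup.lift _ (FreeAbelianGroup.lift μ) (Q.relations_le_ker hμ h)

lemma lift_cls {n : ℕ} {G : Type*} [AddCommGroup G] (μ : CompactOpen (π.shiftSpace L M) → G)
    (hμ : CompactOpen.IsAdditive μ) (h : ∀ E F, Q.Hol n E F → μ E = μ F)
    (E : CompactOpen (π.shiftSpace L M)) : Q.lift μ hμ h (Q.cls n E) = μ E :=
  FreeAbelianGroup.lift_apply_of _ _

lemma hom_ext {n : ℕ} {G : Type*} [AddCommGroup G] {f g : Q.Approx n L →+ G}
    (h : ∀ E, f (Q.cls n E) = g (Q.cls n E)) : f = g :=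
  QuotientAddGroup.addMonoidHom_ext _ (FreeAbelianGroup.lift_ext _ _ h)

lemma hol_map {n : ℕ} (θ : Fin (K + 1) → Fin (L + 1)) {E F : CompactOpen (π.shiftSpace L M)}
    (h : Q.Hol n E F) : Q.Hol n (E.map (π.reindex_isStrict M θ).toIsSBijective)
      (F.map (π.reindex_isStrict M θ).toIsSBijective) :=
  LeafHomeo.map E.2.1 F.2.1 (π.reindex_isStrict M θ).toIsSBijective
    (π.reindex_isStrict M θ).toIsSBijective h fun _ _ _ _ hxy => Q.samePast_reindex hxy θ

/-- The homomorphism induced by a reindexing map. -/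
noncomputable def pull (n : ℕ) (θ : Fin (K + 1) → Fin (L + 1)) : Q.Approx n L →+ Q.Approx n K :=
  Q.lift (fun E => Q.cls n (E.map (π.reindex_isStrict M θ).toIsSBijective))
    ((Q.isAdditive_cls n).map _) fun _ _ h => Q.cls_eq (Q.hol_map θ h)

lemma pull_cls (n : ℕ) (θ : Fin (K + 1) → Fin (L + 1)) (E : CompactOpen (π.shiftSpace L M)) :
    Q.pull n θ (Q.cls n E) = Q.cls n (E.map (π.reindex_isStrict M θ).toIsSBijective) :=
  Q.lift_cls _ _ _ E

/-- The label at time `-n`. -/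
noncomputable def pastLabel (n : ℕ) (p : π.Shift L M) : Fin (L + 1) → Fin Q.size :=
  Q.label ((π.shiftSpace L M).φ.symm^[n] p)

lemma leafConstant_pastLabel (n : ℕ) (E : Set (π.Shift L M)) :
    LeafConstant (π.shiftSpace L M).φ fun x : E => Q.pastLabel n (x : π.Shift L M) :=
  SmaleSpace.leafConstant_comp (q := Q.label) (Q.label_eq_of_dist_lt L) ((π.shiftSpace L M).isMap_symm_iterate n) E

/-- The part of a compact open set with a given label at time `-n`. -/
noncomputable def part (n : ℕ) (a : Fin (L + 1) → Fin Q.size) (E : CompactOpen (π.shiftSpace L M)) :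
    CompactOpen (π.shiftSpace L M) :=
  E.cut (fun x => Q.pastLabel n x) (Q.leafConstant_pastLabel n E.1) {a}

lemma part_val (n : ℕ) (a : Fin (L + 1) → Fin Q.size) (E : CompactOpen (π.shiftSpace L M)) :
    (Q.part n a E).1 = E.1 ∩ Q.pastLabel n ⁻¹' {a} :=
  CompactOpen.cut_val _ _ _ _

lemma hol_part {n : ℕ} (a : Fin (L + 1) → Fin Q.size) {E F : CompactOpen (π.shiftSpace L M)}
    (h : Q.Hol n E F) : Q.Hol n (Q.part n a E) (Q.part n a F) := by
  unfold Hol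
  rw [part_val, part_val]
  exact h.inter_preimage _ (fun x y hxy => hxy n le_rfl) _

/-- The component with a given label. -/
noncomputable def proj (n : ℕ) (a : Fin (L + 1) → Fin Q.size) : Q.Approx n L →+ Q.Approx n L :=
  Q.lift (fun E => Q.cls n (Q.part n a E))
    ((Q.isAdditive_cls n).cut _ (fun E => Q.leafConstant_pastLabel n E) {a})
    fun _ _ h => Q.cls_eq (Q.hol_part a h)

lemma proj_cls (n : ℕ) (a : Fin (L + 1) → Fin Q.size) (E : CompactOpen (π.shiftSpace L M)) :
    Q.proj n a (Q.cls n E) = Q.cls n (Q.part n a E) :=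
  Q.lift_cls _ _ _ E

lemma pastLabel_of_mem_map_part {n : ℕ} {a : Fin (L + 1) → Fin Q.size}
    {θ : Fin (K + 1) → Fin (L + 1)} {E : CompactOpen (π.shiftSpace L M)} {p : π.Shift K M}
    (hp : p ∈ ((Q.part n a E).map (π.reindex_isStrict M θ).toIsSBijective).1) :
    Q.pastLabel n p = a ∘ θ := by
  obtain ⟨p, hp, rfl⟩ := hp
  rw [part_val] at hp
  rw [pastLabel, ← reindex_symm_iterate, label_reindex]
  exact congrArg (· ∘ θ) hp.2

/-- The approximations form a labelled system. -/
noncomputable def system (n : ℕ) : LabelledSystem (Fin Q.size) where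
  obj := Q.Approx n
  pull := Q.pull n
  proj := Q.proj n
  pull_pull θ τ x := by
    suffices h : (Q.pull n τ).comp (Q.pull n θ) = Q.pull n (θ ∘ τ) from DFunLike.congr_fun h x
    refine Q.hom_ext fun E => ?_
    simp only [AddMonoidHom.comp_apply, pull_cls]
    congr 1
    exact Subtype.ext (Set.image_comp (π.reindex M τ) (π.reindex M θ) E.1).symm
  pull_id {L} x := by
    suffices h : Q.pull n id = AddMonoidHom.id (Q.Approx n L) from DFunLike.congr_fun h x
    refine Q.hom_ext fun E => ?_
    simp only [AddMonoidHom.id_apply, pull_cls]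
    congr 1
    exact Subtype.ext (Set.image_id E.1)
  sum_proj {L} x := by
    suffices h : ∑ a, Q.proj n a = AddMonoidHom.id (Q.Approx n L) by
      have := DFunLike.congr_fun h x
      simpa only [AddMonoidHom.finsetSum_apply, AddMonoidHom.id_apply] using this
    refine Q.hom_ext fun E => ?_
    simp only [AddMonoidHom.finsetSum_apply, proj_cls, AddMonoidHom.id_apply]
    exact (Q.isAdditive_cls n).sum_cut E _ (Q.leafConstant_pastLabel n E.1)
  proj_pull_proj θ a x := by
    suffices h : (Q.proj n (a ∘ θ)).comp ((Q.pull n θ).comp (Q.proj n a)) =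
        (Q.pull n θ).comp (Q.proj n a) from DFunLike.congr_fun h x
    refine Q.hom_ext fun E => ?_
    simp only [AddMonoidHom.comp_apply, pull_cls, proj_cls]
    congr 1
    refine Subtype.ext ?_
    rw [part_val]
    exact Set.inter_eq_left.mpr fun p hp => Q.pastLabel_of_mem_map_part hp
  proj_pull_proj_of_ne θ a b x hb := by
    suffices h : (Q.proj n b).comp ((Q.pull n θ).comp (Q.proj n a)) = 0 from DFunLike.congr_fun h x
    refine Q.hom_ext fun E => ?_
    simp only [AddMonoidHom.comp_apply, pull_cls, proj_cls]
    refine (Q.isAdditive_cls n).eq_zero ?_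
    rw [part_val]
    refine Set.eq_empty_of_forall_notMem fun p hp => hb ?_
    rw [← Q.pastLabel_of_mem_map_part hp.1]
    exact hp.2.symm
  pull_congr θ θ' a x h := by
    suffices h : (Q.pull n θ).comp (Q.proj n a) = (Q.pull n θ').comp (Q.proj n a) from
      DFunLike.congr_fun h x
    refine Q.hom_ext fun E => ?_
    simp only [AddMonoidHom.comp_apply, pull_cls, proj_cls]
    -- The identity of the part labelled `a` induces the holonomy between its two images.
    refine Q.cls_eq (LeafHomeo.map (r := Eq) (Q.part n a E).2.1 (Q.part n a E).2.1
      (π.reindex_isStrict M θ).toIsSBijective (π.reindex_isStrict M θ').toIsSBijective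
      (.refl fun _ => rfl) ?_)
    rintro p hp _ _ rfl
    rw [part_val] at hp
    exact Q.samePast_reindex_of_label hp.2 h

/-! ### Passage to the limit -/

lemma hol_mono {m n : ℕ} (hmn : m ≤ n) {E F : CompactOpen (π.shiftSpace L M)} (h : Q.Hol m E F) :
    Q.Hol n E F :=
  LeafHomeo.mono h fun _ _ hxy k hk => hxy k (hmn.trans hk)

lemma relations_mono (L : ℕ) : Monotone fun n => Q.relations n L := by
  intro m n hmn
  refine AddSubgroup.closure_mono (Set.union_subset_union_right _ ?_)
  rintro _ ⟨E, F, h, rfl⟩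
  exact ⟨E, F, Q.hol_mono hmn h, rfl⟩

/-- The transition maps between the approximations. -/
noncomputable def trans (n L : ℕ) : Q.Approx 0 L →+ Q.Approx n L :=
  Q.lift (Q.cls n) (Q.isAdditive_cls n) fun _ _ h => Q.cls_eq (Q.hol_mono (Nat.zero_le n) h)

lemma trans_cls (n : ℕ) (E : CompactOpen (π.shiftSpace L M)) :
    Q.trans n L (Q.cls 0 E) = Q.cls n E :=
  Q.lift_cls _ _ _ E

lemma trans_pull (n : ℕ) (θ : Fin (K + 1) → Fin (L + 1)) (x : Q.Approx 0 L) :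
    Q.trans n K (Q.pull 0 θ x) = Q.pull n θ (Q.trans n L x) := by
  suffices h : (Q.trans n K).comp (Q.pull 0 θ) = (Q.pull n θ).comp (Q.trans n L) from
    DFunLike.congr_fun h x
  refine Q.hom_ext fun E => ?_
  simp only [AddMonoidHom.comp_apply, pull_cls, trans_cls]

lemma trans_bdy (n : ℕ) (x : (Q.system 0).obj (L + 1)) :
    Q.trans n L ((Q.system 0).bdy L x) = (Q.system n).bdy L (Q.trans n (L + 1) x) := by
  refine ((Q.system 0).hom_bdy (G := Q.Approx n L) (Q.trans n L) x).trans
    (Eq.trans ?_ ((Q.system n).bdy_apply (Q.trans n (L + 1) x)).symm)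
  exact Finset.sum_congr rfl fun l _ => congrArg (fun y => (-1 : ℤ) ^ (l : ℕ) • y)
    (Q.trans_pull n l.succAbove x)

lemma trans_mem_DC (n : ℕ) {x : (Q.system 0).obj L} (hx : x ∈ (Q.system 0).DC L) :
    (Q.trans n L x : (Q.system n).obj L) ∈ (Q.system n).DC L := by
  refine (Q.system 0).hom_mem_of_mem_DC (G := (Q.system n).obj L) (Q.trans n L) _
    (fun i j y hij => ?_) (fun α y => ?_) hx
  · exact (Q.system n).mem_DC_of_eq_pull_update hij _ (Q.trans_pull n _ y)
  · exact (Q.system n).sub_mem_DC_of_eq_pull α (Q.trans n L y) (Q.trans_pull n _ y)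

/-- Sets with the same class in an approximation have the same class in `D^s`. -/
def IsFine (L : ℕ) : Prop :=
  ∀ (n : ℕ) (E F : CompactOpen (π.shiftSpace L M)), Q.Hol n E F → dimClass E = dimClass F

/-- The homomorphism from an approximation to `D^s(Σ_{L,M})`. -/
noncomputable def toChains (n : ℕ) (hQ : Q.IsFine L) : Q.Approx n L →+ π.chains L M :=
  Q.lift (G := DimGroup (π.shiftSpace L M)) dimClass CompactOpen.isAdditive_dimClass (hQ n)

lemma toChains_cls (n : ℕ) (hQ : Q.IsFine L) (E : CompactOpen (π.shiftSpace L M)) :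
    Q.toChains n hQ (Q.cls n E) = dimClass E :=
  Q.lift_cls (G := DimGroup (π.shiftSpace L M)) _ _ _ E

lemma toChains_pull (n : ℕ) (hK : Q.IsFine K) (hL : Q.IsFine L) (θ : Fin (K + 1) → Fin (L + 1))
    (x : Q.Approx n L) :
    Q.toChains n hK (Q.pull n θ x) = π.pull M θ (Q.toChains n hL x) := by
  suffices h : (Q.toChains n hK).comp (Q.pull n θ) = (π.pull M θ).comp (Q.toChains n hL) from
    DFunLike.congr_fun h x
  refine Q.hom_ext fun E => ?_
  simp only [AddMonoidHom.comp_apply, pull_cls, toChains_cls]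
  exact (dimMap_dimClass (π.reindex_isStrict M θ) E).symm

lemma toChains_bdy (n : ℕ) (hL : Q.IsFine L) (hL' : Q.IsFine (L + 1))
    (x : (Q.system n).obj (L + 1)) :
    Q.toChains n hL ((Q.system n).bdy L x) = π.boundary L M (Q.toChains n hL' x) := by
  refine ((Q.system n).hom_bdy (G := π.chains L M) (Q.toChains n hL) x).trans
    (Eq.trans ?_ (π.boundary_apply (Q.toChains n hL' x)).symm)
  exact Finset.sum_congr rfl fun l _ => congrArg (fun y => (-1 : ℤ) ^ (l : ℕ) • y)
    (Q.toChains_pull n hL hL' l.succAbove x)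

lemma toChains_trans (n : ℕ) (hL : Q.IsFine L) (x : Q.Approx 0 L) :
    Q.toChains n hL (Q.trans n L x) = Q.toChains 0 hL x := by
  suffices h : (Q.toChains n hL).comp (Q.trans n L) = Q.toChains 0 hL from DFunLike.congr_fun h x
  refine Q.hom_ext fun E => ?_
  simp only [AddMonoidHom.comp_apply, trans_cls, toChains_cls]
  rfl

lemma toChains_surjective (n : ℕ) (hL : Q.IsFine L) : Function.Surjective (Q.toChains n hL) := by
  suffices h : (Q.toChains n hL).range = ⊤ from AddMonoidHom.range_eq_top.mp h
  refine eq_top_iff.mpr fun c hc => ?_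
  clear hc
  obtain ⟨c, rfl⟩ := QuotientAddGroup.mk_surjective c
  have hm : ∀ E, dimClass E ∈ (Q.toChains n hL).range := fun E => ⟨Q.cls n E, Q.toChains_cls n hL E⟩
  induction c using FreeAbelianGroup.induction_on with
  | zero => exact zero_mem _
  | of q =>
    induction q using Quotient.inductionOn with
    | h E => exact hm E
  | neg q ih => exact neg_mem ih
  | add x y hx hy => exact add_mem hx hy

lemma toChains_mem_DC (n : ℕ) (hL : Q.IsFine L) {x : (Q.system n).obj L}
    (hx : x ∈ (Q.system n).DC L) : Q.toChains n hL x ∈ π.DC M L := by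
  refine (Q.system n).hom_mem_of_mem_DC (G := π.chains L M) (Q.toChains n hL) _
    (fun i j y hij => ?_) (fun α y => ?_) hx
  · refine AddSubgroup.mem_sup_left ((congrArg (· ∈ π.degenerate M L)
      (Q.toChains_pull n hL hL (Function.update id j i) y)).mpr ?_)
    rcases lt_or_gt_of_ne hij with h | h
    · exact π.pull_mem_degenerate _ i j h (by simp [Function.update_of_ne hij]) _
    · exact π.pull_mem_degenerate _ j i h (by simp [Function.update_of_ne hij]) _
  · exact AddSubgroup.mem_sup_right ((congrArg (fun z : π.chains L M =>
      z - (Equiv.Perm.sign α : ℤ) • Q.toChains n hL y ∈ π.signed M L)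
      (Q.toChains_pull n hL hL _ y)).mpr (π.perm_sub_mem α _))

/-- The map from an approximation is surjective and commutes with reindexings, so every generator of
the degenerate chains lifts to one of the same kind. -/
lemma exists_mem_DC (n : ℕ) (hL : Q.IsFine L) (hL' : Q.IsFine (L + 1)) {c : π.chains (L + 1) M}
    (hc : c ∈ π.DC M (L + 1)) :
    ∃ x ∈ (Q.system n).DC (L + 1), Q.toChains n hL' x = c := by
  let f : (Q.system n).obj (L + 1) →+ π.chains (L + 1) M := Q.toChains n hL'
  suffices h : π.DC M (L + 1) ≤ ((Q.system n).DC (L + 1)).map f from h hc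
  refine sup_le (iSup_le fun l => iSup_le fun q => iSup_le fun hlq => ?_)
    ((AddSubgroup.closure_le _).mpr ?_)
  · rintro _ ⟨c, rfl⟩
    obtain ⟨y, rfl⟩ := Q.toChains_surjective n hL c
    refine ⟨_, (Q.system n).pull_mem_DC (Fin.insertNth (α := fun _ => Fin (L + 1)) q l id)
      (fun h => ?_) y, Q.toChains_pull n hL' hL _ y⟩
    refine Fin.succAbove_ne q l (h ?_)
    simp
  · rintro _ ⟨α, c, rfl⟩
    obtain ⟨y, rfl⟩ : ∃ y, f y = c := Q.toChains_surjective n hL' c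
    refine ⟨_, (Q.system n).sub_mem_DC_of_eq_pull α y rfl, ?_⟩
    rw [map_sub, map_zsmul]
    exact congrArg (fun z : π.chains (L + 1) M =>
      z - (Equiv.Perm.sign α : ℤ) • Q.toChains n hL' y) (Q.toChains_pull n hL' hL' _ y)

/-- An element that vanishes in `D^s` vanishes in some approximation. -/
lemma exists_trans_eq_zero (hL : Q.IsFine L) {x : Q.Approx 0 L} (hx : Q.toChains 0 hL x = 0) :
    ∃ n, Q.trans n L x = 0 := by
  obtain ⟨b, rfl⟩ := QuotientAddGroup.mk_surjective x
  -- Dividing by all levels at once recovers D^s: ∼ is absorbed by the holonomy relations, so the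
  -- quotient by `R` receives a map `g` from D^s. An element that dies in D^s thus lies in `R`, and
  -- in one level because the levels increase.
  let R := ⨆ n, Q.relations n L
  have hR : ∀ E F : CompactOpen (π.shiftSpace L M), DimRel (π.shiftSpace L M) E F →
      (QuotientAddGroup.mk (.of E) : _ ⧸ R) = QuotientAddGroup.mk (.of F) := fun E F h => by
    obtain ⟨n, hn⟩ := SmaleSpace.exists_leafHomeo_of_dimRel (Q.label_eq_of_dist_lt L) h
    rw [← sub_eq_zero]
    exact (QuotientAddGroup.eq_zero_iff _).mpr (AddSubgroup.mem_iSup_of_mem n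
      (AddSubgroup.subset_closure (Or.inr ⟨E, F, hn, rfl⟩)))
  let g₀ : FreeAbelianGroup (Quotient (dimSetoid (π.shiftSpace L M))) →+ _ ⧸ R :=
    FreeAbelianGroup.lift (Quotient.lift
      (fun E => (QuotientAddGroup.mk (FreeAbelianGroup.of E) : _ ⧸ R)) hR)
  have hg₀ : ∀ E, g₀ (dimGen E) = QuotientAddGroup.mk (FreeAbelianGroup.of E) := fun E =>
    FreeAbelianGroup.lift_apply_of _ _
  let g : DimGroup (π.shiftSpace L M) →+ _ ⧸ R := QuotientAddGroup.lift _ g₀ (by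
    refine (AddSubgroup.closure_le _).mpr ?_
    rintro _ ⟨E, F, H, hd, hH, rfl⟩
    change g₀ _ = 0
    rw [map_sub, map_sub, hg₀, hg₀, hg₀]
    exact (QuotientAddGroup.eq_zero_iff _).mpr (AddSubgroup.mem_iSup_of_mem 0
      (AddSubgroup.subset_closure (Or.inl ⟨E, F, H, hd, hH, rfl⟩))))
  have hg : (g.comp (Q.toChains 0 hL)).comp (QuotientAddGroup.mk' (Q.relations 0 L)) =
      QuotientAddGroup.mk' R := by
    refine FreeAbelianGroup.lift_ext _ _ fun E => ?_
    exact (congrArg g (Q.toChains_cls 0 hL E)).trans (hg₀ E)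
  have hb : (QuotientAddGroup.mk b : _ ⧸ R) = 0 := by
    refine (DFunLike.congr_fun hg b).symm.trans ?_
    exact (congrArg g hx).trans (map_zero g)
  obtain ⟨n, hn⟩ := (AddSubgroup.mem_iSup_of_directed (Q.relations_mono L).directed_le).mp
    ((QuotientAddGroup.eq_zero_iff _).mp hb)
  refine ⟨n, ?_⟩
  have ht : (Q.trans n L).comp (QuotientAddGroup.mk' (Q.relations 0 L)) =
      QuotientAddGroup.mk' (Q.relations n L) :=
    FreeAbelianGroup.lift_ext _ _ fun E => Q.trans_cls n E
  exact (DFunLike.congr_fun ht b).trans ((QuotientAddGroup.eq_zero_iff _).mpr hn)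

end Partition

end SUPair

end SmaleHomology

/-! ### Filling degenerate cycles in the dimension groups; homological conclusion -/

namespace SmaleHomology

namespace SUPair

variable {X Y Z : Type*} [MetricSpace X] [MetricSpace Y] [MetricSpace Z]
  {SX : SmaleSpace X} {SY : SmaleSpace Y} {SZ : SmaleSpace Z}
variable [CompactSpace X] [CompactSpace Y] [CompactSpace Z] (π : SUPair SX SY SZ) {L M : ℕ}

/-- Equal labels force all points (y_l, z), hence the whole tuples, to be close. The scale depends
on `L` and `M` but serves all levels n. -/
lemma exists_isFine (L M : ℕ) : ∃ δ > 0, ∀ Q : π.Partition M,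
    (∀ p p', Q.symbol p = Q.symbol p' → dist p p' ≤ δ) → Q.IsFine L := by
  obtain ⟨δ, hδ, h⟩ := (π.shiftSpace L M).exists_dimClass_eq
  refine ⟨δ, hδ, fun Q hQ n E F hEF => h Q.label (fun p p' hpp => ?_) (Q.label_eq_of_dist_lt L) n E F
    hEF⟩
  have hl : ∀ l, dist (π.reindex M (fun _ : Fin (0 + 1) => l) p) (π.reindex M (fun _ => l) p') ≤ δ :=
    fun l => hQ _ _ (congrFun hpp l)
  exact (dist_le_iff hδ.le).mpr ⟨fun l => (dist_fst_le _ _ 0).trans (hl l),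
    fun m => (dist_snd_le (π.reindex M (fun _ : Fin (0 + 1) => 0) p) (π.reindex M (fun _ => 0) p')
      m).trans (hl 0)⟩

/-- Degenerate cycles of positive degree are boundaries of degenerate chains. -/
theorem exists_boundary_eq {c : π.chains (L + 1) M} (hc : c ∈ π.DC M (L + 1))
    (h : π.boundary L M c = 0) : ∃ b ∈ π.DC M (L + 2), π.boundary (L + 1) M b = c := by
  obtain ⟨δ₀, h₀, hf₀⟩ := π.exists_isFine L M
  obtain ⟨δ₁, h₁, hf₁⟩ := π.exists_isFine (L + 1) M
  obtain ⟨δ₂, h₂, hf₂⟩ := π.exists_isFine (L + 2) M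
  -- One partition has to be fine in the three degrees involved: those of the boundary, of the cycle
  -- and of its filling.
  obtain ⟨Q, hQ⟩ := π.exists_partition M (lt_min h₀ (lt_min h₁ h₂))
  replace hf₀ := hf₀ Q fun p p' e => (hQ p p' e).trans (min_le_left _ _)
  replace hf₁ := hf₁ Q fun p p' e =>
    (hQ p p' e).trans ((min_le_right _ _).trans (min_le_left _ _))
  replace hf₂ := hf₂ Q fun p p' e =>
    (hQ p p' e).trans ((min_le_right _ _).trans (min_le_right _ _))
  obtain ⟨x, hx, rfl⟩ := Q.exists_mem_DC 0 hf₀ hf₁ hc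
  rw [← Q.toChains_bdy 0 hf₀ hf₁] at h
  -- The lift `x` is a cycle only after passage to level `n`; there it is still degenerate and can
  -- be filled.
  obtain ⟨n, hn⟩ := Q.exists_trans_eq_zero hf₀ h
  rw [Q.trans_bdy] at hn
  obtain ⟨y, hy, hyx⟩ := (Q.system n).exists_bdy_eq (Q.trans_mem_DC n hx) hn
  refine ⟨_, Q.toChains_mem_DC n hf₂ hy, ?_⟩
  rw [← Q.toChains_bdy n hf₁ hf₂]
  exact (congrArg (Q.toChains n hf₁) hyx).trans (Q.toChains_trans n hf₁ x)

/-- In degree 0 there are no degeneracies, and the only permutation of one coordinate is the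
identity. -/
lemma DC_zero (c : π.chains 0 M) (hc : c ∈ π.DC M 0) : c = 0 := by
  suffices h : π.DC M 0 ≤ ⊥ from h hc
  refine sup_le le_rfl ((AddSubgroup.closure_le _).mpr ?_)
  rintro _ ⟨α, a, rfl⟩
  rw [show α = 1 from Equiv.ext fun i => Subsingleton.elim (α := Fin 1) _ _]
  have : π.perm M (1 : Equiv.Perm (Fin (0 + 1))) a = a := by
    rw [perm, inv_one]
    exact π.pull_id a
  simp [this]

open CategoryTheory

lemma acyclic_degenerateComplex (M : ℕ) : (π.degenerateComplex M).Acyclic := by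
  intro L
  cases L with
  | zero =>
    rw [HomologicalComplex.exactAt_iff' _ 1 0 0 (by simp) (by simp), ShortComplex.ab_exact_iff]
    intro x _
    exact ⟨0, (map_zero _).trans (Subtype.ext (π.DC_zero x.1 x.2)).symm⟩
  | succ L =>
    rw [HomologicalComplex.exactAt_iff' _ (L + 2) (L + 1) L (by simp) (by simp),
      ShortComplex.ab_exact_iff]
    have hd : ∀ L, (π.degenerateComplex M).d (L + 1) L =
        AddCommGrpCat.ofHom (π.boundaryDC L M) :=
      fun L => ChainComplex.of_d (fun L => AddCommGrpCat.of (π.DC M L))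
        (fun L => AddCommGrpCat.ofHom (π.boundaryDC L M)) L
    intro x hx
    change (π.degenerateComplex M).d (L + 1) L x = 0 at hx
    rw [hd] at hx
    obtain ⟨b, hb, hbx⟩ := π.exists_boundary_eq x.2 (congrArg Subtype.val hx)
    refine ⟨⟨b, hb⟩, ?_⟩
    change (π.degenerateComplex M).d (L + 2) (L + 1) _ = x
    rw [hd]
    exact Subtype.ext hbx

lemma shortExact_shortComplex (M : ℕ) : (π.shortComplex M).ShortExact := by
  refine HomologicalComplex.shortExact_of_degreewise_shortExact _ fun L => ?_
  refine
    { exact := ?_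
      mono_f := (AddCommGrpCat.mono_iff_injective _).mpr Subtype.val_injective
      epi_g := (AddCommGrpCat.epi_iff_surjective _).mpr (QuotientAddGroup.mk'_surjective (π.DC M L)) }
  rw [ShortComplex.ab_exact_iff]
  intro x hx
  exact ⟨⟨x, (QuotientAddGroup.eq_zero_iff (N := π.DC M L) (x : π.chains L M)).mp hx⟩, rfl⟩

end SUPair

open CategoryTheory in
/-- In a short exact sequence of complexes the second map is a quasi-isomorphism if the first
complex is acyclic. -/
lemma quasiIso_g_of_acyclic {C ι : Type*} [Category C] [Abelian C] {c : ComplexShape ι}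
    {S : ShortComplex (HomologicalComplex C c)} (hS : S.ShortExact) (h : S.X₁.Acyclic) :
    QuasiIso S.g := by
  have h0 : ∀ i, Limits.IsZero (S.X₁.homology i) := fun i =>
    (HomologicalComplex.exactAt_iff_isZero_homology _ _).mp (h i)
  refine ⟨fun i => ?_⟩
  rw [quasiIsoAt_iff_isIso_homologyMap]
  have h1 : Mono (HomologicalComplex.homologyMap S.g i) :=
    (hS.homology_exact₂ i).mono_g ((h0 i).eq_of_src _ _)
  have h2 : Epi (HomologicalComplex.homologyMap S.g i) := by
    -- If there is a next degree, the connecting map has zero target. Otherwise there are no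
    -- outgoing differentials, and surjectivity in homology is inherited from the complexes.
    by_cases hi : ∃ j, c.Rel i j
    · obtain ⟨j, hij⟩ := hi
      exact (hS.homology_exact₃ i j hij).epi_f ((h0 j).eq_of_tgt _ _)
    · have := hS.epi_g
      exact HomologicalComplex.epi_homologyMap_of_epi_of_not_rel S.g i (by simpa using hi)
  exact isIso_of_mono_of_epi _

end SmaleHomology

theorem mainTheorem2 {X Y Z : Type*} [MetricSpace X] [CompactSpace X] [MetricSpace Y]
    [CompactSpace Y] [MetricSpace Z] [CompactSpace Z] {SX : SmaleHomology.SmaleSpace X}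
    {SY : SmaleHomology.SmaleSpace Y} {SZ : SmaleHomology.SmaleSpace Z}
    (π : SmaleHomology.SUPair SX SY SZ) (M : ℕ) :
    (π.shortComplex M).ShortExact ∧ (π.degenerateComplex M).Acyclic ∧
      QuasiIso (π.projection M) :=
  ⟨π.shortExact_shortComplex M, π.acyclic_degenerateComplex M,
    SmaleHomology.quasiIso_g_of_acyclic (π.shortExact_shortComplex M)
      (π.acyclic_degenerateComplex M)⟩
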